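/- Let $H$ be a real separable Hilbert space, and let $A:D(A)\subset H\to H$ be the infinitesimal generator of a strongly continuous semigroup $(e^{tA})_{t\ge 0}$ on $H$. Let $Q$ be a bounded nonnegative self-adjoint operator on $H$ with $\ker Q=\{0\}$ such that for every $t>0$ the operator $Q_t=\int_0^t e^{sA}Qe^{sA^*}\,ds$ (strong integral) is of trace class. Assume $e^{tA}(H)\subset Q_t^{1/2}(H)$ for all $t>0$, and that $\Lambda(t):=Q_t^{-1/2}e^{tA}$ satisfies $\|\Lambda(t)\|_{\mathcal L(H)}\le C_\delta/t^{\delta}$ for all $t>0$, with some $\delta\in(0,1)$ and $C_\delta>0$. Let $u_0:H\to\mathbb R$ and $B:H\to H$ be bounded and measurable. Let $(e_k)$ be an orthonormal basis of $H$, let $W_t=\sum_k W^k_te_k$ be a cylindrical Brownian motion on a probability space ($W^k$ independent standard real Brownian motions), let $W_A(t)=\int_0^t e^{(t-s)A}Q^{1/2}\,dW_s$, and let $Z_t^x=e^{tA}x+W_A(t)$ ($t\ge 0$, $x\in H$) be the Ornstein–Uhlenbeck process. Put $S_tf(x)=\mathbb E f(Z_t^x)$ for bounded measurable $f:H\to\mathbb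 R$, and define $$v^0(t,x)=\mathbb E\,u_0(Z_t^x),\qquad k^n_s(y)=\langle B(y),Dv^n(s,y)\rangle,\qquad v^{n+1}(t,x)=\int_0^t (S_{t-s}k^n_s)(x)\,ds ,$$ where $D$ is the Fréchet derivative in the space variable. The integrals $\int_0^t (S_{t-s}k^n_s)(x)\,ds$ converge absolutely for all $n\ge 0$, $t\geq 0$, $x\in H$. If $Y$ is a centered Gaussian vector in $H$ with injective covariance operator $K$, and $\eta$ is a bounded $H$-valued random vector independent of $Y$, then $\langle \eta,K^{-1/2}Y\rangle$ denotes the random variable defined as the $L^2$-limit, as $\varepsilon\downarrow0$, of $\langle (K+\varepsilon)^{-1}K^{1/2}\eta,\,Y\rangle$; it equals $\langle g,Y\rangle$ when $\eta=K^{1/2}g$ with $g$ deterministic. Then for every $n\ge1$, $t\ge0$ and $x\in H$, with $s_0=0$, $$v^{n}(t,x)=\int_{0}^{t}ds_n\int_0^{s_n}ds_{n-1}\cdots\int_{0}^{s_2}ds_1\;\mathbb E\Bigg[u_0(Z_t^x)\prod_{i=1}^n\Big\langle\Lambda(s_i-s_{i-1})B(Z_{t-s_i}^x),\,Q_{s_i-s_{i-1}}^{-1/2}\big(Z_{t-s_{i-1}}^x-e^{(s_i-s_{i-1})A}Z_{t-s_i}^x\big)\Big\rangle\Bigg],$$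 where the random variable under the expectation is integrable whenever $0<s_1<\dots<s_n<t$, and the expectation is an integrable function of $(s_1,\dots,s_n)$ on this simplex. Moreover, $v^n(t,\cdot)$ is bounded and Fréchet differentiable with bounded derivative, $$\|v^n(t)\|_\infty\le\|u_0\|_\infty\|B\|_\infty^n\int_{0}^{t}ds_n\int_0^{s_n}ds_{n-1}\cdots\int_{0}^{s_2}ds_1\prod_{i=1}^n\|\Lambda(s_i-s_{i-1})\|_{\mathcal L(H)}$$ and, with $s_{n+1}=t$, $$\|Dv^n(t)\|_\infty\le\|u_0\|_\infty\|B\|_\infty^n\int_{0}^{t}ds_n\int_0^{s_n}ds_{n-1}\cdots\int_{0}^{s_2}ds_1\prod_{i=1}^{n+1}\|\Lambda(s_i-s_{i-1})\|_{\mathcal L(H)}.$$ -/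

import Mathlib

open MeasureTheory ProbabilityTheory Filter Topology
open scoped NNReal ENNReal RealInnerProductSpace

noncomputable section

namespace Kolmogorov

variable {H : Type*} [NormedAddCommGroup H] [InnerProductSpace ℝ H]

/-! ### Strongly continuous semigroups -/

/-- A strongly continuous semigroup `t ↦ e^{tA}`, `t ≥ 0`, of bounded operators on `H`. Only the
values at times `t ≥ 0` are meaningful. -/
structure C0Semigroup (H : Type*) [NormedAddCommGroup H] [InnerProductSpace ℝ H] where
  toFun : ℝ → H →L[ℝ] H
  map_zero : toFun 0 = ContinuousLinearMap.id ℝ H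
  map_add : ∀ s t, 0 ≤ s → 0 ≤ t → toFun (s + t) = (toFun s).comp (toFun t)
  strong_cont : ∀ x, ContinuousOn (fun t => toFun t x) (Set.Ici 0)

instance : CoeFun (C0Semigroup H) (fun _ => ℝ → H →L[ℝ] H) := ⟨C0Semigroup.toFun⟩

/-- The unbounded operator `A : D(A) ⊆ H → H` is the infinitesimal generator of `T`:
`x ∈ D(A)` and `A x = y` exactly when `(T t x - x) / t → y` as `t ↓ 0`. -/
def IsGenerator (A : H →ₗ.[ℝ] H) (T : C0Semigroup H) : Prop :=
  ∀ x y : H, (x, y) ∈ A.graph ↔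
    Tendsto (fun t : ℝ => t⁻¹ • (T t x - x)) (𝓝[>] 0) (𝓝 y)

/-! ### Trace class operators and square roots -/

/-- Trace class (nuclear) operators: `L = ∑ₙ ⟨aₙ, ·⟩ bₙ` with `∑ₙ ‖aₙ‖ ‖bₙ‖ < ∞`. -/
def IsTraceClass (L : H →L[ℝ] H) : Prop :=
  ∃ a b : ℕ → H, Summable (fun n => ‖a n‖ * ‖b n‖) ∧
    ∀ x, HasSum (fun n => ⟪a n, x⟫ • b n) (L x)

/-- Taylor coefficients of `(1 - √(1 - z)) / z`. -/
def sqrtCoeff (k : ℕ) : ℝ := (catalan k : ℝ) / 2 ^ (2 * k + 1)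

theorem sqrtCoeff_nonneg (k : ℕ) : 0 ≤ sqrtCoeff k := by
  unfold sqrtCoeff; positivity

theorem sqrtCoeff_zero : sqrtCoeff 0 = 1 / 2 := by simp [sqrtCoeff]

theorem sqrtCoeff_succ (k : ℕ) : sqrtCoeff (k + 1) =
    1 / 2 * ∑ p ∈ Finset.HasAntidiagonal.antidiagonal k, sqrtCoeff p.1 * sqrtCoeff p.2 := by
  simp only [sqrtCoeff, catalan_succ', Nat.cast_sum, Nat.cast_mul, Finset.sum_div, Finset.mul_sum]
  refine Finset.sum_congr rfl (fun p hp => ?_)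
  rw [Finset.HasAntidiagonal.mem_antidiagonal] at hp
  rw [← hp]
  field_simp
  ring

theorem sum_sqrtCoeff_le (n : ℕ) : ∑ k ∈ Finset.range n, sqrtCoeff k ≤ 1 := by
  induction n with
  | zero => simp
  | succ n ih =>
    rw [Finset.sum_range_succ']
    have h1 : ∑ k ∈ Finset.range n, sqrtCoeff (k + 1)
        ≤ 1 / 2 * (∑ k ∈ Finset.range n, sqrtCoeff k) ^ 2 := by
      simp only [sqrtCoeff_succ]
      rw [← Finset.mul_sum, sq, Finset.sum_mul_sum, ← Finset.sum_product',
        ← Finset.sum_biUnion]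
      · refine mul_le_mul_of_nonneg_left (Finset.sum_le_sum_of_subset_of_nonneg ?_
          (fun p _ _ => mul_nonneg (sqrtCoeff_nonneg _) (sqrtCoeff_nonneg _))) (by norm_num)
        intro p hp
        simp only [Finset.mem_biUnion, Finset.mem_range, Finset.HasAntidiagonal.mem_antidiagonal] at hp
        obtain ⟨a, ha, hp⟩ := hp
        simp only [Finset.mem_product, Finset.mem_range]
        omega
      · intro a _ b _ hab
        refine Finset.disjoint_left.2 (fun p hp hp' => hab ?_)
        rw [Finset.HasAntidiagonal.mem_antidiagonal] at hp hp'
        omega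
    have h2 : (0 : ℝ) ≤ ∑ k ∈ Finset.range n, sqrtCoeff k :=
      Finset.sum_nonneg (fun k _ => sqrtCoeff_nonneg k)
    rw [sqrtCoeff_zero]
    nlinarith

theorem norm_one_sub_le (K : H →L[ℝ] H) (hK : K.IsPositive) (hK1 : ‖K‖ ≤ 1) : ‖1 - K‖ ≤ 1 := by
  refine ContinuousLinearMap.opNorm_le_bound _ zero_le_one (fun x => ?_)
  have h1 := hK.inner_nonneg_left (x - K x)
  have h2 : ⟪K (K x), K x⟫ ≤ ‖K x‖ ^ 2 := by
    refine (real_inner_le_norm _ _).trans ?_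
    have := K.le_of_opNorm_le hK1 (K x)
    nlinarith [norm_nonneg (K x)]
  have h3 : ⟪K (K x), x⟫ = ⟪K x, K x⟫ := hK.inner_left_eq_inner_right _ _
  simp only [map_sub, inner_sub_left, inner_sub_right] at h1
  rw [h3, real_inner_self_eq_norm_sq] at h1
  have h4 : ‖x - K x‖ ^ 2 ≤ ‖x‖ ^ 2 := by
    rw [norm_sub_sq_real, real_inner_comm]
    nlinarith
  rw [one_mul]
  exact abs_le_of_sq_le_sq' h4 (norm_nonneg _) |>.2

theorem exists_sqrt [CompleteSpace H] (L : H →L[ℝ] H) (hL : L.IsPositive) :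
    ∃ S : H →L[ℝ] H, S.IsPositive ∧ S.comp S = L := by
  by_cases h0 : L = 0
  · exact ⟨0, ContinuousLinearMap.isPositive_zero, by simp [h0]⟩
  have hn : 0 < ‖L‖ := norm_pos_iff.2 h0
  set K : H →L[ℝ] H := ‖L‖⁻¹ • L with hKdef
  have hK : K.IsPositive := hL.smul_of_nonneg (by positivity)
  have hK1 : ‖K‖ ≤ 1 := by
    rw [hKdef, norm_smul, norm_inv, norm_norm, inv_mul_cancel₀ hn.ne']
  set X : H →L[ℝ] H := 1 - K with hX
  have hX1 : ‖X‖ ≤ 1 := norm_one_sub_le K hK hK1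
  have hXs : IsSelfAdjoint X := (IsSelfAdjoint.one _).sub hK.isSelfAdjoint
  have hpow : ∀ n, ‖X ^ n‖ ≤ 1 := by
    intro n
    rcases Nat.eq_zero_or_pos n with rfl | hn
    · rw [pow_zero]; exact ContinuousLinearMap.norm_id_le
    · exact (norm_pow_le' X hn).trans (pow_le_one₀ (norm_nonneg _) hX1)
  have hcs : Summable sqrtCoeff :=
    summable_of_sum_range_le sqrtCoeff_nonneg sum_sqrtCoeff_le
  have hct : ∑' n, sqrtCoeff n ≤ 1 := Real.tsum_le_of_sum_range_le sqrtCoeff_nonneg sum_sqrtCoeff_le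
  have hb : ∀ n, ‖sqrtCoeff n • X ^ n‖ ≤ sqrtCoeff n := by
    intro n
    rw [norm_smul, Real.norm_of_nonneg (sqrtCoeff_nonneg n)]
    exact mul_le_of_le_one_right (sqrtCoeff_nonneg n) (hpow n)
  have hns : Summable (fun n => ‖sqrtCoeff n • X ^ n‖) :=
    Summable.of_nonneg_of_le (fun _ => norm_nonneg _) hb hcs
  set G : H →L[ℝ] H := ∑' n, sqrtCoeff n • X ^ n with hG
  have hG1 : ‖G‖ ≤ 1 :=
    (norm_tsum_le_tsum_norm hns).trans ((hns.tsum_le_tsum hb hcs).trans hct)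
  have hGs : IsSelfAdjoint G := by
    rw [IsSelfAdjoint, hG, tsum_star]
    refine tsum_congr (fun n => ?_)
    rw [star_smul, (hXs.pow n).star_eq, star_trivial]
  have hcomm : Commute X G := by
    refine Commute.tsum_right _ (fun n => ?_)
    exact ((Commute.refl X).pow_right n).smul_right _
  have hGG : G = (1 / 2 : ℝ) • 1 + (1 / 2 : ℝ) • (X * (G * G)) := by
    have e1 : G * G = ∑' n, ∑ p ∈ Finset.HasAntidiagonal.antidiagonal n,
        (sqrtCoeff p.1 • X ^ p.1) * (sqrtCoeff p.2 • X ^ p.2) :=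
      tsum_mul_tsum_eq_tsum_sum_antidiagonal_of_summable_norm hns hns
    have hs2 := (summable_norm_sum_mul_antidiagonal_of_summable_norm hns hns).of_norm
    conv_lhs => rw [hG, hns.of_norm.tsum_eq_zero_add]
    rw [e1, ← hs2.tsum_mul_left, ← tsum_const_smul'' ]
    rw [sqrtCoeff_zero, pow_zero]
    congr 1
    refine tsum_congr (fun n => ?_)
    rw [sqrtCoeff_succ, mul_smul, Finset.sum_smul, Finset.mul_sum]
    congr 1
    refine Finset.sum_congr rfl (fun p hp => ?_)
    rw [Finset.HasAntidiagonal.mem_antidiagonal] at hp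
    rw [smul_mul_smul_comm, mul_smul_comm, ← pow_add, hp, pow_succ']
  have hY : ‖X * G‖ ≤ 1 := (norm_mul_le _ _).trans (mul_le_one₀ hX1 (norm_nonneg _) hG1)
  have hYs : IsSelfAdjoint (X * G) := (hXs.commute_iff hGs).1 hcomm
  have hR : (1 - X * G : H →L[ℝ] H).IsPositive := by
    refine (ContinuousLinearMap.isPositive_iff' _).2 ⟨(IsSelfAdjoint.one _).sub hYs, fun x => ?_⟩
    have h1 : ⟪(X * G) x, x⟫ ≤ ‖x‖ ^ 2 := by
      refine (real_inner_le_norm _ _).trans ?_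
      have := (X * G).le_of_opNorm_le hY x
      nlinarith [norm_nonneg x]
    change 0 ≤ ⟪x - (X * G) x, x⟫
    rw [inner_sub_left, real_inner_self_eq_norm_sq]
    linarith
  have hRR : (1 - X * G) * (1 - X * G) = K := by
    have e : (1 - X * G) * (1 - X * G) = 1 - (2 : ℝ) • (X * G) + X * (X * (G * G)) := by
      have : X * G * (X * G) = X * (X * (G * G)) := by
        rw [mul_assoc, ← mul_assoc G X G, ← hcomm.eq, mul_assoc]
      rw [sub_mul, mul_sub, mul_sub, this, two_smul]
      simp only [one_mul, mul_one]
      abel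
    have e2 : (2 : ℝ) • (X * G) = X + X * (X * (G * G)) := by
      conv_lhs => rw [hGG]
      rw [mul_add, smul_add, mul_smul_comm, mul_smul_comm, smul_smul, smul_smul]
      norm_num
    rw [e, e2, hX]
    abel
  refine ⟨Real.sqrt ‖L‖ • (1 - X * G), hR.smul_of_nonneg (Real.sqrt_nonneg _), ?_⟩
  change (Real.sqrt ‖L‖ • (1 - X * G)) * (Real.sqrt ‖L‖ • (1 - X * G)) = L
  rw [smul_mul_smul_comm, hRR, Real.mul_self_sqrt hn.le, hKdef, smul_smul,
    mul_inv_cancel₀ hn.ne', one_smul]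

open scoped Classical in
/-- The nonnegative self-adjoint square root `L^{1/2}` of a nonnegative self-adjoint bounded
operator `L`; it exists by `opSqrt_spec` below, and it is unique. -/
def opSqrt (L : H →L[ℝ] H) : H →L[ℝ] H :=
  if h : ∃ S : H →L[ℝ] H, S.IsPositive ∧ S.comp S = L then h.choose else 0

theorem opSqrt_spec [CompleteSpace H] (L : H →L[ℝ] H) (hL : L.IsPositive) :
    (opSqrt L).IsPositive ∧ (opSqrt L).comp (opSqrt L) = L := by
  have h := exists_sqrt L hL
  rw [opSqrt, dif_pos h]
  exact h.choose_spec

theorem countable_of_orthonormal [TopologicalSpace.SeparableSpace H] {ι : Type*} {v : ι → H}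
    (hv : Orthonormal ℝ v) : Countable ι := by
  refine Pairwise.countable_of_isOpen_disjoint (s := fun i => Metric.ball (v i) (1 / 2)) ?_
    (fun i => Metric.isOpen_ball) (fun i => ⟨v i, Metric.mem_ball_self (by norm_num)⟩)
  intro i j hij
  refine Metric.ball_disjoint_ball ?_
  rw [dist_eq_norm]
  have h : ‖v i - v j‖ ^ 2 = 2 := by
    rw [norm_sub_sq_real, hv.1 i, hv.1 j, hv.2 hij]
    norm_num
  nlinarith [norm_nonneg (v i - v j)]

/-! ### The covariance operators `Q_t` -/

section Covariance

variable [CompleteSpace H]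

theorem C0Semigroup.exists_bound (T : C0Semigroup H) (t : ℝ) :
    ∃ M : ℝ, 0 ≤ M ∧ ∀ s ∈ Set.Icc 0 t, ‖T s‖ ≤ M := by
  have h : ∀ x, ∃ C, ∀ s : Set.Icc (0 : ℝ) t, ‖T (s : ℝ) x‖ ≤ C := by
    intro x
    have hc : ContinuousOn (fun s => T s x) (Set.Icc 0 t) :=
      (T.strong_cont x).mono Set.Icc_subset_Ici_self
    obtain ⟨C, hC⟩ := isCompact_Icc.exists_bound_of_continuousOn hc
    exact ⟨C, fun s => hC s s.2⟩
  obtain ⟨C, hC⟩ := banach_steinhaus h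
  exact ⟨max C 0, le_max_right _ _, fun s hs => (hC ⟨s, hs⟩).trans (le_max_left _ _)⟩

variable [TopologicalSpace.SeparableSpace H]

theorem integrableOn_cov (T : C0Semigroup H) (Q : H →L[ℝ] H) (t : ℝ) (x : H) :
    IntegrableOn (fun s => T s (Q ((T s).adjoint x))) (Set.Ioc 0 t) := by
  obtain ⟨w, b, -⟩ := exists_hilbertBasis ℝ H
  have hw : Countable w := countable_of_orthonormal b.orthonormal
  have hT : ∀ y, AEStronglyMeasurable (fun s => T s y) (volume.restrict (Set.Ioc 0 t)) := by
    intro y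
    refine ContinuousOn.aestronglyMeasurable ?_ measurableSet_Ioc
    exact (T.strong_cont y).mono (fun s hs => hs.1.le)
  have key : ∀ (F : ℝ → H →L[ℝ] H) (g : ℝ → H),
      (∀ y, AEStronglyMeasurable (fun s => F s y) (volume.restrict (Set.Ioc 0 t))) →
      (∀ y, AEStronglyMeasurable (fun s => ⟪y, g s⟫) (volume.restrict (Set.Ioc 0 t))) →
      AEStronglyMeasurable (fun s => F s (g s)) (volume.restrict (Set.Ioc 0 t)) := by
    intro F g hF hg
    refine aestronglyMeasurable_of_tendsto_ae (u := (atTop : Filter (Finset w)))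
      (f := fun A s => ∑ i ∈ A, ⟪b i, g s⟫ • F s (b i)) ?_ ?_
    · intro A
      exact Finset.aestronglyMeasurable_fun_sum _ (fun i _ => (hg (b i)).smul (hF (b i)))
    · refine Eventually.of_forall (fun s => ?_)
      have h1 := (b.hasSum_repr (g s)).mapL (F s)
      simp only [map_smul, b.repr_apply_apply] at h1
      exact h1
  have hm : AEStronglyMeasurable (fun s => T s (Q ((T s).adjoint x)))
      (volume.restrict (Set.Ioc 0 t)) := by
    refine key (fun s => T s) (fun s => Q ((T s).adjoint x)) hT ?_
    intro y
    have : (fun s => ⟪y, Q ((T s).adjoint x)⟫) = fun s => ⟪T s (Q.adjoint y), x⟫ := by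
      funext s
      rw [← ContinuousLinearMap.adjoint_inner_left, ContinuousLinearMap.adjoint_inner_right]
    rw [this]
    exact (hT _).inner aestronglyMeasurable_const
  obtain ⟨M, hM0, hM⟩ := T.exists_bound t
  refine Integrable.of_bound hm (M * (‖Q‖ * (M * ‖x‖))) ?_
  refine (ae_restrict_iff' measurableSet_Ioc).2 (Eventually.of_forall (fun s hs => ?_))
  have hs' := hM s ⟨hs.1.le, hs.2⟩
  refine ((T s).le_of_opNorm_le hs' _).trans ?_
  gcongr
  refine (Q.le_opNorm _).trans ?_
  gcongr
  refine ContinuousLinearMap.le_of_opNorm_le _ ?_ _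
  simpa using hs'

/-- The covariance operator `Q_t = ∫₀ᵗ e^{sA} Q e^{sA*} ds`, the integral being taken strongly:
`Q_t x = ∫₀ᵗ e^{sA} Q e^{sA*} x ds` for all `x`. -/
def covOp (T : C0Semigroup H) (Q : H →L[ℝ] H) (t : ℝ) : H →L[ℝ] H :=
  LinearMap.mkContinuousOfExistsBound
    { toFun := fun x => ∫ s in Set.Ioc 0 t, T s (Q ((T s).adjoint x))
      map_add' := by
        intro x y
        simp only [map_add]
        exact integral_add (integrableOn_cov T Q t x) (integrableOn_cov T Q t y)
      map_smul' := by
        intro c x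
        simp only [map_smul, RingHom.id_apply]
        exact integral_smul c _ }
    (by
      obtain ⟨M, hM0, hM⟩ := T.exists_bound t
      refine ⟨(M * (‖Q‖ * M)) * volume.real (Set.Ioc 0 t), fun x => ?_⟩
      have h := norm_setIntegral_le_of_norm_le_const (μ := volume) (s := Set.Ioc 0 t)
        (f := fun s => T s (Q ((T s).adjoint x))) (C := M * (‖Q‖ * (M * ‖x‖))) (by simp) ?_
      · refine h.trans (le_of_eq ?_)
        ring
      · intro s hs
        have hs' := hM s ⟨hs.1.le, hs.2⟩
        refine ((T s).le_of_opNorm_le hs' _).trans ?_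
        gcongr
        refine (Q.le_opNorm _).trans ?_
        gcongr
        refine ContinuousLinearMap.le_of_opNorm_le _ ?_ _
        simpa using hs')

theorem covOp_apply (T : C0Semigroup H) (Q : H →L[ℝ] H) {t : ℝ} (ht : 0 ≤ t) (x : H) :
    covOp T Q t x = ∫ s in (0 : ℝ)..t, T s (Q ((T s).adjoint x)) := by
  rw [intervalIntegral.integral_of_le ht]
  rfl

open scoped Classical in
/-- `Λ(t) = Q_t^{-1/2} e^{tA}`: the bounded operator with `Q_t^{1/2} Λ(t) = e^{tA}`. When
`e^{tA}(H) ⊆ Q_t^{1/2}(H)` and `Q_t^{1/2}` is injective it exists (`covSqrt_comp_lam`) and is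
unique. -/
def lam (T : C0Semigroup H) (Q : H →L[ℝ] H) (t : ℝ) : H →L[ℝ] H :=
  if h : ∃ L : H →L[ℝ] H, (opSqrt (covOp T Q t)).comp L = T t then h.choose else 0

theorem covSqrt_comp_lam (T : C0Semigroup H) (Q : H →L[ℝ] H) (t : ℝ)
    (hinj : ∀ x, opSqrt (covOp T Q t) x = 0 → x = 0)
    (hrange : ∀ x, ∃ y, opSqrt (covOp T Q t) y = T t x) :
    (opSqrt (covOp T Q t)).comp (lam T Q t) = T t := by
  set S := opSqrt (covOp T Q t) with hS
  have hi : ∀ x y, S x = S y → x = y := by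
    intro x y h
    have := hinj (x - y) (by rw [map_sub, h, sub_self])
    exact sub_eq_zero.1 this
  choose f hf using hrange
  let g : H →ₗ[ℝ] H :=
    { toFun := f
      map_add' := fun x y => hi _ _ (by rw [map_add, hf, hf, hf, map_add])
      map_smul' := fun c x => hi _ _ (by rw [map_smul, hf, hf, map_smul]; rfl) }
  have hg : ∃ L : H →L[ℝ] H, S.comp L = T t := by
    refine ⟨ContinuousLinearMap.ofSeqClosedGraph (g := g) ?_, ?_⟩
    · intro u x y hu hgu
      refine hi _ _ ?_
      have h1 : Tendsto (fun n => S (f (u n))) atTop (𝓝 (S y)) :=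
        (S.continuous.tendsto y).comp hgu
      have h2 : Tendsto (fun n => T t (u n)) atTop (𝓝 (T t x)) :=
        ((T t).continuous.tendsto x).comp hu
      simp only [hf] at h1
      exact (tendsto_nhds_unique h1 h2).trans (hf x).symm
    · ext x
      exact hf x
  rw [lam, dif_pos hg]
  exact hg.choose_spec

end Covariance

/-! ### Wiener integrals and the Ornstein–Uhlenbeck process -/

section OUProcess

variable {Ω : Type*} [MeasurableSpace Ω]

/-- `I = ∫₀ᵗ f(s) dβ_s` for a Brownian motion `β` and a continuous `H`-valued deterministic
integrand `f` on `[0, t]`: the limit in `L²(Ω; H)` of the Riemann sums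
`∑_{j < m} (β_{(j+1)t/m} - β_{jt/m}) f(jt/m)`. -/
def IsWienerIntegral (P : Measure Ω) (β : ℝ≥0 → Ω → ℝ) (f : ℝ → H) (t : ℝ) (I : Ω → H) : Prop :=
  MemLp I 2 P ∧
  Tendsto (fun m : ℕ => eLpNorm (fun ω =>
    (∑ j ∈ Finset.range m,
      (β (Real.toNNReal ((j + 1) * t / m)) ω - β (Real.toNNReal (j * t / m)) ω) •
        f (j * t / m)) - I ω) 2 P) atTop (𝓝 0)

/-- `(W^k)` is a family of independent standard one-dimensional Brownian motions: with an
orthonormal basis `(e_k)` it is the cylindrical Brownian motion `W_t = ∑_k W^k_t e_k`. -/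
def IsCylindricalBM {ι : Type*} (P : Measure Ω) (W : ι → ℝ≥0 → Ω → ℝ) : Prop :=
  (∀ k, IsBrownianReal (W k) P) ∧ iIndepFun (fun k ω t => W k t ω) P

variable [CompleteSpace H]

/-- `WA t` is the stochastic convolution `W_A(t) = ∫₀ᵗ e^{(t-s)A} Q^{1/2} dW_s` for every `t ≥ 0`,
that is `∑_k ∫₀ᵗ e^{(t-s)A} Q^{1/2} e_k dW^k_s`, the series converging in `L²(Ω; H)`. -/
def IsStochasticConvolution {ι : Type*} (P : Measure Ω) (T : C0Semigroup H) (Q : H →L[ℝ] H)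
    (e : HilbertBasis ι ℝ H) (W : ι → ℝ≥0 → Ω → ℝ) (WA : ℝ → Ω → H) : Prop :=
  ∀ t, 0 ≤ t → MemLp (WA t) 2 P ∧ ∃ I : ι → Ω → H,
    (∀ k, IsWienerIntegral P (W k) (fun s => T (t - s) (opSqrt Q (e k))) t (I k)) ∧
    Tendsto (fun F : Finset ι => eLpNorm (fun ω => (∑ k ∈ F, I k ω) - WA t ω) 2 P) atTop (𝓝 0)

/-- The Ornstein–Uhlenbeck process `Z_t^x = e^{tA} x + W_A(t)`, the solution of
`dZ = A Z dt + Q^{1/2} dW`, `Z_0 = x`. -/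
def ou (T : C0Semigroup H) (WA : ℝ → Ω → H) (t : ℝ) (x : H) (ω : Ω) : H := T t x + WA t ω

/-- The Ornstein–Uhlenbeck semigroup `S_t f(x) = E f(Z_t^x)`. -/
def ouSemigroup (P : Measure Ω) (T : C0Semigroup H) (WA : ℝ → Ω → H) (t : ℝ) (f : H → ℝ)
    (x : H) : ℝ :=
  ∫ ω, f (ou T WA t x ω) ∂P

open scoped Classical in
/-- The random variable `⟨η, K^{-1/2} Y⟩` for a nonnegative self-adjoint injective operator `K`,
where `Y` is Gaussian with covariance `K` and `η` is a random vector independent of `Y`.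
When `η = K^{1/2} g` it is `⟨g, Y⟩`. Since `Y` need not belong to `K^{1/2}(H)`, it is in general
defined, as usual, as a limit in `L²(P)`: it is the limit as `ε ↓ 0` of `⟨g_ε, Y⟩`, where
`g_ε = (K + ε)⁻¹ K^{1/2} η`, so that `K^{1/2} g_ε → η`. It is determined up to almost sure
equality. -/
def whitePairing (P : Measure Ω) (K : H →L[ℝ] H) (η Y : Ω → H) : Ω → ℝ :=
  if h : ∃ X : Ω → ℝ, MemLp X 2 P ∧ Tendsto (fun ε : ℝ => eLpNorm (fun ω =>
      ⟪Ring.inverse (K + ε • ContinuousLinearMap.id ℝ H) (opSqrt K (η ω)), Y ω⟫ - X ω) 2 P)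
      (𝓝[>] 0) (𝓝 0)
  then h.choose else 0

/-! ### The iteration scheme -/

/-- The iterates: `v⁰(t,x) = E u₀(Z_t^x)` and `vⁿ⁺¹(t,x) = ∫₀ᵗ (S_{t-s} kⁿ_s)(x) ds` with
`kⁿ_s(y) = ⟨B(y), Dvⁿ(s,y)⟩`. -/
def iterate (P : Measure Ω) (T : C0Semigroup H) (WA : ℝ → Ω → H) (u₀ : H → ℝ) (B : H → H) :
    ℕ → ℝ → H → ℝ
  | 0, t, x => ouSemigroup P T WA t u₀ x
  | n + 1, t, x => ∫ s in (0 : ℝ)..t,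
      ouSemigroup P T WA (t - s) (fun y => fderiv ℝ (iterate P T WA u₀ B n s) y (B y)) x

end OUProcess

/-! ### Ordered time integrals and norms -/

/-- `∫₀ᵗ dsₙ ∫₀^{sₙ} dsₙ₋₁ ⋯ ∫₀^{s₂} ds₁ F(s₁, …, sₙ)`. -/
def orderedIntegral : (n : ℕ) → ℝ → ((Fin n → ℝ) → ℝ) → ℝ
  | 0, _, F => F Fin.elim0
  | n + 1, t, F => ∫ r in (0 : ℝ)..t,
      orderedIntegral n r (fun s => F (Fin.snoc (α := fun _ => ℝ) s r))

/-- The open simplex `{0 < s₁ < ⋯ < sₙ < t}`. -/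
def timeSimplex (n : ℕ) (t : ℝ) : Set (Fin n → ℝ) :=
  {s | StrictMono s ∧ ∀ i, 0 < s i ∧ s i < t}

/-- The time preceding `s i` in the list `s₀ = 0, s₁, …, sₙ`. (The index `i : Fin n` stands for
the `(i+1)`-st time.) -/
def prevTime {n : ℕ} (s : Fin n → ℝ) (i : Fin n) : ℝ :=
  Fin.cons (α := fun _ => ℝ) 0 s i.castSucc

/-- The supremum norm of a bounded function on `H`. -/
def supNorm {F : Type*} [NormedAddCommGroup F] (f : H → F) : ℝ := ⨆ x, ‖f x‖

/-- Bounded functions. -/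
def IsBdd {F : Type*} [NormedAddCommGroup F] (f : H → F) : Prop :=
  BddAbove (Set.range fun x => ‖f x‖)

/-- `C_b^1(H)`: bounded Fréchet differentiable functions with bounded derivative. -/
def IsCb1 (f : H → ℝ) : Prop :=
  Differentiable ℝ f ∧ IsBdd f ∧ IsBdd (fderiv ℝ f)

section Formula

variable {Ω : Type*} [MeasurableSpace Ω] [CompleteSpace H] [TopologicalSpace.SeparableSpace H]

/-- The random variable
`u₀(Z_t^x) ∏ᵢ ⟨Λ(sᵢ - sᵢ₋₁) B(Z_{t-sᵢ}^x), Q_{sᵢ-sᵢ₋₁}^{-1/2} (Z_{t-sᵢ₋₁}^x - e^{(sᵢ-sᵢ₋₁)A} Z_{t-sᵢ}^x)⟩`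
for times `s₁, …, sₙ`, with `s₀ = 0`. -/
def chaosIntegrand (P : Measure Ω) (T : C0Semigroup H) (Q : H →L[ℝ] H) (WA : ℝ → Ω → H)
    (u₀ : H → ℝ) (B : H → H) (t : ℝ) (x : H) {n : ℕ} (s : Fin n → ℝ) (ω : Ω) : ℝ :=
  u₀ (ou T WA t x ω) * ∏ i : Fin n,
    whitePairing P (covOp T Q (s i - prevTime s i))
      (fun ω' => lam T Q (s i - prevTime s i) (B (ou T WA (t - s i) x ω')))
      (fun ω' => ou T WA (t - prevTime s i) x ω' -
        T (s i - prevTime s i) (ou T WA (t - s i) x ω')) ω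

end Formula

end Kolmogorov

end

/-! Everything rests on one smoothing formula. The vector `W_A(τ)` is centered Gaussian with
covariance `Q_τ`, and `e^{τA} h = Q_τ^{1/2} Λ(τ) h` is a Cameron–Martin direction for it. Shifting
the law by this direction therefore multiplies it by a density, whose expansion in `L²` is `1 +
⟨Λ(τ) h, Q_τ^{-1/2} Y⟩` up to an error with squared norm exactly `exp |Λh|² - 1 - |Λh|²`. That error
is of order `|h|²`, so for bounded measurable `f` the function `S_τ f` is Fréchet differentiable,
with `⟨D S_τ f(x), h⟩ = E[f(e^{τA} x + Y) ⟨Λ(τ) h, Q_τ^{-1/2} Y⟩]` and `‖D S_τ f‖ ≤ ‖f‖ ‖Λ(τ)‖`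
(`exists_density_opSqrt`, `hasFDerivAt_gaussian_smoothing`).

The formula is then used twice. On the analytic side, differentiating under the integral and Fubini
unfold the recursion: `vⁿ(t, x)` is the integral over the simplex of `S_{t-sₙ} ⟨B, D S_{sₙ-sₙ₋₁} ⟨B,
… ⟨B, D S_{s₁} u₀⟩ … ⟩⟩ (x)` (`IsOUFamily.iterate_eq`). Each derivative costs a factor `‖Λ(sᵢ -
sᵢ₋₁)‖ ‖B‖`, which gives both norm bounds. The products of singularities `τ^{-δ}` are integrable
because `δ < 1` (`lintegral_prod_lamNorm_snoc_le`).

On the probabilistic side, `Z_t - e^{(t-r)A} Z_r` has law `N(0, Q_{t-r})` and is independent of the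
process at finitely many times up to `r` (`stochasticConvolution_increment`). Integrating out the
latest increment with the earlier values frozen turns `f(Z_t)` times its white noise factor into
`⟨B, D S_{t-r} f⟩(Z_r)`. Repeating this once per factor identifies the expectation with the analytic
integrand at fixed times (`prod_chaosFactor`).

The remaining work concerns measurability in time: the laws of `W_A(τ)` and the numbers `‖Λ(τ)‖` are
defined separately for each `τ`. The first are handled through continuity of characteristic
functions, the second through a variational formula for the norm. -/

noncomputable section

namespace Kolmogorov

variable {H : Type*} [NormedAddCommGroup H] [InnerProductSpace ℝ H]
-- Square roots and the regularized inverse `(K + ε)⁻¹ K^{1/2}`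
section SquareRoot

variable [CompleteSpace H] {K : H →L[ℝ] H}

theorem opSqrt_apply_apply (hK : K.IsPositive) (x : H) : opSqrt K (opSqrt K x) = K x := by
  have h := (opSqrt_spec K hK).2
  exact DFunLike.congr_fun h x

theorem inner_opSqrt (hK : K.IsPositive) (x y : H) : ⟪opSqrt K x, y⟫ = ⟪x, opSqrt K y⟫ :=
  (opSqrt_spec K hK).1.inner_left_eq_inner_right x y

theorem inner_opSqrt_opSqrt (hK : K.IsPositive) (x y : H) :
    ⟪opSqrt K x, opSqrt K y⟫ = ⟪K x, y⟫ := by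
  rw [← inner_opSqrt hK, opSqrt_apply_apply hK]

theorem norm_opSqrt_sq (hK : K.IsPositive) (x : H) : ‖opSqrt K x‖ ^ 2 = ⟪K x, x⟫ := by
  rw [← real_inner_self_eq_norm_sq, inner_opSqrt_opSqrt hK]

theorem opSqrt_injective (hK : K.IsPositive) (hinj : ∀ x, K x = 0 → x = 0) (x : H)
    (hx : opSqrt K x = 0) : x = 0 :=
  hinj x (by rw [← opSqrt_apply_apply hK, hx, map_zero])

/-- A vector `x` orthogonal to the range is orthogonal to `S (S x)`, so `‖S x‖² = 0` by symmetry. -/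
theorem denseRange_of_symmetric_of_injective {S : H →L[ℝ] H} (hS : ∀ x y, ⟪S x, y⟫ = ⟪x, S y⟫)
    (hinj : ∀ x, S x = 0 → x = 0) : DenseRange S := by
  have h : (LinearMap.range (S : H →ₗ[ℝ] H)).topologicalClosure = ⊤ := by
    rw [Submodule.topologicalClosure_eq_top_iff, Submodule.eq_bot_iff]
    intro x hx
    refine hinj x ?_
    have h1 := hx (S (S x)) ⟨S x, rfl⟩
    rw [hS] at h1
    exact inner_self_eq_zero.1 h1
  have h2 := Submodule.dense_iff_topologicalClosure_eq_top.2 h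
  rwa [LinearMap.coe_range] at h2

theorem denseRange_opSqrt (hK : K.IsPositive) (hinj : ∀ x, K x = 0 → x = 0) :
    DenseRange (opSqrt K) :=
  denseRange_of_symmetric_of_injective (inner_opSqrt hK) (opSqrt_injective hK hinj)

/-- The regularized inverse square root `(K + ε)⁻¹ K^{1/2}`. -/
def regInvSqrt (K : H →L[ℝ] H) (ε : ℝ) : H →L[ℝ] H :=
  (Ring.inverse (K + ε • ContinuousLinearMap.id ℝ H)).comp (opSqrt K)

theorem isUnit_add_smul_id (hK : K.IsPositive) {ε : ℝ} (hε : 0 < ε) :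
    IsUnit (K + ε • ContinuousLinearMap.id ℝ H) := by
  refine ContinuousLinearMap.isUnit_of_forall_le_norm_inner_map (c := ⟨ε, hε.le⟩) _ hε
    (fun x => ?_)
  refine le_trans ?_ (le_abs_self _)
  have h1 := hK.inner_nonneg_left x
  simp only [_root_.add_apply, _root_.smul_apply,
    ContinuousLinearMap.id_apply, inner_add_left, real_inner_smul_left,
    real_inner_self_eq_norm_sq]
  change ‖x‖ ^ 2 * ε ≤ _
  linarith

theorem add_smul_inverse_apply (hK : K.IsPositive) {ε : ℝ} (hε : 0 < ε) (x : H) :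
    K (Ring.inverse (K + ε • ContinuousLinearMap.id ℝ H) x) +
      ε • Ring.inverse (K + ε • ContinuousLinearMap.id ℝ H) x = x :=
  DFunLike.congr_fun (Ring.mul_inverse_cancel _ (isUnit_add_smul_id hK hε)) x

theorem inverse_add_smul_apply (hK : K.IsPositive) {ε : ℝ} (hε : 0 < ε) (x : H) :
    Ring.inverse (K + ε • ContinuousLinearMap.id ℝ H) (K x + ε • x) = x :=
  DFunLike.congr_fun (Ring.inverse_mul_cancel _ (isUnit_add_smul_id hK hε)) x

/-- `K^{1/2}` commutes with `K + ε`, hence with its inverse. -/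
theorem inverse_comm_opSqrt (hK : K.IsPositive) {ε : ℝ} (hε : 0 < ε) (x : H) :
    opSqrt K (Ring.inverse (K + ε • ContinuousLinearMap.id ℝ H) x) =
      Ring.inverse (K + ε • ContinuousLinearMap.id ℝ H) (opSqrt K x) := by
  set R := Ring.inverse (K + ε • ContinuousLinearMap.id ℝ H) with hR
  have h := inverse_add_smul_apply hK hε (opSqrt K (R x))
  have e : K (opSqrt K (R x)) + ε • opSqrt K (R x) = opSqrt K x := by
    conv_rhs => rw [← add_smul_inverse_apply hK hε x, map_add, map_smul]
    rw [← opSqrt_apply_apply hK, ← opSqrt_apply_apply hK (R x)]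
  rw [e] at h
  exact h.symm

theorem opSqrt_regInvSqrt (hK : K.IsPositive) {ε : ℝ} (hε : 0 < ε) (x : H) :
    opSqrt K (regInvSqrt K ε x) =
      K (Ring.inverse (K + ε • ContinuousLinearMap.id ℝ H) x) := by
  rw [regInvSqrt, ContinuousLinearMap.comp_apply, ← inverse_comm_opSqrt hK hε,
    opSqrt_apply_apply hK]

/-- With `y = (K + ε)⁻¹ x`, expanding `‖x‖² = ‖K y + ε y‖²` gives three nonnegative terms, each of
which is at most `‖x‖²`. -/
theorem norm_inverse_le (hK : K.IsPositive) {ε : ℝ} (hε : 0 < ε) (x : H) :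
    ε * ‖Ring.inverse (K + ε • ContinuousLinearMap.id ℝ H) x‖ ≤ ‖x‖ ∧
    ‖K (Ring.inverse (K + ε • ContinuousLinearMap.id ℝ H) x)‖ ≤ ‖x‖ := by
  set y := Ring.inverse (K + ε • ContinuousLinearMap.id ℝ H) x with hy
  have h := add_smul_inverse_apply hK hε x
  rw [← hy] at h
  have h1 := hK.inner_nonneg_left y
  have h2 : ‖x‖ ^ 2 = ‖K y‖ ^ 2 + 2 * (ε * ⟪K y, y⟫) + (ε * ‖y‖) ^ 2 := by
    rw [← h, norm_add_sq_real, real_inner_smul_right, norm_smul, Real.norm_of_nonneg hε.le]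
  have h3 := mul_nonneg hε.le h1
  constructor <;> refine abs_le_of_sq_le_sq' ?_ (norm_nonneg _) |>.2 <;> nlinarith [sq_nonneg ‖K y‖]

theorem norm_opSqrt_regInvSqrt_le (hK : K.IsPositive) {ε : ℝ} (hε : 0 < ε) (x : H) :
    ‖opSqrt K (regInvSqrt K ε x)‖ ≤ ‖x‖ := by
  rw [opSqrt_regInvSqrt hK hε]
  exact (norm_inverse_le hK hε x).2

/-- The operators `K (K + ε)⁻¹` are contractions and converge to the identity on the range of `K`,
which is dense; an `r / 3` argument extends the convergence to all of `H`. -/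
theorem tendsto_opSqrt_regInvSqrt (hK : K.IsPositive) (hinj : ∀ x, K x = 0 → x = 0) (x : H) :
    Tendsto (fun ε => opSqrt K (regInvSqrt K ε x)) (𝓝[>] 0) (𝓝 x) := by
  rw [Metric.tendsto_nhds]
  intro r hr
  have hd : DenseRange K := denseRange_of_symmetric_of_injective
    (fun x y => hK.inner_left_eq_inner_right x y) hinj
  obtain ⟨b, hb⟩ := hd.exists_dist_lt x (ε := r / 3) (by positivity)
  have hε' : ∀ᶠ ε : ℝ in 𝓝[>] 0, ε * ‖b‖ < r / 3 := by
    have : Tendsto (fun ε : ℝ => ε * ‖b‖) (𝓝[>] 0) (𝓝 (0 * ‖b‖)) :=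
      (tendsto_id.mono_left nhdsWithin_le_nhds).mul_const _
    rw [zero_mul] at this
    exact this.eventually_lt_const (by positivity)
  filter_upwards [hε', self_mem_nhdsWithin] with ε h1 h2
  have h2 : (0 : ℝ) < ε := h2
  rw [opSqrt_regInvSqrt hK h2]
  set R := Ring.inverse (K + ε • ContinuousLinearMap.id ℝ H) with hR
  have e1 : K (R x) = K (R (x - K b)) + K (R (K b)) := by rw [← map_add, ← map_add]; simp
  have e2 : K (R (K b)) = K b - ε • (K (R b)) := by
    have e3 : R (K b) = b - ε • R b := by
      have := inverse_add_smul_apply hK h2 b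
      rw [map_add, map_smul] at this
      exact eq_sub_of_add_eq this
    rw [e3, map_sub, map_smul]
  have n1 := (norm_inverse_le hK h2 (x - K b)).2
  have n2 := (norm_inverse_le hK h2 b).2
  rw [← hR] at n1 n2
  rw [dist_eq_norm] at hb ⊢
  have e4 : K (R x) - x = K (R (x - K b)) - (x - K b) - ε • K (R b) := by
    rw [e1, e2]; abel
  rw [e4]
  calc _ ≤ ‖K (R (x - K b))‖ + ‖x - K b‖ + ‖ε • K (R b)‖ :=
        (norm_sub_le _ _).trans (add_le_add (norm_sub_le _ _) le_rfl)
    _ ≤ ‖x - K b‖ + ‖x - K b‖ + ε * ‖b‖ := by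
        rw [norm_smul, Real.norm_of_nonneg h2.le]
        gcongr
    _ < r := by linarith

end SquareRoot

/-! ### The covariance operators: positivity, injectivity, continuity in time -/

section CovarianceOperator

variable [CompleteSpace H] (T : C0Semigroup H) {Q : H →L[ℝ] H}

theorem inner_semigroup_cov (hQ : Q.IsPositive) (s : ℝ) (x y : H) :
    ⟪T s (Q ((T s).adjoint x)), y⟫ =
      ⟪opSqrt Q ((T s).adjoint x), opSqrt Q ((T s).adjoint y)⟫ := by
  rw [inner_opSqrt_opSqrt hQ, ContinuousLinearMap.adjoint_inner_right]

variable [TopologicalSpace.SeparableSpace H]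

theorem integrableOn_inner_cov (hQ : Q.IsPositive) (t : ℝ) (x y : H) :
    IntegrableOn (fun s => ⟪opSqrt Q ((T s).adjoint x), opSqrt Q ((T s).adjoint y)⟫)
      (Set.Ioc 0 t) := by
  have h := (integrableOn_cov T Q t x).inner_const (𝕜 := ℝ) y
  simp only [inner_semigroup_cov T hQ] at h
  exact h

theorem inner_covOp (hQ : Q.IsPositive) (t : ℝ) (x y : H) :
    ⟪covOp T Q t x, y⟫ = ∫ s in Set.Ioc 0 t,
      ⟪opSqrt Q ((T s).adjoint x), opSqrt Q ((T s).adjoint y)⟫ := by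
  have h : covOp T Q t x = ∫ s in Set.Ioc 0 t, T s (Q ((T s).adjoint x)) := rfl
  rw [h, real_inner_comm, ← integral_inner (integrableOn_cov T Q t x)]
  refine integral_congr_ae (Eventually.of_forall fun s => ?_)
  simp only
  rw [real_inner_comm, inner_semigroup_cov T hQ]

theorem covOp_isPositive (hQ : Q.IsPositive) (t : ℝ) : (covOp T Q t).IsPositive := by
  refine (ContinuousLinearMap.isPositive_iff' _).2 ⟨?_, fun x => ?_⟩
  · rw [ContinuousLinearMap.isSelfAdjoint_iff_isSymmetric]
    intro x y
    change ⟪covOp T Q t x, y⟫ = ⟪x, covOp T Q t y⟫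
    rw [inner_covOp T hQ, real_inner_comm, inner_covOp T hQ]
    refine integral_congr_ae (Eventually.of_forall fun s => real_inner_comm _ _)
  · change 0 ≤ ⟪covOp T Q t x, x⟫
    rw [inner_covOp T hQ]
    exact integral_nonneg fun s => real_inner_self_nonneg

/-- If `⟨Q_t x, x⟩ = 0` then `e^{sA*} x = 0` for almost every `s ≤ t`, so `x` is orthogonal to
`e^{sA} x` for arbitrarily small `s`; strong continuity at `0` gives `‖x‖² = 0`. -/
theorem covOp_injective (hQ : Q.IsPositive) (hQker : ∀ x, Q x = 0 → x = 0) {t : ℝ} (ht : 0 < t)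
    (x : H) (hx : covOp T Q t x = 0) : x = 0 := by
  have h1 : ∫ s in Set.Ioc 0 t,
      ⟪opSqrt Q ((T s).adjoint x), opSqrt Q ((T s).adjoint x)⟫ = 0 := by
    rw [← inner_covOp T hQ, hx, inner_zero_left]
  rw [integral_eq_zero_iff_of_nonneg (fun s => real_inner_self_nonneg)
    (integrableOn_inner_cov T hQ t x x)] at h1
  have h2 : ∀ᵐ s ∂(volume.restrict (Set.Ioc 0 t)), ∀ y, ⟪x, T s y⟫ = 0 := by
    filter_upwards [h1] with s hs y
    have h3 : (T s).adjoint x = 0 := opSqrt_injective hQ hQker _ (inner_self_eq_zero.1 hs)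
    rw [← ContinuousLinearMap.adjoint_inner_left, h3, inner_zero_left]
  have h3 : ∃ᶠ s in 𝓝[>] (0 : ℝ), ∀ y, ⟪x, T s y⟫ = 0 := by
    rw [frequently_iff]
    intro U hU
    obtain ⟨u, hu, hU⟩ := mem_nhdsGT_iff_exists_Ioo_subset.1 hU
    have hu : (0 : ℝ) < u := hu
    have hm : 0 < min u t := lt_min hu ht
    have h4 : ∀ᵐ s ∂(volume.restrict (Set.Ioo 0 (min u t))), ∀ y, ⟪x, T s y⟫ = 0 :=
      ae_restrict_of_ae_restrict_of_subset (Set.Ioo_subset_Ioc_self.trans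
        (Set.Ioc_subset_Ioc_right (min_le_right _ _))) h2
    have h5 : (volume.restrict (Set.Ioo 0 (min u t))) ≠ 0 := by
      rw [Ne, Measure.restrict_eq_zero, Real.volume_Ioo]
      simpa using hm
    have : NeBot (ae (volume.restrict (Set.Ioo 0 (min u t)))) := ae_neBot.2 h5
    obtain ⟨s, hs, hs'⟩ := (h4.and (ae_restrict_mem measurableSet_Ioo)).exists
    exact ⟨s, hU (Set.mem_Ioo.2 ⟨hs'.1, hs'.2.trans_le (min_le_left _ _)⟩), hs⟩
  have h4 : Tendsto (fun s => ⟪x, T s x⟫) (𝓝[>] 0) (𝓝 ⟪x, T 0 x⟫) := by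
    have := (T.strong_cont x) 0 (Set.mem_Ici.2 le_rfl)
    exact (tendsto_const_nhds.inner (this.tendsto.mono_left
      (nhdsWithin_mono _ Set.Ioi_subset_Ici_self)))
  have h5 : ⟪x, T 0 x⟫ = 0 := by
    by_contra hne
    obtain ⟨s, hs, hs'⟩ := (h3.and_eventually (h4.eventually_ne hne)).exists
    exact hs' (hs x)
  rw [T.map_zero] at h5
  exact inner_self_eq_zero.1 h5

/-- The quadratic form is the primitive of an integrable function of time. No continuity of `s ↦
e^{sA*} x` is needed. -/
theorem continuousOn_inner_covOp (hQ : Q.IsPositive) (x : H) :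
    ContinuousOn (fun t => ⟪covOp T Q t x, x⟫) (Set.Ici 0) := by
  intro t₀ ht₀
  have hi : ∀ a, 0 ≤ a → ∀ b, 0 ≤ b → IntervalIntegrable
      (fun s => ⟪opSqrt Q ((T s).adjoint x), opSqrt Q ((T s).adjoint x)⟫) volume a b := by
    have : ∀ a, 0 ≤ a → IntervalIntegrable
      (fun s => ⟪opSqrt Q ((T s).adjoint x), opSqrt Q ((T s).adjoint x)⟫) volume 0 a := by
      intro a ha
      rw [intervalIntegrable_iff_integrableOn_Ioc_of_le ha]
      exact integrableOn_inner_cov T hQ a x x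
    intro a ha b hb
    exact (this a ha).symm.trans (this b hb)
  have h := (intervalIntegral.continuousOn_primitive_interval'
    (hi 0 le_rfl (t₀ + 1) (by linarith [Set.mem_Ici.1 ht₀])) (a := 0) (by simp)) t₀
    (by rw [Set.uIcc_of_le (by linarith [Set.mem_Ici.1 ht₀])]; exact ⟨ht₀, by linarith⟩)
  have h2 : ContinuousWithinAt (fun t => ⟪covOp T Q t x, x⟫) (Set.Icc 0 (t₀ + 1)) t₀ := by
    rw [Set.uIcc_of_le (by linarith [Set.mem_Ici.1 ht₀])] at h
    refine h.congr (fun s hs => ?_) ?_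
    · rw [inner_covOp T hQ, intervalIntegral.integral_of_le hs.1]
    · rw [inner_covOp T hQ, intervalIntegral.integral_of_le ht₀]
  refine h2.mono_of_mem_nhdsWithin ?_
  rw [← Set.Ici_inter_Iic]
  exact inter_mem_nhdsWithin _ (Iic_mem_nhds (by linarith))

end CovarianceOperator

/-! ### Wiener integrals of deterministic integrands as an isometric graph -/

section WienerSpace

variable {Ω : Type*} [MeasurableSpace Ω] {P : Measure Ω} {ι : Type*}

/-- Pairs `(W^k_t, 1_{(0,t]} e_k)` in `L²(P) × L²(ℝ; H)`. -/
def wienerGenerators (P : Measure Ω) (e : ι → H) (W : ι → ℝ≥0 → Ω → ℝ) :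
    Set (Lp ℝ 2 P × Lp H 2 (volume : Measure ℝ)) :=
  {p | ∃ k : ι, ∃ t : ℝ≥0, p.1 =ᵐ[P] W k t ∧
    p.2 = indicatorConstLp 2 (measurableSet_Ioc (a := (0 : ℝ)) (b := t)) (by simp) (e k)}

/-- The graph of the Wiener integral of deterministic `H`-valued integrands with respect to the
cylindrical Brownian motion `(W^k)` in the orthonormal system `e`. -/
def wienerSpace (P : Measure Ω) (e : ι → H) (W : ι → ℝ≥0 → Ω → ℝ) :
    Submodule ℝ (Lp ℝ 2 P × Lp H 2 (volume : Measure ℝ)) :=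
  (Submodule.span ℝ (wienerGenerators P e W)).topologicalClosure

variable {e : ι → H} {W : ι → ℝ≥0 → Ω → ℝ}

theorem memLp_brownian (hW : IsCylindricalBM P W) (k : ι) (t : ℝ≥0) : MemLp (W k t) 2 P :=
  ((hW.1 k).hasLaw_eval t).hasGaussianLaw.memLp_two

theorem wienerGenerators_eq (hW : IsCylindricalBM P W) :
    wienerGenerators P e W = Set.range (fun q : ι × ℝ≥0 => ((memLp_brownian hW q.1 q.2).toLp,
      indicatorConstLp 2 (measurableSet_Ioc (a := (0 : ℝ)) (b := q.2)) (by simp) (e q.1))) := by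
  ext p
  constructor
  · rintro ⟨k, t, h1, h2⟩
    refine ⟨(k, t), Prod.ext (Lp.ext ?_) h2.symm⟩
    exact (MemLp.coeFn_toLp (memLp_brownian hW k t)).trans h1.symm
  · rintro ⟨q, rfl⟩
    exact ⟨q.1, q.2, MemLp.coeFn_toLp (memLp_brownian hW q.1 q.2), rfl⟩

/-- Both sides equal `min s t` when `k = l` and vanish otherwise, by independence on the left and
orthogonality of `e` on the right. -/
theorem inner_brownian [IsProbabilityMeasure P] [CompleteSpace H] (he : Orthonormal ℝ e)
    (hW : IsCylindricalBM P W) (k l : ι) (s t : ℝ≥0) :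
    ⟪(memLp_brownian hW k s).toLp, (memLp_brownian hW l t).toLp⟫ =
      ⟪(indicatorConstLp 2 (measurableSet_Ioc (a := (0 : ℝ)) (b := s)) (by simp) (e k) :
          Lp H 2 (volume : Measure ℝ)),
        indicatorConstLp 2 (measurableSet_Ioc (a := (0 : ℝ)) (b := t)) (by simp) (e l)⟫ := by
  classical
  have h1 : ⟪(memLp_brownian hW k s).toLp, (memLp_brownian hW l t).toLp⟫ =
      cov[W k s, W l t; P] := by
    rw [covariance_eq_sub (memLp_brownian hW k s) (memLp_brownian hW l t), L2.inner_def,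
      (hW.1 k).integral_eval, zero_mul, sub_zero]
    refine integral_congr_ae ?_
    filter_upwards [(memLp_brownian hW k s).coeFn_toLp, (memLp_brownian hW l t).coeFn_toLp]
      with ω h1 h2
    rw [h1, h2]
    simp [mul_comm]
  rw [h1, L2.inner_indicatorConstLp_indicatorConstLp _ _ (by simp) (by simp)]
  by_cases hkl : k = l
  · subst hkl
    rw [(hW.1 k).covariance_eval, real_inner_self_eq_norm_sq, he.1 k, Set.Ioc_inter_Ioc]
    simp
  · rw [he.2 hkl, smul_zero]
    exact ((hW.2.indepFun hkl).comp (measurable_pi_apply s) (measurable_pi_apply t)).covariance_eq_zero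
      (memLp_brownian hW k s) (memLp_brownian hW l t)

/-- For fixed `k` the sum over times is a linear image of a finite-dimensional marginal of `W k`;
sums for different `k` are independent. -/
theorem hasGaussianLaw_sum_brownian [IsProbabilityMeasure P] (hW : IsCylindricalBM P W)
    (c : ι × ℝ≥0 →₀ ℝ) :
    HasGaussianLaw (fun ω => c.sum fun q a => a * W q.1 q.2 ω) P := by
  classical
  set F := c.support.image Prod.fst
  set J := c.support.image Prod.snd
  have h1 : (fun ω => c.sum fun q a => a * W q.1 q.2 ω) =
      -- The support of `c` is enlarged to a rectangle `F × J`, on which the added coefficients are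
      -- zero, so that the sum can be grouped by `k`.
      fun ω => ∑ k : F, ∑ t ∈ J, c (k, t) • W k t ω := by
    funext ω
    rw [Finset.sum_coe_sort F (fun k => ∑ t ∈ J, c (k, t) • W k t ω), ← Finset.sum_product']
    refine Finset.sum_subset (fun q hq => ?_) (fun q _ hq => ?_)
    · exact Finset.mem_product.2 ⟨Finset.mem_image_of_mem _ hq, Finset.mem_image_of_mem _ hq⟩
    · simp [Finsupp.notMem_support_iff.1 hq]
  rw [h1]
  refine iIndepFun.hasGaussianLaw_fun_sum (X := fun (k : F) ω => ∑ t ∈ J, c (k, t) • W k t ω)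
    (fun k => ?_) ?_
  · have h2 := ((hW.1 k).hasLaw J).hasGaussianLaw.map
      (∑ t : J, c (k, t) • ContinuousLinearMap.proj (R := ℝ) (φ := fun _ : J => ℝ) t)
    convert! h2 using 1
    funext ω
    simp [← Finset.sum_coe_sort J]
  · have h2 : iIndepFun (fun (k : F) ω t => W k t ω) P :=
      hW.2.precomp (g := fun k : F => (k : ι)) Subtype.val_injective
    exact h2.comp (fun k (w : ℝ≥0 → ℝ) => ∑ t ∈ J, c (k, t) • w t) (fun k => by fun_prop)

/-- The isometry follows by bilinearity from `inner_brownian`. Gaussianity is recorded only through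
one characteristic function value, a form that passes to `L²` limits; since the graph is a linear
space, this loses nothing. -/
theorem wiener_of_mem_span [IsProbabilityMeasure P] [CompleteSpace H] (he : Orthonormal ℝ e)
    (hW : IsCylindricalBM P W) {p : Lp ℝ 2 P × Lp H 2 (volume : Measure ℝ)}
    (hp : p ∈ Submodule.span ℝ (wienerGenerators P e W)) :
    ‖p.1‖ = ‖p.2‖ ∧
      ∫ ω, Complex.exp (p.1 ω * Complex.I) ∂P = Complex.exp (-(‖p.2‖ ^ 2 : ℝ) / 2) := by
  rw [wienerGenerators_eq hW, Finsupp.mem_span_range_iff_exists_finsupp] at hp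
  obtain ⟨c, rfl⟩ := hp
  set g := fun q : ι × ℝ≥0 => (((memLp_brownian hW q.1 q.2).toLp : Lp ℝ 2 P),
      (indicatorConstLp 2 (measurableSet_Ioc (a := (0 : ℝ)) (b := q.2)) (by simp) (e q.1) :
        Lp H 2 (volume : Measure ℝ))) with hg
  have e1 : (c.sum fun q a => a • g q).1 = ∑ q ∈ c.support, c q • (g q).1 := by
    simp [Finsupp.sum, Prod.fst_sum]
  have e2 : (c.sum fun q a => a • g q).2 = ∑ q ∈ c.support, c q • (g q).2 := by
    simp [Finsupp.sum, Prod.snd_sum]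
  have hn : ‖(c.sum fun q a => a • g q).1‖ = ‖(c.sum fun q a => a • g q).2‖ := by
    rw [← sq_eq_sq₀ (norm_nonneg _) (norm_nonneg _), ← real_inner_self_eq_norm_sq,
      ← real_inner_self_eq_norm_sq, e1, e2]
    simp only [sum_inner, inner_sum, real_inner_smul_left, real_inner_smul_right]
    refine Finset.sum_congr rfl fun q _ => Finset.sum_congr rfl fun r _ => ?_
    rw [hg]
    simp only
    rw [inner_brownian he hW]
  refine ⟨hn, ?_⟩
  have hae : ((c.sum fun q a => a • g q).1 : Ω → ℝ) =ᵐ[P]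
      fun ω => c.sum fun q a => a * W q.1 q.2 ω := by
    rw [e1]
    refine (Lp.coeFn_finsetSum _ _).trans ?_
    have h3 : ∀ᵐ ω ∂P, ∀ q ∈ c.support, (c q • (g q).1 : Lp ℝ 2 P) ω = c q * W q.1 q.2 ω := by
      refine (ae_ball_iff (S := (c.support : Set (ι × ℝ≥0))) c.support.countable_toSet).2 ?_
      intro q _
      filter_upwards [Lp.coeFn_smul (c q) (g q).1, (memLp_brownian hW q.1 q.2).coeFn_toLp]
        with ω h4 h5
      rw [h4, Pi.smul_apply, hg]
      simp only
      rw [h5, smul_eq_mul]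
    filter_upwards [h3] with ω h4
    rw [Finset.sum_apply]
    exact Finset.sum_congr rfl h4
  have hG : HasGaussianLaw ((c.sum fun q a => a • g q).1 : Ω → ℝ) P :=
    (hasGaussianLaw_sum_brownian hW c).congr hae.symm
  have hmem := hG.memLp_two
  have hmean : ∫ ω, (c.sum fun q a => a • g q).1 ω ∂P = 0 := by
    rw [integral_congr_ae hae]
    simp only [Finsupp.sum]
    rw [integral_finsetSum]
    · refine Finset.sum_eq_zero fun q _ => ?_
      rw [integral_const_mul, (hW.1 q.1).integral_eval, mul_zero]
    · exact fun q _ => ((memLp_brownian hW q.1 q.2).integrable (by norm_num)).const_mul _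
  have hvar : Var[((c.sum fun q a => a • g q).1 : Ω → ℝ); P] =
      ‖(c.sum fun q a => a • g q).2‖ ^ 2 := by
    rw [variance_eq_sub hmem, hmean, ← hn, ← real_inner_self_eq_norm_sq, L2.inner_def]
    simp [sq]
  have hmap := hG.map_eq_gaussianReal
  rw [hmean, hvar] at hmap
  have hc := charFun_gaussianReal (μ := 0)
    (v := (‖(c.sum fun q a => a • g q).2‖ ^ 2).toNNReal) 1
  rw [← hmap, charFun_apply_real, integral_map hG.aemeasurable (by fun_prop)] at hc
  rw [Real.coe_toNNReal _ (by positivity)] at hc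
  simp only [Complex.ofReal_one, one_mul, Complex.ofReal_zero, mul_zero, zero_mul, zero_sub,
    one_pow, mul_one] at hc
  rw [hc, neg_div]

/-- Both identities are stable under limits: norms are continuous, and along an almost surely
convergent subsequence the exponentials converge by domination. -/
theorem wiener_of_mem [IsProbabilityMeasure P] [CompleteSpace H] (he : Orthonormal ℝ e)
    (hW : IsCylindricalBM P W) {p : Lp ℝ 2 P × Lp H 2 (volume : Measure ℝ)}
    (hp : p ∈ wienerSpace P e W) :
    ‖p.1‖ = ‖p.2‖ ∧
      ∫ ω, Complex.exp (p.1 ω * Complex.I) ∂P = Complex.exp (-(‖p.2‖ ^ 2 : ℝ) / 2) := by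
  obtain ⟨x, hx, hxp⟩ := mem_closure_iff_seq_limit.1 hp
  have h1 : Tendsto (fun n => (x n).1) atTop (𝓝 p.1) := (continuous_fst.tendsto p).comp hxp
  have h2 : Tendsto (fun n => (x n).2) atTop (𝓝 p.2) := (continuous_snd.tendsto p).comp hxp
  have hs := fun n => wiener_of_mem_span he hW (hx n)
  refine ⟨tendsto_nhds_unique h1.norm (by simpa only [(hs _).1] using h2.norm), ?_⟩
  obtain ⟨ns, hns, hae⟩ := (tendstoInMeasure_of_tendsto_Lp h1).exists_seq_tendsto_ae'
  have h3 : Tendsto (fun n => ∫ ω, Complex.exp ((x (ns n)).1 ω * Complex.I) ∂P) atTop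
      (𝓝 (∫ ω, Complex.exp (p.1 ω * Complex.I) ∂P)) := by
    refine tendsto_integral_of_dominated_convergence (fun _ => 1) (fun n => ?_)
      (integrable_const _) (fun n => Eventually.of_forall fun ω => ?_) ?_
    · have := (Lp.aestronglyMeasurable (x (ns n)).1)
      have h5 : Continuous fun r : ℝ => Complex.exp (r * Complex.I) := by fun_prop
      exact h5.comp_aestronglyMeasurable this
    · rw [Complex.norm_exp_ofReal_mul_I]
    · filter_upwards [hae] with ω hω
      have h5 : Continuous fun r : ℝ => Complex.exp (r * Complex.I) := by fun_prop
      exact (h5.tendsto _).comp hω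
  simp only [(hs _).2] at h3
  have h4 : Continuous fun y : Lp H 2 (volume : Measure ℝ) =>
      Complex.exp (-(‖y‖ ^ 2 : ℝ) / 2) := by fun_prop
  exact tendsto_nhds_unique h3 ((h4.tendsto _).comp (h2.comp hns))

/-- If the first components of elements of the Wiener graph converge, then so do the second ones,
and a pointwise limit of the latter is their limit. -/
theorem wienerSpace_of_tendsto [IsProbabilityMeasure P] [CompleteSpace H] (he : Orthonormal ℝ e)
    (hW : IsCylindricalBM P W) {α : Type*} {l : Filter α} [l.NeBot] [l.IsCountablyGenerated]
    {p : α → Lp ℝ 2 P × Lp H 2 (volume : Measure ℝ)} (hp : ∀ a, p a ∈ wienerSpace P e W)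
    {X : Lp ℝ 2 P} (hX : Tendsto (fun a => (p a).1) l (𝓝 X))
    {ψ : α → ℝ → H} (hψ : ∀ a, (p a).2 =ᵐ[volume] ψ a) {φ : ℝ → H}
    (hφ : ∀ r, Tendsto (fun a => ψ a r) l (𝓝 (φ r))) :
    ∃ f : Lp H 2 (volume : Measure ℝ), f =ᵐ[volume] φ ∧ (X, f) ∈ wienerSpace P e W := by
  -- The graph is a subspace, so the isometry applies to differences and transfers the Cauchy
  -- property from the random variables to the integrands.
  have hc : Cauchy (map (fun a => (p a).2) l) := by
    have h1 := cauchy_map_iff.1 (hX.cauchy_map)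
    refine cauchy_map_iff.2 ⟨h1.1, ?_⟩
    rw [Metric.uniformity_eq_comap_nhds_zero, tendsto_comap_iff] at h1 ⊢
    refine h1.2.congr fun q => ?_
    have := (wiener_of_mem he hW (sub_mem (hp q.1) (hp q.2))).1
    simp only [Prod.fst_sub, Prod.snd_sub] at this
    simp only [Function.comp, dist_eq_norm]
    exact this
  obtain ⟨f, hf⟩ := CompleteSpace.complete hc
  have hf : Tendsto (fun a => (p a).2) l (𝓝 f) := hf
  refine ⟨f, ?_, ?_⟩
  · obtain ⟨ns, hns, hae⟩ := (tendstoInMeasure_of_tendsto_Lp hf).exists_seq_tendsto_ae'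
    have h2 : ∀ᵐ r, ∀ n, (p (ns n)).2 r = ψ (ns n) r := ae_all_iff.2 fun n => hψ (ns n)
    filter_upwards [hae, h2] with r h3 h4
    simp only [h4] at h3
    exact tendsto_nhds_unique h3 ((hφ r).comp hns)
  · exact (Submodule.isClosed_topologicalClosure _).mem_of_tendsto (hX.prodMk_nhds hf)
      (Eventually.of_forall hp)

end WienerSpace

/-! ### Approximation by left-endpoint step functions -/

section StepFunctions

/-- The left-endpoint step function of a function `g` on the grid `jt/m`. -/
def gridStep {F : Type*} [AddCommMonoid F] (g : ℝ → F) (t : ℝ) (m : ℕ) (r : ℝ) : F :=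
  ∑ j ∈ Finset.range m, (Set.Ioc ((Real.toNNReal (j * t / m) : ℝ))
    ((Real.toNNReal ((j + 1) * t / m) : ℝ))).indicator (fun _ => g (j * t / m)) r

/-- At a point `r` of `(0, t]` the step function takes the value of `g` at the left end of the cell
containing `r`, which is within `t / m` of `r`. -/
theorem tendsto_gridStep {F : Type*} [NormedAddCommGroup F] {g : ℝ → F} {t : ℝ} (ht : 0 ≤ t)
    (hg : ContinuousOn g (Set.Icc 0 t)) (r : ℝ) :
    Tendsto (fun m => gridStep g t m r) atTop (𝓝 ((Set.Ioc 0 t).indicator g r)) := by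
  have ha : ∀ (m j : ℕ), ((Real.toNNReal (j * t / m) : ℝ)) = j * t / m := fun m j =>
    Real.coe_toNNReal _ (by positivity)
  have hb : ∀ (m j : ℕ), ((Real.toNNReal ((j + 1) * t / m) : ℝ)) = (j + 1) * t / m := fun m j =>
    Real.coe_toNNReal _ (by positivity)
  by_cases hr : r ∈ Set.Ioc 0 t
  · rw [Set.indicator_of_mem hr]
    have ht0 : 0 < t := hr.1.trans_le hr.2
    have key : ∀ m : ℕ, 0 < m → ∃ s ∈ Set.Icc 0 t, |s - r| ≤ t / m ∧ gridStep g t m r = g s := by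
      intro m hm
      have hm' : (0 : ℝ) < m := by exact_mod_cast hm
      -- The cells are open on the left and closed on the right, so the cell of `r` has index `⌈r m
      -- / t⌉ - 1`.
      set N := ⌈r * m / t⌉₊ with hN
      have hN0 : 0 < N := Nat.ceil_pos.2 (div_pos (mul_pos hr.1 hm') ht0)
      have h1 : r * m / t ≤ N := Nat.le_ceil _
      have h2 : (N : ℝ) - 1 < r * m / t := by
        have := Nat.ceil_lt_add_one (div_pos (mul_pos hr.1 hm') ht0).le
        linarith
      have hNm : N ≤ m := by
        refine Nat.ceil_le.2 ?_
        rw [div_le_iff₀ ht0, mul_comm]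
        exact mul_le_mul_of_nonneg_left hr.2 hm'.le
      obtain ⟨j, hj⟩ : ∃ j, N = j + 1 := ⟨N - 1, by omega⟩
      have hcast : (N : ℝ) = j + 1 := by rw [hj]; push_cast; ring
      rw [hcast] at h1 h2
      have h3 : r ≤ (j + 1) * t / m := by
        rw [le_div_iff₀ hm']; rwa [div_le_iff₀ ht0] at h1
      have h4 : j * t / m < r := by
        rw [div_lt_iff₀ hm']; rw [lt_div_iff₀ ht0] at h2; linarith
      refine ⟨j * t / m, ⟨by positivity, h4.le.trans hr.2⟩, ?_, ?_⟩
      · rw [abs_le]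
        have : (j + 1) * t / m = j * t / m + t / m := by ring
        constructor <;> linarith [div_nonneg ht hm'.le]
      · rw [gridStep, Finset.sum_eq_single j]
        · rw [ha, hb, Set.indicator_of_mem (Set.mem_Ioc.2 ⟨h4, h3⟩)]
        · intro i _ hij
          rw [ha, hb]
          refine Set.indicator_of_notMem (fun hi => hij ?_) _
          have h5 : (i : ℝ) < j + 1 := by
            have := hi.1.trans_le h3
            rw [div_lt_div_iff_of_pos_right hm'] at this
            exact lt_of_mul_lt_mul_right this ht0.le
          have h6 : (j : ℝ) < i + 1 := by
            have := h4.trans_le hi.2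
            rw [div_lt_div_iff_of_pos_right hm'] at this
            exact lt_of_mul_lt_mul_right this ht0.le
          have h7 : i < j + 1 := by exact_mod_cast h5
          have h8 : j < i + 1 := by exact_mod_cast h6
          omega
        · intro hj'
          exact absurd (Finset.mem_range.2 (by omega)) hj'
    choose! s hs1 hs2 hs3 using key
    have hst : Tendsto s atTop (𝓝[Set.Icc 0 t] r) := by
      refine tendsto_nhdsWithin_iff.2 ⟨?_, ?_⟩
      · rw [tendsto_iff_dist_tendsto_zero]
        refine squeeze_zero' (Eventually.of_forall fun _ => dist_nonneg) ?_
          (tendsto_const_div_atTop_nhds_zero_nat t)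
        filter_upwards [eventually_gt_atTop 0] with m hm
        exact hs2 m hm
      · filter_upwards [eventually_gt_atTop 0] with m hm
        exact hs1 m hm
    refine Tendsto.congr' ?_ ((hg r ⟨hr.1.le, hr.2⟩).tendsto.comp hst)
    filter_upwards [eventually_gt_atTop 0] with m hm
    exact (hs3 m hm).symm
  · rw [Set.indicator_of_notMem hr]
    refine tendsto_const_nhds.congr fun m => ?_
    rw [gridStep]
    refine (Finset.sum_eq_zero fun j hj => ?_).symm
    rw [ha, hb]
    refine Set.indicator_of_notMem (fun hi => hr ?_) _
    have hm : (0 : ℝ) < m := by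
      exact_mod_cast (Nat.zero_le j).trans_lt (Finset.mem_range.1 hj)
    refine ⟨lt_of_le_of_lt (by positivity) hi.1, hi.2.trans ?_⟩
    rw [div_le_iff₀ hm, mul_comm]
    refine mul_le_mul_of_nonneg_left ?_ ht
    exact_mod_cast Finset.mem_range.1 hj

end StepFunctions

/-! ### The integrand that represents `⟨x, W_A(t)⟩` -/

section StochasticConvolution

variable {Ω : Type*} [MeasurableSpace Ω] {P : Measure Ω} {ι : Type*}

theorem tendsto_toLp_inner {α : Type*} {l : Filter α} {F : α → Ω → H} {G : Ω → H}
    (hF : ∀ a, MemLp (F a) 2 P) (hG : MemLp G 2 P)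
    (h : Tendsto (fun a => eLpNorm (fun ω => F a ω - G ω) 2 P) l (𝓝 0)) (x : H) :
    Tendsto (fun a => ((hF a).const_inner (𝕜 := ℝ) x).toLp) l
      (𝓝 (hG.const_inner (𝕜 := ℝ) x).toLp) := by
  rw [Lp.tendsto_Lp_iff_tendsto_eLpNorm'']
  have h2 : Tendsto (fun a => ENNReal.ofReal ‖x‖ * eLpNorm (fun ω => F a ω - G ω) 2 P) l
      (𝓝 (ENNReal.ofReal ‖x‖ * 0)) :=
    ENNReal.Tendsto.const_mul h (Or.inr ENNReal.ofReal_ne_top)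
  rw [mul_zero] at h2
  refine tendsto_of_tendsto_of_tendsto_of_le_of_le tendsto_const_nhds h2 (fun _ => zero_le)
    (fun a => ?_)
  refine eLpNorm_le_mul_eLpNorm_of_ae_le_mul (Eventually.of_forall fun ω => ?_) _
  simp only [Pi.sub_apply]
  rw [← inner_sub_right]
  exact abs_real_inner_le_norm _ _

variable {e : ι → H} {W : ι → ℝ≥0 → Ω → ℝ}

theorem increment_mem_wienerSpace (hW : IsCylindricalBM P W) (k : ι)
    {a b : ℝ≥0} (hab : a ≤ b) :
    (((memLp_brownian hW k b).toLp - (memLp_brownian hW k a).toLp : Lp ℝ 2 P),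
      (indicatorConstLp 2 (measurableSet_Ioc (a := (a : ℝ)) (b := b)) (by simp) (e k) :
        Lp H 2 (volume : Measure ℝ))) ∈ wienerSpace P e W := by
  have h1 : ∀ t : ℝ≥0, (((memLp_brownian hW k t).toLp : Lp ℝ 2 P),
      (indicatorConstLp 2 (measurableSet_Ioc (a := (0 : ℝ)) (b := t)) (by simp) (e k) :
        Lp H 2 (volume : Measure ℝ))) ∈ wienerSpace P e W := fun t =>
    Submodule.le_topologicalClosure _ (Submodule.subset_span
      ⟨k, t, (memLp_brownian hW k t).coeFn_toLp, rfl⟩)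
  convert sub_mem (h1 b) (h1 a) using 1
  refine Prod.ext rfl (Lp.ext ?_)
  filter_upwards [indicatorConstLp_coeFn (p := 2) (μ := (volume : Measure ℝ))
      (hs := measurableSet_Ioc (a := (a : ℝ)) (b := b)) (hμs := by simp) (c := e k), Lp.coeFn_sub
    (indicatorConstLp 2 (measurableSet_Ioc (a := (0 : ℝ)) (b := b)) (by simp) (e k) :
      Lp H 2 (volume : Measure ℝ))
    (indicatorConstLp 2 (measurableSet_Ioc (a := (0 : ℝ)) (b := a)) (by simp) (e k)),
    indicatorConstLp_coeFn (p := 2) (μ := (volume : Measure ℝ))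
      (hs := measurableSet_Ioc (a := (0 : ℝ)) (b := b)) (hμs := by simp) (c := e k),
    indicatorConstLp_coeFn (p := 2) (μ := (volume : Measure ℝ))
      (hs := measurableSet_Ioc (a := (0 : ℝ)) (b := a)) (hμs := by simp) (c := e k)]
    with r h1' h2 h3 h4
  rw [Prod.snd_sub, h1', h2, Pi.sub_apply, h3, h4]
  have hab' : (a : ℝ) ≤ b := by exact_mod_cast hab
  have ha : (0 : ℝ) ≤ a := a.2
  by_cases hr1 : r ≤ a
  · by_cases hr0 : 0 < r
    · simp [Set.indicator, hr1, hr0, hr1.trans hab', not_lt.2 hr1]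
    · simp [Set.indicator, hr0, not_lt.2 hr1]
  · have hr2 : (a : ℝ) < r := not_le.1 hr1
    simp [Set.indicator, hr1, hr2, ha.trans_lt hr2]

/-- The Riemann sums paired with `x` lie in the graph, their integrands being step functions on the
grid. The sums converge in `L²` by definition of the integral and the step functions converge
pointwise, so `wienerSpace_of_tendsto` applies. -/
theorem wienerIntegral_mem [IsProbabilityMeasure P] [CompleteSpace H] (he : Orthonormal ℝ e)
    (hW : IsCylindricalBM P W) (k : ι) {f : ℝ → H} {t : ℝ} (ht : 0 ≤ t)
    (hf : ContinuousOn f (Set.Icc 0 t)) {I : Ω → H} (hI : IsWienerIntegral P (W k) f t I)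
    (x : H) :
    ∃ φ : Lp H 2 (volume : Measure ℝ),
      φ =ᵐ[volume] (Set.Ioc 0 t).indicator (fun r => ⟪x, f r⟫ • e k) ∧
      ((hI.1.const_inner (𝕜 := ℝ) x).toLp, φ) ∈ wienerSpace P e W := by
  set A : ℕ → ℕ → ℝ≥0 := fun m j => Real.toNNReal (j * t / m)
  set B : ℕ → ℕ → ℝ≥0 := fun m j => Real.toNNReal ((j + 1) * t / m)
  have hAB : ∀ m j, A m j ≤ B m j := fun m j => Real.toNNReal_le_toNNReal (by
    rw [add_mul, add_div]; linarith [show 0 ≤ 1 * t / m by positivity])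
  set F : ℕ → Ω → H := fun m ω => ∑ j ∈ Finset.range m,
    (W k (B m j) ω - W k (A m j) ω) • f (j * t / m) with hFdef
  have hF : ∀ m, MemLp (F m) 2 P := fun m => memLp_finsetSum _ fun j _ => by
    have h1 := (memLp_brownian hW k (B m j)).sub (memLp_brownian hW k (A m j))
    refine MemLp.of_le_mul (c := ‖f (j * t / m)‖) h1 ?_ (Eventually.of_forall fun ω => ?_)
    · exact h1.aestronglyMeasurable.smul_const _
    · rw [norm_smul, mul_comm]; rfl
  have hlim := tendsto_toLp_inner hF hI.1 hI.2 x
  let p : ℕ → Lp ℝ 2 P × Lp H 2 (volume : Measure ℝ) := fun m =>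
    ∑ j ∈ Finset.range m, ⟪x, f (j * t / m)⟫ •
      (((memLp_brownian hW k (B m j)).toLp - (memLp_brownian hW k (A m j)).toLp : Lp ℝ 2 P),
      (indicatorConstLp 2 (measurableSet_Ioc (a := (A m j : ℝ)) (b := B m j)) (by simp) (e k) :
        Lp H 2 (volume : Measure ℝ)))
  have hp : ∀ m, p m ∈ wienerSpace P e W := fun m =>
    Submodule.sum_mem _ fun j _ => Submodule.smul_mem _ _ (increment_mem_wienerSpace hW k (hAB m j))
  have hp1 : ∀ m, (p m).1 = ((hF m).const_inner (𝕜 := ℝ) x).toLp := by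
    intro m
    refine Lp.ext ?_
    have e1 : (p m).1 = ∑ j ∈ Finset.range m, ⟪x, f (j * t / m)⟫ •
        ((memLp_brownian hW k (B m j)).toLp - (memLp_brownian hW k (A m j)).toLp) := by
      simp [p, Prod.fst_sum]
    have h2 : ∀ᵐ ω ∂P, ∀ j : ℕ, (⟪x, f (j * t / m)⟫ • ((memLp_brownian hW k (B m j)).toLp -
        (memLp_brownian hW k (A m j)).toLp) : Lp ℝ 2 P) ω =
        ⟪x, f (j * t / m)⟫ * (W k (B m j) ω - W k (A m j) ω) := by
      refine ae_all_iff.2 fun j => ?_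
      filter_upwards [Lp.coeFn_smul ⟪x, f (j * t / m)⟫ ((memLp_brownian hW k (B m j)).toLp -
        (memLp_brownian hW k (A m j)).toLp), Lp.coeFn_sub (memLp_brownian hW k (B m j)).toLp
        (memLp_brownian hW k (A m j)).toLp, (memLp_brownian hW k (B m j)).coeFn_toLp,
        (memLp_brownian hW k (A m j)).coeFn_toLp] with ω h3 h4 h5 h6
      rw [h3, Pi.smul_apply, h4, Pi.sub_apply, h5, h6, smul_eq_mul]
    rw [e1]
    filter_upwards [Lp.coeFn_finsetSum (Finset.range m) (fun j : ℕ => ⟪x, f (j * t / m)⟫ •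
        ((memLp_brownian hW k (B m j)).toLp - (memLp_brownian hW k (A m j)).toLp)), h2,
        ((hF m).const_inner (𝕜 := ℝ) x).coeFn_toLp] with ω h3 h4 h5
    rw [h3, h5, Finset.sum_apply, hFdef]
    simp only [inner_sum, real_inner_smul_right]
    refine Finset.sum_congr rfl fun j _ => ?_
    rw [h4, mul_comm]
  have hp2 : ∀ m, (p m).2 =ᵐ[volume] fun r => gridStep (fun r => ⟪x, f r⟫ • e k) t m r := by
    intro m
    have e1 : (p m).2 = ∑ j ∈ Finset.range m, ⟪x, f (j * t / m)⟫ •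
        (indicatorConstLp 2 (measurableSet_Ioc (a := (A m j : ℝ)) (b := B m j)) (by simp) (e k) :
        Lp H 2 (volume : Measure ℝ)) := by
      simp [p, Prod.snd_sum]
    have h2 : ∀ᵐ r : ℝ, ∀ j : ℕ, (⟪x, f (j * t / m)⟫ •
        (indicatorConstLp 2 (measurableSet_Ioc (a := (A m j : ℝ)) (b := B m j)) (by simp) (e k) :
        Lp H 2 (volume : Measure ℝ)) : Lp H 2 (volume : Measure ℝ)) r =
        (Set.Ioc (A m j : ℝ) (B m j)).indicator (fun _ => ⟪x, f (j * t / m)⟫ • e k) r := by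
      refine ae_all_iff.2 fun j => ?_
      filter_upwards [Lp.coeFn_smul ⟪x, f (j * t / m)⟫
        (indicatorConstLp 2 (measurableSet_Ioc (a := (A m j : ℝ)) (b := B m j)) (by simp) (e k) :
        Lp H 2 (volume : Measure ℝ)), indicatorConstLp_coeFn (p := 2) (μ := (volume : Measure ℝ))
        (hs := measurableSet_Ioc (a := (A m j : ℝ)) (b := B m j)) (hμs := by simp) (c := e k)]
        with r h3 h4
      rw [h3, Pi.smul_apply, h4, Set.indicator_const_smul_apply]
    rw [e1]
    filter_upwards [Lp.coeFn_finsetSum (Finset.range m) (fun j : ℕ => ⟪x, f (j * t / m)⟫ •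
        (indicatorConstLp 2 (measurableSet_Ioc (a := (A m j : ℝ)) (b := B m j)) (by simp) (e k) :
        Lp H 2 (volume : Measure ℝ))), h2] with r h3 h4
    rw [h3, Finset.sum_apply, gridStep]
    exact Finset.sum_congr rfl fun j _ => h4 j
  refine wienerSpace_of_tendsto he hW hp ?_ hp2 (tendsto_gridStep ht ?_)
  · simpa only [hp1] using hlim
  · exact (continuousOn_const.inner hf).smul continuousOn_const

variable [CompleteSpace H] [TopologicalSpace.SeparableSpace H] {T : C0Semigroup H} {Q : H →L[ℝ] H}

/-- Moving the operators to the other side, the partial sums over `k` have as integrands the partial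
sums of the expansion of `Q^{1/2} e^{(t-r)A*} x` in the basis `e`, which converge for every `r`. -/
theorem stochasticConvolution_mem [IsProbabilityMeasure P] (hQ : Q.IsPositive)
    {e : HilbertBasis ι ℝ H} (hW : IsCylindricalBM P W) {WA : ℝ → Ω → H}
    (hWA : IsStochasticConvolution P T Q e W WA) {t : ℝ} (ht : 0 ≤ t) (x : H) :
    ∃ φ : Lp H 2 (volume : Measure ℝ),
      φ =ᵐ[volume] (Set.Ioc 0 t).indicator (fun r => opSqrt Q ((T (t - r)).adjoint x)) ∧
      (((hWA t ht).1.const_inner (𝕜 := ℝ) x).toLp, φ) ∈ wienerSpace P e W := by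
  classical
  have hι : Countable ι := countable_of_orthonormal e.orthonormal
  obtain ⟨hM, I, hI, hlim⟩ := hWA t ht
  have hcont : ∀ k, ContinuousOn (fun s => T (t - s) (opSqrt Q (e k))) (Set.Icc 0 t) := fun k =>
    (T.strong_cont (opSqrt Q (e k))).comp (by fun_prop)
      (fun s hs => Set.mem_Ici.2 (sub_nonneg.2 hs.2))
  choose φ hφ1 hφ2 using fun k => wienerIntegral_mem e.orthonormal hW k ht (hcont k) (hI k) x
  have hF : ∀ F : Finset ι, MemLp (fun ω => ∑ k ∈ F, I k ω) 2 P := fun F =>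
    memLp_finsetSum _ fun k _ => (hI k).1
  have hl := tendsto_toLp_inner hF hM hlim x
  let p : Finset ι → Lp ℝ 2 P × Lp H 2 (volume : Measure ℝ) := fun F =>
    ∑ k ∈ F, (((hI k).1.const_inner (𝕜 := ℝ) x).toLp, φ k)
  have hp1 : ∀ F, (p F).1 = ((hF F).const_inner (𝕜 := ℝ) x).toLp := by
    intro F
    refine Lp.ext ?_
    have e1 : (p F).1 = ∑ k ∈ F, ((hI k).1.const_inner (𝕜 := ℝ) x).toLp := by
      simp [p, Prod.fst_sum]
    rw [e1]
    have h2 : ∀ᵐ ω ∂P, ∀ k, (((hI k).1.const_inner (𝕜 := ℝ) x).toLp : Lp ℝ 2 P) ω = ⟪x, I k ω⟫ :=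
      ae_all_iff.2 fun k => ((hI k).1.const_inner (𝕜 := ℝ) x).coeFn_toLp
    filter_upwards [Lp.coeFn_finsetSum F (fun k => ((hI k).1.const_inner (𝕜 := ℝ) x).toLp), h2,
      ((hF F).const_inner (𝕜 := ℝ) x).coeFn_toLp] with ω h3 h4 h5
    rw [h3, h5, Finset.sum_apply, inner_sum]
    exact Finset.sum_congr rfl fun k _ => h4 k
  have hp2 : ∀ F, (p F).2 =ᵐ[volume] fun r => (Set.Ioc 0 t).indicator
      (fun r => ∑ k ∈ F, ⟪e k, opSqrt Q ((T (t - r)).adjoint x)⟫ • e k) r := by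
    intro F
    have e1 : (p F).2 = ∑ k ∈ F, φ k := by simp [p, Prod.snd_sum]
    rw [e1]
    have h2 : ∀ᵐ r, ∀ k, φ k r = (Set.Ioc 0 t).indicator
      (fun r => ⟪x, T (t - r) (opSqrt Q (e k))⟫ • e k) r := ae_all_iff.2 hφ1
    filter_upwards [Lp.coeFn_finsetSum F φ, h2] with r h3 h4
    rw [h3, Finset.sum_apply]
    simp only [h4]
    by_cases hr : r ∈ Set.Ioc 0 t
    · simp only [Set.indicator_of_mem hr]
      refine Finset.sum_congr rfl fun k _ => ?_
      rw [← inner_opSqrt hQ, ContinuousLinearMap.adjoint_inner_right, real_inner_comm]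
    · simp only [Set.indicator_of_notMem hr, Finset.sum_const_zero]
  refine wienerSpace_of_tendsto e.orthonormal hW (p := p)
    (fun F => Submodule.sum_mem _ fun k _ => hφ2 k) (by simpa only [hp1] using hl) hp2 (fun r => ?_)
  by_cases hr : r ∈ Set.Ioc 0 t
  · simp only [Set.indicator_of_mem hr]
    have := e.hasSum_repr (opSqrt Q ((T (t - r)).adjoint x))
    simp only [e.repr_apply_apply] at this
    exact this
  · simp only [Set.indicator_of_notMem hr]
    exact tendsto_const_nhds

end StochasticConvolution

/-! ### Law of the stochastic convolution and independence of its increments -/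

section GaussianLaws

/-- `μ` is the centered Gaussian measure with covariance operator `K`. -/
def IsCenteredGaussian [MeasurableSpace H] (μ : Measure H) (K : H →L[ℝ] H) : Prop :=
  ∀ h : H, ∫ z, Complex.exp (⟪h, z⟫ * Complex.I) ∂μ = Complex.exp (-(⟪K h, h⟫ : ℝ) / 2)

variable {Ω : Type*} [MeasurableSpace Ω] {P : Measure Ω} {ι : Type*}
variable [CompleteSpace H] [TopologicalSpace.SeparableSpace H] {T : C0Semigroup H} {Q : H →L[ℝ] H}

theorem setIntegral_cov_reflect (hQ : Q.IsPositive) {r t : ℝ} (hrt : r ≤ t) (x : H) :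
    ∫ s in Set.Ioc r t, ⟪opSqrt Q ((T (t - s)).adjoint x), opSqrt Q ((T (t - s)).adjoint x)⟫ =
      ⟪covOp T Q (t - r) x, x⟫ := by
  rw [inner_covOp T hQ, ← intervalIntegral.integral_of_le hrt,
    ← intervalIntegral.integral_of_le (sub_nonneg.2 hrt)]
  rw [intervalIntegral.integral_comp_sub_left (fun s =>
    ⟪opSqrt Q ((T s).adjoint x), opSqrt Q ((T s).adjoint x)⟫) t, sub_self]

theorem norm_sq_of_ae_eq_indicator (hQ : Q.IsPositive) {r t : ℝ} (hrt : r ≤ t) (x : H)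
    {φ : Lp H 2 (volume : Measure ℝ)}
    (hφ : φ =ᵐ[volume] (Set.Ioc r t).indicator (fun s => opSqrt Q ((T (t - s)).adjoint x))) :
    ‖φ‖ ^ 2 = ⟪covOp T Q (t - r) x, x⟫ := by
  rw [← setIntegral_cov_reflect hQ hrt, ← integral_indicator measurableSet_Ioc,
    ← real_inner_self_eq_norm_sq, L2.inner_def]
  refine integral_congr_ae ?_
  filter_upwards [hφ] with s hs
  rw [hs]
  by_cases h : s ∈ Set.Ioc r t
  · simp only [Set.indicator_of_mem h]
  · simp only [Set.indicator_of_notMem h, inner_zero_left]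

variable [IsProbabilityMeasure P] [MeasurableSpace H] [BorelSpace H]

theorem stochasticConvolution_law (hQ : Q.IsPositive)
    {e : HilbertBasis ι ℝ H} {W : ι → ℝ≥0 → Ω → ℝ} (hW : IsCylindricalBM P W) {WA : ℝ → Ω → H}
    (hWA : IsStochasticConvolution P T Q e W WA) {t : ℝ} (ht : 0 ≤ t) :
    IsCenteredGaussian (P.map (WA t)) (covOp T Q t) := by
  intro h
  obtain ⟨φ, hφ, hmem⟩ := stochasticConvolution_mem hQ hW hWA ht h
  have h1 := (wiener_of_mem e.orthonormal hW hmem).2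
  simp only at h1
  rw [norm_sq_of_ae_eq_indicator hQ ht h hφ, sub_zero] at h1
  rw [← h1, integral_map (hWA t ht).1.aestronglyMeasurable.aemeasurable
    (by apply Continuous.aestronglyMeasurable; fun_prop)]
  refine integral_congr_ae ?_
  filter_upwards [((hWA t ht).1.const_inner (𝕜 := ℝ) h).coeFn_toLp] with ω hω
  rw [hω]

/-- The integrand of `⟨h, W_A(t) - e^{(t-r)A} W_A(r)⟩` lives on `(r, t]`, whereas functionals of the
values at times up to `r` have integrands that vanish after `r`. Disjoint supports make the norms
add in squares, which factorizes the joint characteristic function. -/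
theorem stochasticConvolution_increment (hQ : Q.IsPositive)
    {e : HilbertBasis ι ℝ H} {W : ι → ℝ≥0 → Ω → ℝ} (hW : IsCylindricalBM P W) {WA : ℝ → Ω → H}
    (hWA : IsStochasticConvolution P T Q e W WA) {r t : ℝ} (hr : 0 ≤ r) (hrt : r ≤ t)
    {J : Type*} [Fintype J] (u : J → ℝ) (hu : ∀ j, 0 ≤ u j ∧ u j ≤ r) :
    IsCenteredGaussian (P.map (fun ω => WA t ω - T (t - r) (WA r ω))) (covOp T Q (t - r)) ∧
    IndepFun (fun ω j => WA (u j) ω) (fun ω => WA t ω - T (t - r) (WA r ω)) P := by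
  classical
  have ht : 0 ≤ t := hr.trans hrt
  have hm : ∀ s, 0 ≤ s → AEMeasurable (WA s) P := fun s hs =>
    (hWA s hs).1.aestronglyMeasurable.aemeasurable
  set X : Ω → H := fun ω => WA t ω - T (t - r) (WA r ω) with hX
  have hXm : AEMeasurable X P :=
    (hm t ht).sub ((T (t - r)).continuous.measurable.comp_aemeasurable (hm r hr))
  have hXV : ∀ h : H, ∃ p ∈ wienerSpace P e W, p.1 =ᵐ[P] (fun ω => ⟪h, X ω⟫) ∧
      p.2 =ᵐ[volume] (Set.Ioc r t).indicator (fun s => opSqrt Q ((T (t - s)).adjoint h)) := by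
    intro h
    obtain ⟨φ, hφ, hmem⟩ := stochasticConvolution_mem hQ hW hWA ht h
    obtain ⟨ψ, hψ, hmem'⟩ := stochasticConvolution_mem hQ hW hWA hr ((T (t - r)).adjoint h)
    refine ⟨_, sub_mem hmem hmem', ?_, ?_⟩
    · filter_upwards [((hWA t ht).1.const_inner (𝕜 := ℝ) h).coeFn_toLp,
        ((hWA r hr).1.const_inner (𝕜 := ℝ) ((T (t - r)).adjoint h)).coeFn_toLp,
        Lp.coeFn_sub ((hWA t ht).1.const_inner (𝕜 := ℝ) h).toLp
        ((hWA r hr).1.const_inner (𝕜 := ℝ) ((T (t - r)).adjoint h)).toLp] with ω h1 h2 h3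
      rw [Prod.fst_sub, h3, Pi.sub_apply, h1, h2, ContinuousLinearMap.adjoint_inner_left, hX]
      simp only
      rw [inner_sub_right]
    · filter_upwards [hφ, hψ, Lp.coeFn_sub φ ψ] with s h1 h2 h3
      rw [Prod.snd_sub, h3, Pi.sub_apply, h1, h2]
      by_cases hsr : s ≤ r
      · by_cases hs0 : 0 < s
        -- Before time `r` the two integrands cancel by the semigroup law `e^{(t-s)A} = e^{(t-r)A}
        -- e^{(r-s)A}`.
        · have e1 : (T (t - s)).adjoint h = (T (r - s)).adjoint ((T (t - r)).adjoint h) := by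
            have : T (t - s) = (T (t - r)).comp (T (r - s)) := by
              rw [← T.map_add _ _ (sub_nonneg.2 hrt) (sub_nonneg.2 hsr)]; congr 1; ring
            rw [this, ContinuousLinearMap.adjoint_comp]; rfl
          simp [Set.indicator, hs0, hsr, hsr.trans hrt, not_lt.2 hsr, e1]
        · simp [Set.indicator, hs0, not_lt.2 hsr]
      · have hsr' : r < s := not_le.1 hsr
        simp [Set.indicator, hsr, hsr', hr.trans_lt hsr']
  have hYV : ∀ L : StrongDual ℝ (J → H), ∃ p ∈ wienerSpace P e W,
      p.1 =ᵐ[P] (fun ω => L (fun j => WA (u j) ω)) ∧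
      ∀ᵐ s, r < s → p.2 s = 0 := by
    intro L
    -- The Riesz vectors of the coordinates of `L`: a functional of the past is a finite sum of
    -- pairings `⟨g j, W_A(u j)⟩`.
    set g : J → H := fun j => (InnerProductSpace.toDual ℝ H).symm
      (L.comp (ContinuousLinearMap.single ℝ (fun _ => H) j))
    choose φ hφ hmem using fun j => stochasticConvolution_mem hQ hW hWA (hu j).1 (g j)
    refine ⟨_, Submodule.sum_mem _ (t := Finset.univ) fun j _ => hmem j, ?_, ?_⟩
    · have h2 : ∀ᵐ ω ∂P, ∀ j, (((hWA (u j) (hu j).1).1.const_inner (𝕜 := ℝ) (g j)).toLp :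
          Lp ℝ 2 P) ω = ⟪g j, WA (u j) ω⟫ :=
        ae_all_iff.2 fun j => ((hWA (u j) (hu j).1).1.const_inner (𝕜 := ℝ) (g j)).coeFn_toLp
      rw [Prod.fst_sum]
      filter_upwards [h2, Lp.coeFn_finsetSum Finset.univ (fun j =>
        (((hWA (u j) (hu j).1).1.const_inner (𝕜 := ℝ) (g j)).toLp : Lp ℝ 2 P))] with ω h3 h4
      rw [h4, Finset.sum_apply, ← Finset.univ_sum_single (fun j => WA (u j) ω), map_sum]
      refine Finset.sum_congr rfl fun j _ => ?_
      rw [h3 j]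
      exact InnerProductSpace.toDual_symm_apply
    · have h2 : ∀ᵐ s, ∀ j, φ j s = _ := ae_all_iff.2 hφ
      rw [Prod.snd_sum]
      filter_upwards [h2, Lp.coeFn_finsetSum Finset.univ φ] with s h3 h4 hs
      rw [h4, Finset.sum_apply]
      refine Finset.sum_eq_zero fun j _ => ?_
      rw [h3 j, Set.indicator_of_notMem]
      exact fun h5 => absurd (h5.2.trans (hu j).2) (not_le.2 hs)
  have hYm : AEMeasurable (fun ω j => WA (u j) ω) P :=
    aemeasurable_pi_lambda _ fun j => hm _ (hu j).1
  refine ⟨fun h => ?_, ?_⟩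
  · obtain ⟨p, hp, h1, h2⟩ := hXV h
    have h3 := (wiener_of_mem e.orthonormal hW hp).2
    rw [norm_sq_of_ae_eq_indicator hQ hrt h h2] at h3
    rw [← h3, integral_map hXm (by apply Continuous.aestronglyMeasurable; fun_prop)]
    refine integral_congr_ae ?_
    filter_upwards [h1] with ω hω
    rw [hω]
  · rw [indepFun_iff_charFunDual_prod hYm hXm]
    intro L
    obtain ⟨q, hq, hq1, hq2⟩ := hYV (L.comp (ContinuousLinearMap.inl ℝ _ _))
    obtain ⟨p, hp, hp1, hp2⟩ := hXV ((InnerProductSpace.toDual ℝ H).symm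
      (L.comp (ContinuousLinearMap.inr ℝ _ _)))
    have hp1' : p.1 =ᵐ[P] fun ω => L.comp (ContinuousLinearMap.inr ℝ _ _) (X ω) := by
      filter_upwards [hp1] with ω h
      rw [h]
      exact InnerProductSpace.toDual_symm_apply
    have hqp := wiener_of_mem e.orthonormal hW (add_mem hq hp)
    have horth : ⟪q.2, p.2⟫ = 0 := by
      rw [L2.inner_def]
      refine integral_eq_zero_of_ae ?_
      filter_upwards [hq2, hp2] with s h1 h2
      by_cases hs : r < s
      · rw [h1 hs, inner_zero_left]; rfl
      · rw [h2, Set.indicator_of_notMem (fun h => hs h.1), inner_zero_right]; rfl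
    have hsq : ‖q.2 + p.2‖ ^ 2 = ‖q.2‖ ^ 2 + ‖p.2‖ ^ 2 := by
      rw [norm_add_sq_real, horth]; ring
    have c1 : charFunDual (P.map fun ω => ((fun j => WA (u j) ω), X ω)) L =
        ∫ ω, Complex.exp ((q + p).1 ω * Complex.I) ∂P := by
      rw [charFunDual_apply, integral_map (hYm.prodMk hXm)
        (by apply Continuous.aestronglyMeasurable; fun_prop)]
      refine integral_congr_ae ?_
      filter_upwards [hq1, hp1', Lp.coeFn_add q.1 p.1] with ω h1 h2 h3
      rw [Prod.fst_add, h3, Pi.add_apply, h1, h2, ContinuousLinearMap.comp_apply,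
        ContinuousLinearMap.comp_apply, ← map_add]
      simp
    have c2 : charFunDual (P.map fun ω j => WA (u j) ω) (L.comp (ContinuousLinearMap.inl ℝ _ _)) =
        ∫ ω, Complex.exp (q.1 ω * Complex.I) ∂P := by
      rw [charFunDual_apply, integral_map hYm
        (by apply Continuous.aestronglyMeasurable; fun_prop)]
      refine integral_congr_ae ?_
      filter_upwards [hq1] with ω h1
      rw [h1]
    have c3 : charFunDual (P.map X) (L.comp (ContinuousLinearMap.inr ℝ _ _)) =
        ∫ ω, Complex.exp (p.1 ω * Complex.I) ∂P := by
      rw [charFunDual_apply, integral_map hXm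
        (by apply Continuous.aestronglyMeasurable; fun_prop)]
      refine integral_congr_ae ?_
      filter_upwards [hp1'] with ω h1
      rw [h1]
    rw [c1, c2, c3, hqp.2, (wiener_of_mem e.orthonormal hW hq).2,
      (wiener_of_mem e.orthonormal hW hp).2, ← Complex.exp_add, Prod.snd_add, hsq]
    congr 1
    push_cast
    ring

end GaussianLaws

/-! ### Exponential densities of translates -/

section ShiftDensity

/-- The density of the translate by `K a` of the centered Gaussian measure with covariance `K`. -/
def shiftDensity (K : H →L[ℝ] H) (a z : H) : ℝ := Real.exp (⟪a, z⟫ - ⟪K a, a⟫ / 2)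

theorem continuous_shiftDensity (K : H →L[ℝ] H) (a : H) : Continuous (shiftDensity K a) := by
  unfold shiftDensity; fun_prop

theorem shiftDensity_mul {K : H →L[ℝ] H} (hK : K.IsPositive) (a b z : H) :
    shiftDensity K a z * shiftDensity K b z = Real.exp ⟪K a, b⟫ * shiftDensity K (a + b) z := by
  rw [shiftDensity, shiftDensity, shiftDensity, ← Real.exp_add, ← Real.exp_add]
  congr 1
  have : ⟪K b, a⟫ = ⟪K a, b⟫ := by
    rw [real_inner_comm]; exact (hK.inner_left_eq_inner_right a b).symm
  simp only [map_add, inner_add_left, inner_add_right, this]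
  ring

end ShiftDensity

/-! ### The Cameron–Martin formula for shifts in the range of `K` -/

section CameronMartin

variable [CompleteSpace H] [TopologicalSpace.SeparableSpace H] [MeasurableSpace H] [BorelSpace H]
  {μ : Measure H} [IsProbabilityMeasure μ] {K : H →L[ℝ] H}

theorem IsCenteredGaussian.map_inner (hμ : IsCenteredGaussian μ K) (hK : K.IsPositive) (h : H) :
    μ.map (fun z => ⟪h, z⟫) = gaussianReal 0 (⟪K h, h⟫).toNNReal := by
  have : IsProbabilityMeasure (μ.map (fun z => ⟪h, z⟫)) :=
    Measure.isProbabilityMeasure_map (by fun_prop)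
  refine Measure.ext_of_charFun ?_
  ext t
  rw [charFun_gaussianReal, charFun_apply_real, integral_map (by fun_prop) (by fun_prop),
    Real.coe_toNNReal _ (hK.inner_nonneg_left h)]
  have h1 := hμ (t • h)
  simp only [real_inner_smul_left, map_smul, real_inner_smul_right] at h1
  push_cast at h1
  rw [h1]
  congr 1
  push_cast
  ring

theorem IsCenteredGaussian.memLp_inner (hμ : IsCenteredGaussian μ K) (hK : K.IsPositive) (h : H) :
    MemLp (fun z => ⟪h, z⟫) 2 μ := by
  have h1 : MemLp id 2 (μ.map (fun z => ⟪h, z⟫)) := by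
    rw [hμ.map_inner hK]; exact memLp_id_gaussianReal' 2 (by norm_num)
  exact (memLp_map_measure_iff (f := fun z => ⟪h, z⟫) (g := id) (by fun_prop) (by fun_prop)).1 h1

theorem IsCenteredGaussian.integral_inner (hμ : IsCenteredGaussian μ K) (hK : K.IsPositive)
    (h : H) : ∫ z, ⟪h, z⟫ ∂μ = 0 := by
  have h1 : ∫ x, x ∂(μ.map (fun z => ⟪h, z⟫)) = 0 := by
    rw [hμ.map_inner hK, integral_id_gaussianReal]
  rwa [integral_map (by fun_prop) (by fun_prop)] at h1

theorem IsCenteredGaussian.integral_inner_sq (hμ : IsCenteredGaussian μ K) (hK : K.IsPositive)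
    (h : H) : ∫ z, ⟪h, z⟫ * ⟪h, z⟫ ∂μ = ⟪K h, h⟫ := by
  have h1 := variance_fun_id_gaussianReal (μ := 0) (v := (⟪K h, h⟫).toNNReal)
  rw [← hμ.map_inner hK, variance_eq_integral (by fun_prop)] at h1
  rw [integral_map (by fun_prop) (by fun_prop), integral_map (by fun_prop) (by fun_prop),
    hμ.integral_inner hK, Real.coe_toNNReal _ (hK.inner_nonneg_left h)] at h1
  simpa [sq] using h1

theorem IsCenteredGaussian.integrable_exp (hμ : IsCenteredGaussian μ K) (hK : K.IsPositive)
    (h : H) : Integrable (fun z => Real.exp ⟪h, z⟫) μ := by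
  have h1 := integrable_exp_mul_gaussianReal (μ := 0) (v := (⟪K h, h⟫).toNNReal) 1
  rw [← hμ.map_inner hK, integrable_map_measure (by fun_prop) (by fun_prop)] at h1
  simpa [Function.comp_def] using h1

theorem IsCenteredGaussian.integral_exp (hμ : IsCenteredGaussian μ K) (hK : K.IsPositive)
    (h : H) : ∫ z, Real.exp ⟪h, z⟫ ∂μ = Real.exp (⟪K h, h⟫ / 2) := by
  have h1 := mgf_gaussianReal (hμ.map_inner hK h) 1
  rw [mgf, Real.coe_toNNReal _ (hK.inner_nonneg_left h)] at h1
  simpa using h1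

/-- Uncorrelated jointly Gaussian variables: the mixed term of the quadratic form drops out and the
characteristic function splits. -/
theorem IsCenteredGaussian.indepFun (hμ : IsCenteredGaussian μ K) (hK : K.IsPositive) {a w : H}
    (haw : ⟪K a, w⟫ = 0) : IndepFun (fun z => ⟪w, z⟫) (fun z => ⟪a, z⟫) μ := by
  rw [indepFun_iff_charFunDual_prod (by fun_prop) (by fun_prop)]
  intro L
  have hL : ∀ x y : ℝ, L (x, y) = L (1, 0) * x + L (0, 1) * y := by
    intro x y
    have : ((x, y) : ℝ × ℝ) = x • (1, 0) + y • (0, 1) := by simp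
    rw [this, map_add, map_smul, map_smul, smul_eq_mul, smul_eq_mul]
    ring
  have hw : ⟪K w, a⟫ = 0 := by
    rw [← haw, real_inner_comm]; exact (hK.inner_left_eq_inner_right a w).symm
  simp only [charFunDual_apply]
  rw [integral_map (by fun_prop) (by apply Continuous.aestronglyMeasurable; fun_prop),
    integral_map (by fun_prop) (by apply Continuous.aestronglyMeasurable; fun_prop),
    integral_map (by fun_prop) (by apply Continuous.aestronglyMeasurable; fun_prop)]
  have e1 : ∀ z, L (⟪w, z⟫, ⟪a, z⟫) = ⟪L (1, 0) • w + L (0, 1) • a, z⟫ := fun z => by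
    rw [hL, inner_add_left, real_inner_smul_left, real_inner_smul_left]
  have e2 : ∀ z, L.comp (ContinuousLinearMap.inl ℝ ℝ ℝ) ⟪w, z⟫ = ⟪L (1, 0) • w, z⟫ := fun z => by
    rw [real_inner_smul_left, ContinuousLinearMap.comp_apply, ContinuousLinearMap.inl_apply, hL,
      mul_zero, add_zero]
  have e3 : ∀ z, L.comp (ContinuousLinearMap.inr ℝ ℝ ℝ) ⟪a, z⟫ = ⟪L (0, 1) • a, z⟫ := fun z => by
    rw [real_inner_smul_left, ContinuousLinearMap.comp_apply, ContinuousLinearMap.inr_apply, hL,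
      mul_zero, zero_add]
  simp only [e1, e2, e3]
  rw [hμ, hμ, hμ, ← Complex.exp_add]
  congr 1
  simp only [map_add, map_smul, inner_add_left, inner_add_right, real_inner_smul_left,
    real_inner_smul_right, haw, hw]
  push_cast
  ring

/-- Split `h = w + c a` with `w` orthogonal to `a` for the covariance form. Then `⟨w, z⟩` and `⟨a,
z⟩` are independent, and the integral is a characteristic function times a one-dimensional complex
moment generating function at `1 + c i`. -/
theorem IsCenteredGaussian.charFun_tilt (hμ : IsCenteredGaussian μ K) (hK : K.IsPositive)
    (a h : H) : ∫ z, Complex.exp (⟪h, z⟫ * Complex.I) * Complex.exp ⟪a, z⟫ ∂μ =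
      Complex.exp (-(⟪K h, h⟫ : ℝ) / 2 + ⟪K a, h⟫ * Complex.I + (⟪K a, a⟫ : ℝ) / 2) := by
  set σ := ⟪K a, a⟫ with hσ
  -- If `⟨K a, a⟩ = 0` then `K^{1/2} a = 0`, so `⟨K a, h⟩ = 0` as well and `c = 0` serves.
  obtain ⟨c, hc⟩ : ∃ c : ℝ, ⟪K a, h⟫ = c * σ := by
    by_cases h0 : σ = 0
    · refine ⟨0, ?_⟩
      rw [hσ, ← norm_opSqrt_sq hK] at h0
      have h0 : opSqrt K a = 0 := by simpa using h0
      rw [← inner_opSqrt_opSqrt hK, h0, inner_zero_left, zero_mul]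
    · exact ⟨⟪K a, h⟫ / σ, by field_simp⟩
  set w := h - c • a with hw
  have haw : ⟪K a, w⟫ = 0 := by
    rw [hw, inner_sub_right, real_inner_smul_right, hc, sub_self]
  have hwa : ⟪K w, a⟫ = 0 := by
    rw [← haw, real_inner_comm]; exact (hK.inner_left_eq_inner_right a w).symm
  have hhw : h = w + c • a := by rw [hw]; abel
  have hind := (hμ.indepFun hK haw).comp
    (φ := fun x : ℝ => Complex.exp (x * Complex.I))
    (ψ := fun x : ℝ => Complex.exp ((1 + c * Complex.I) * x)) (by fun_prop) (by fun_prop)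
  have hprod := hind.integral_fun_mul_eq_mul_integral
    (by apply Continuous.aestronglyMeasurable; simp only [Function.comp_def]; fun_prop)
    (by apply Continuous.aestronglyMeasurable; simp only [Function.comp_def]; fun_prop)
  simp only [Function.comp] at hprod
  have e1 : ∀ z, Complex.exp (⟪h, z⟫ * Complex.I) * Complex.exp ⟪a, z⟫ =
      Complex.exp (⟪w, z⟫ * Complex.I) * Complex.exp ((1 + c * Complex.I) * ⟪a, z⟫) := by
    intro z
    rw [← Complex.exp_add, ← Complex.exp_add]
    congr 1
    rw [hhw, inner_add_left, real_inner_smul_left]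
    push_cast
    ring
  simp only [e1]
  rw [hprod, hμ]
  have h2 := complexMGF_gaussianReal (hμ.map_inner hK a) (1 + c * Complex.I)
  rw [complexMGF, Real.coe_toNNReal _ (hK.inner_nonneg_left a)] at h2
  rw [h2, ← Complex.exp_add]
  congr 1
  have h3 : ⟪K h, h⟫ = ⟪K w, w⟫ + c ^ 2 * σ := by
    rw [hhw]
    simp only [map_add, map_smul, inner_add_left, inner_add_right, real_inner_smul_left,
      real_inner_smul_right, haw, hwa, ← hσ]
    ring
  rw [h3, hc, ← hσ]
  push_cast
  linear_combination (-(c : ℂ) ^ 2 * σ / 2 * (-1)) * Complex.I_sq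

theorem integrable_shiftDensity (hμ : IsCenteredGaussian μ K) (hK : K.IsPositive) (a : H) :
    Integrable (shiftDensity K a) μ := by
  unfold shiftDensity
  simp only [Real.exp_sub]
  exact (hμ.integrable_exp hK a).div_const _

theorem map_add_eq_withDensity (hμ : IsCenteredGaussian μ K) (hK : K.IsPositive) (a : H) :
    μ.map (fun z => z + K a) = μ.withDensity (fun z => ENNReal.ofReal (shiftDensity K a z)) := by
  have : IsFiniteMeasure (μ.withDensity (fun z => ENNReal.ofReal (shiftDensity K a z))) :=
    isFiniteMeasure_withDensity_ofReal (integrable_shiftDensity hμ hK a).2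
  refine Measure.ext_of_charFun ?_
  ext h
  rw [charFun_apply, charFun_apply,
    integral_map (by fun_prop) (by apply Continuous.aestronglyMeasurable; fun_prop),
    integral_withDensity_eq_integral_toReal_smul
      (continuous_shiftDensity K a).measurable.ennreal_ofReal (by simp)]
  have e1 : ∀ z, Complex.exp (⟪z + K a, h⟫ * Complex.I) =
      Complex.exp (⟪h, z⟫ * Complex.I) * Complex.exp (⟪K a, h⟫ * Complex.I) := by
    intro z
    rw [← Complex.exp_add, inner_add_left, real_inner_comm]
    congr 1; push_cast; ring
  have e2 : ∀ z, (ENNReal.ofReal (shiftDensity K a z)).toReal • Complex.exp (⟪z, h⟫ * Complex.I) =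
      Complex.exp (⟪h, z⟫ * Complex.I) * Complex.exp ⟪a, z⟫ *
        Complex.exp (-(⟪K a, a⟫ : ℝ) / 2) := by
    intro z
    rw [ENNReal.toReal_ofReal (by unfold shiftDensity; positivity), shiftDensity,
      Complex.real_smul, Complex.ofReal_exp, real_inner_comm h z, ← Complex.exp_add,
      ← Complex.exp_add, ← Complex.exp_add]
    congr 1; push_cast; ring
  simp only [e1, e2]
  rw [integral_mul_const, integral_mul_const, hμ, hμ.charFun_tilt hK, ← Complex.exp_add,
    ← Complex.exp_add]
  congr 1
  ring

theorem integral_shift (hμ : IsCenteredGaussian μ K) (hK : K.IsPositive) (a : H) {f : H → ℝ}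
    (hf : Measurable f) : ∫ z, f (z + K a) ∂μ = ∫ z, shiftDensity K a z * f z ∂μ := by
  rw [← integral_map (φ := fun z => z + K a) (by fun_prop) hf.aestronglyMeasurable,
    map_add_eq_withDensity hμ hK, integral_withDensity_eq_integral_toReal_smul
      (continuous_shiftDensity K a).measurable.ennreal_ofReal (by simp)]
  refine integral_congr_ae (Eventually.of_forall fun z => ?_)
  simp only
  rw [ENNReal.toReal_ofReal (by unfold shiftDensity; positivity), smul_eq_mul]

theorem integral_shiftDensity (hμ : IsCenteredGaussian μ K) (hK : K.IsPositive) (a : H) :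
    ∫ z, shiftDensity K a z ∂μ = 1 := by
  unfold shiftDensity
  simp only [Real.exp_sub]
  rw [integral_div, hμ.integral_exp hK, div_self (Real.exp_ne_zero _)]

theorem memLp_shiftDensity (hμ : IsCenteredGaussian μ K) (hK : K.IsPositive) (a : H) :
    MemLp (shiftDensity K a) 2 μ := by
  rw [memLp_two_iff_integrable_sq (continuous_shiftDensity K a).aestronglyMeasurable]
  simp only [sq, shiftDensity_mul hK]
  exact (integrable_shiftDensity hμ hK _).const_mul _

theorem integral_shiftDensity_mul (hμ : IsCenteredGaussian μ K) (hK : K.IsPositive) (a b : H) :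
    ∫ z, shiftDensity K a z * shiftDensity K b z ∂μ = Real.exp ⟪K a, b⟫ := by
  simp only [shiftDensity_mul hK]
  rw [integral_const_mul, integral_shiftDensity hμ hK, mul_one]

theorem inner_toLp {Ω : Type*} [MeasurableSpace Ω] {P : Measure Ω} {f g : Ω → ℝ}
    (hf : MemLp f 2 P) (hg : MemLp g 2 P) : ⟪hf.toLp, hg.toLp⟫ = ∫ ω, f ω * g ω ∂P := by
  rw [L2.inner_def]
  refine integral_congr_ae ?_
  filter_upwards [hf.coeFn_toLp, hg.coeFn_toLp] with ω h1 h2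
  rw [h1, h2, real_inner_eq_re_inner]
  simp [mul_comm]

/-- The distance depends on `a` and `b` only through `K^{1/2} a` and `K^{1/2} b`. This is what lets
the densities extend by continuity to shifts by arbitrary `K^{1/2} g`. -/
theorem norm_shiftDensity_sub_sq (hμ : IsCenteredGaussian μ K) (hK : K.IsPositive) (a b : H) :
    ‖(memLp_shiftDensity hμ hK a).toLp - (memLp_shiftDensity hμ hK b).toLp‖ ^ 2 =
      Real.exp (‖opSqrt K a‖ ^ 2) - 2 * Real.exp ⟪opSqrt K a, opSqrt K b⟫ +
        Real.exp (‖opSqrt K b‖ ^ 2) := by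
  rw [norm_sub_sq_real, ← real_inner_self_eq_norm_sq, ← real_inner_self_eq_norm_sq, inner_toLp,
    inner_toLp, inner_toLp, integral_shiftDensity_mul hμ hK, integral_shiftDensity_mul hμ hK,
    integral_shiftDensity_mul hμ hK, norm_opSqrt_sq hK, norm_opSqrt_sq hK, inner_opSqrt_opSqrt hK]

/-- The only inner product not already available, that of the density with `⟨a, ·⟩`, is the mean of
`⟨a, z + K a⟩`. The identity is exact, so it survives the passage from `K^{1/2} a` to general `g`.
-/
theorem norm_shiftDensity_sub_linear_sq (hμ : IsCenteredGaussian μ K) (hK : K.IsPositive) (a : H) :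
    ‖(memLp_shiftDensity hμ hK a).toLp - (memLp_const (1 : ℝ)).toLp -
        (hμ.memLp_inner hK a).toLp‖ ^ 2 =
      Real.exp (‖opSqrt K a‖ ^ 2) - 1 - ‖opSqrt K a‖ ^ 2 := by
  have h1 : ∫ z, shiftDensity K a z * ⟪a, z⟫ ∂μ = ⟪K a, a⟫ := by
    rw [← integral_shift hμ hK a (f := fun z => ⟪a, z⟫) (by fun_prop)]
    simp only [inner_add_right]
    rw [integral_add ((hμ.memLp_inner hK a).integrable (by norm_num)) (integrable_const _),
      hμ.integral_inner hK, real_inner_comm]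
    simp
  rw [norm_sub_sq_real, norm_sub_sq_real, inner_sub_left, ← real_inner_self_eq_norm_sq,
    ← real_inner_self_eq_norm_sq, ← real_inner_self_eq_norm_sq, inner_toLp, inner_toLp, inner_toLp,
    inner_toLp, inner_toLp, inner_toLp, h1, integral_shiftDensity_mul hμ hK,
    hμ.integral_inner_sq hK, norm_opSqrt_sq hK]
  simp only [mul_one, one_mul]
  rw [integral_shiftDensity hμ hK, hμ.integral_inner hK]
  simp
  ring

end CameronMartin

/-! ### White noise map, Cameron–Martin shifts and Gaussian smoothing -/

section WhiteNoise

variable [CompleteSpace H] [TopologicalSpace.SeparableSpace H] [MeasurableSpace H] [BorelSpace H]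
  {μ : Measure H} [IsProbabilityMeasure μ] {K : H →L[ℝ] H}

theorem IsCenteredGaussian.norm_toLp_inner (hμ : IsCenteredGaussian μ K) (hK : K.IsPositive)
    (a : H) : ‖(hμ.memLp_inner hK a).toLp‖ = ‖opSqrt K a‖ := by
  rw [← sq_eq_sq₀ (norm_nonneg _) (norm_nonneg _), norm_opSqrt_sq hK, ← real_inner_self_eq_norm_sq,
    inner_toLp, hμ.integral_inner_sq hK]

/-- The map `K^{1/2} a ↦ ⟨a, ·⟩` is isometric into `L²(μ)` and defined on a dense subspace, so it
extends. -/
theorem exists_whiteNoise (hμ : IsCenteredGaussian μ K) (hK : K.IsPositive)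
    (hinj : ∀ x, K x = 0 → x = 0) :
    ∃ I : H →L[ℝ] Lp ℝ 2 μ, (∀ a, I (opSqrt K a) = (hμ.memLp_inner hK a).toLp) ∧
      ∀ g, ‖I g‖ ≤ ‖g‖ := by
  let f : H →ₗ[ℝ] Lp ℝ 2 μ :=
    { toFun := fun a => (hμ.memLp_inner hK a).toLp
      map_add' := fun a b => by
        rw [← MemLp.toLp_add]
        exact MemLp.toLp_congr _ _ (Eventually.of_forall fun z => inner_add_left _ _ _)
      map_smul' := fun c a => by
        rw [← MemLp.toLp_const_smul]
        exact MemLp.toLp_congr _ _ (Eventually.of_forall fun z => real_inner_smul_left _ _ _) }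
  have hd : DenseRange ((opSqrt K : H →L[ℝ] H) : H →ₗ[ℝ] H) := denseRange_opSqrt hK hinj
  have hb : ∀ x, ‖f x‖ ≤ 1 * ‖((opSqrt K : H →L[ℝ] H) : H →ₗ[ℝ] H) x‖ := fun x => by
    rw [one_mul]; exact (hμ.norm_toLp_inner hK x).le
  refine ⟨f.extendOfNorm ((opSqrt K : H →L[ℝ] H) : H →ₗ[ℝ] H), fun a => ?_, fun g => ?_⟩
  · exact LinearMap.extendOfNorm_eq hd ⟨1, hb⟩ a
  · simpa using LinearMap.norm_extendOfNorm_apply_le hd 1 hb g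

open scoped Classical in
/-- The white noise map `g ↦ ⟨g, K^{-1/2} ·⟩ ∈ L²(μ)` of a centered Gaussian measure `μ` with
covariance `K`. -/
def whiteNoise (μ : Measure H) [IsProbabilityMeasure μ] (K : H →L[ℝ] H) : H →L[ℝ] Lp ℝ 2 μ :=
  if h : ∃ I : H →L[ℝ] Lp ℝ 2 μ, (∀ a, I (opSqrt K a) =ᵐ[μ] fun z => ⟪a, z⟫) ∧ ∀ g, ‖I g‖ ≤ ‖g‖
  then h.choose else 0

theorem whiteNoise_spec (hμ : IsCenteredGaussian μ K) (hK : K.IsPositive)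
    (hinj : ∀ x, K x = 0 → x = 0) :
    (∀ a, whiteNoise μ K (opSqrt K a) = (hμ.memLp_inner hK a).toLp) ∧
      ∀ g, ‖whiteNoise μ K g‖ ≤ ‖g‖ := by
  have h : ∃ I : H →L[ℝ] Lp ℝ 2 μ, (∀ a, I (opSqrt K a) =ᵐ[μ] fun z => ⟪a, z⟫) ∧
      ∀ g, ‖I g‖ ≤ ‖g‖ := by
    obtain ⟨I, h1, h2⟩ := exists_whiteNoise hμ hK hinj
    exact ⟨I, fun a => by rw [h1]; exact MemLp.coeFn_toLp _, h2⟩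
  rw [whiteNoise, dif_pos h]
  exact ⟨fun a => Lp.ext ((h.choose_spec.1 a).trans (MemLp.coeFn_toLp _).symm), h.choose_spec.2⟩

/-- Translates by elements of the Cameron–Martin space have a square integrable density, and its
second order Taylor remainder is controlled. -/
theorem exists_density_opSqrt (hμ : IsCenteredGaussian μ K) (hK : K.IsPositive)
    (hinj : ∀ x, K x = 0 → x = 0) (g : H) :
    ∃ r : Lp ℝ 2 μ, (∀ f : H → ℝ, Measurable f →
        ∫ z, f (z + opSqrt K g) ∂μ = ∫ z, r z * f z ∂μ) ∧
      ‖r - (memLp_const (1 : ℝ)).toLp - whiteNoise μ K g‖ ^ 2 =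
        Real.exp (‖g‖ ^ 2) - 1 - ‖g‖ ^ 2 := by
  set S := opSqrt K with hS
  obtain ⟨hI, -⟩ := whiteNoise_spec hμ hK hinj
  obtain ⟨u, hu⟩ : ∃ u : ℕ → H, Tendsto (fun n => S (u n)) atTop (𝓝 g) := by
    obtain ⟨v, hv, hvg⟩ := mem_closure_iff_seq_limit.1 (denseRange_opSqrt hK hinj g)
    choose u hu using hv
    exact ⟨u, by rw [show (fun n => S (u n)) = v from funext hu]; exact hvg⟩
  set ρ : ℕ → Lp ℝ 2 μ := fun n => (memLp_shiftDensity hμ hK (u n)).toLp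
  -- By `norm_shiftDensity_sub_sq` the distance of two densities is a continuous function of the
  -- pair of vectors `S (u n)` that vanishes on the diagonal.
  have hc : Cauchy (map ρ atTop) := by
    refine cauchy_map_iff.2 ⟨inferInstance, ?_⟩
    rw [Metric.uniformity_eq_comap_nhds_zero, tendsto_comap_iff]
    have h1 : Tendsto (fun q : ℕ × ℕ => (S (u q.1), S (u q.2))) (atTop ×ˢ atTop) (𝓝 (g, g)) :=
      (hu.comp tendsto_fst).prodMk_nhds (hu.comp tendsto_snd)
    have h2 : Continuous fun y : H × H => Real.sqrt (Real.exp (‖y.1‖ ^ 2) -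
        2 * Real.exp ⟪y.1, y.2⟫ + Real.exp (‖y.2‖ ^ 2)) := by fun_prop
    have h3 := (h2.tendsto (g, g)).comp h1
    have h4 : Real.exp (‖g‖ ^ 2) - 2 * Real.exp ⟪g, g⟫ + Real.exp (‖g‖ ^ 2) = 0 := by
      rw [real_inner_self_eq_norm_sq]; ring
    simp only [h4, Real.sqrt_zero] at h3
    refine h3.congr fun q => ?_
    simp only [Function.comp, dist_eq_norm]
    rw [← norm_shiftDensity_sub_sq hμ hK, Real.sqrt_sq (norm_nonneg _)]
  obtain ⟨r, hr⟩ := CompleteSpace.complete hc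
  have hr : Tendsto ρ atTop (𝓝 r) := hr
  have hr0 : 0 ≤ᵐ[μ] r := by
    obtain ⟨ns, -, hae⟩ := (tendstoInMeasure_of_tendsto_Lp hr).exists_seq_tendsto_ae'
    have h1 : ∀ᵐ z ∂μ, ∀ n, ρ n z = shiftDensity K (u n) z :=
      ae_all_iff.2 fun n => (memLp_shiftDensity hμ hK (u n)).coeFn_toLp
    filter_upwards [hae, h1] with z h2 h3
    refine ge_of_tendsto' h2 fun n => ?_
    rw [h3]
    exact (Real.exp_pos _).le
  have hrint : Integrable r μ := (Lp.memLp r).integrable (by norm_num)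
  have hfin : IsFiniteMeasure (μ.withDensity fun z => ENNReal.ofReal (r z)) :=
    isFiniteMeasure_withDensity_ofReal hrint.2
  have hdens : ∀ f : H → ℝ, ∫ z, f z ∂(μ.withDensity fun z => ENNReal.ofReal (r z)) =
      ∫ z, r z * f z ∂μ := by
    intro f
    rw [integral_withDensity_eq_integral_toReal_smul₀ hrint.1.aemeasurable.ennreal_ofReal
      (by simp)]
    refine integral_congr_ae ?_
    filter_upwards [hr0] with z hz
    rw [ENNReal.toReal_ofReal hz, smul_eq_mul]
  have hprob : IsProbabilityMeasure (μ.map (fun z => z + S g)) :=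
    Measure.isProbabilityMeasure_map (by fun_prop)
  -- The two finite measures are compared on bounded continuous functions: the shifts converge
  -- pointwise, and the densities converge in `L²`.
  have hmeas : μ.map (fun z => z + S g) = μ.withDensity fun z => ENNReal.ofReal (r z) := by
    refine ext_of_forall_integral_eq_of_IsFiniteMeasure fun f => ?_
    rw [hdens, integral_map (by fun_prop) f.continuous.measurable.aestronglyMeasurable]
    have hfm : MemLp f 2 μ := MemLp.of_bound f.continuous.measurable.aestronglyMeasurable ‖f‖
      (Eventually.of_forall f.norm_coe_le_norm)
    have h1 : Tendsto (fun n => ∫ z, f (z + K (u n)) ∂μ) atTop (𝓝 (∫ z, f (z + S g) ∂μ)) := by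
      refine tendsto_integral_of_dominated_convergence (fun _ => ‖f‖)
        (fun n => (f.continuous.comp (by fun_prop)).measurable.aestronglyMeasurable)
        (integrable_const _) (fun n => Eventually.of_forall fun z => f.norm_coe_le_norm _)
        (Eventually.of_forall fun z => ?_)
      have h2 : Tendsto (fun n => z + K (u n)) atTop (𝓝 (z + S g)) := by
        have h3 := (S.continuous.tendsto g).comp hu
        simp only [Function.comp_def, hS, opSqrt_apply_apply hK] at h3
        exact tendsto_const_nhds.add h3
      exact (f.continuous.tendsto _).comp h2
    have h2 : Tendsto (fun n => ⟪ρ n, hfm.toLp⟫) atTop (𝓝 ⟪r, hfm.toLp⟫) :=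
      hr.inner tendsto_const_nhds
    have h3 : ∀ n, ⟪ρ n, hfm.toLp⟫ = ∫ z, f (z + K (u n)) ∂μ := fun n => by
      rw [inner_toLp, integral_shift hμ hK _ f.continuous.measurable]
    have h4 : ⟪r, hfm.toLp⟫ = ∫ z, r z * f z ∂μ := by
      rw [L2.inner_def]
      refine integral_congr_ae ?_
      filter_upwards [hfm.coeFn_toLp] with z hz
      rw [hz, real_inner_eq_re_inner]
      simp [mul_comm]
    simp only [h3] at h2
    rw [← h4]
    exact tendsto_nhds_unique h1 h2
  refine ⟨r, fun f hf => ?_, ?_⟩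
  · rw [← hdens, ← hmeas, integral_map (by fun_prop) hf.aestronglyMeasurable]
  · have h1 : Tendsto (fun n => ‖ρ n - (memLp_const (1 : ℝ)).toLp - whiteNoise μ K (S (u n))‖ ^ 2)
        atTop (𝓝 (‖r - (memLp_const (1 : ℝ)).toLp - whiteNoise μ K g‖ ^ 2)) :=
      (((hr.sub tendsto_const_nhds).sub
        (((whiteNoise μ K).continuous.tendsto g).comp hu)).norm).pow 2
    have h2 : Tendsto (fun n => Real.exp (‖S (u n)‖ ^ 2) - 1 - ‖S (u n)‖ ^ 2) atTop
        (𝓝 (Real.exp (‖g‖ ^ 2) - 1 - ‖g‖ ^ 2)) := by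
      have h3 : Continuous fun y : H => Real.exp (‖y‖ ^ 2) - 1 - ‖y‖ ^ 2 := by fun_prop
      exact (h3.tendsto g).comp hu
    refine tendsto_nhds_unique h1 (h2.congr fun n => ?_)
    rw [hI, norm_shiftDensity_sub_linear_sq hμ hK]

theorem memLp_of_measurable_bounded {f : H → ℝ} {M : ℝ} (hf : Measurable f)
    (hM : ∀ x, |f x| ≤ M) (y : H) : MemLp (fun z => f (y + z)) 2 μ :=
  MemLp.of_bound (hf.comp (measurable_const_add y)).aestronglyMeasurable M (Eventually.of_forall fun z => hM _)

/-- The derivative of `x ↦ E f(T x + Y)` for `T = K^{1/2} L`. -/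
def gaussianFDeriv (μ : Measure H) [IsProbabilityMeasure μ] (K L : H →L[ℝ] H) (F : Lp ℝ 2 μ) :
    H →L[ℝ] ℝ :=
  (innerSL ℝ F).comp ((whiteNoise μ K).comp L)

theorem gaussianFDeriv_apply (L : H →L[ℝ] H) (F : Lp ℝ 2 μ) (h : H) :
    gaussianFDeriv μ K L F h = ⟪F, whiteNoise μ K (L h)⟫ := rfl

theorem norm_toLp_le_of_bounded {f : H → ℝ} {M : ℝ} (hf : Measurable f)
    (hM : ∀ x, |f x| ≤ M) (y : H) :
    ‖(memLp_of_measurable_bounded (μ := μ) hf hM y).toLp‖ ≤ M := by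
  have hM0 : 0 ≤ M := (abs_nonneg _).trans (hM 0)
  refine (Lp.norm_le_of_ae_bound hM0 ?_).trans (by simp [measureUnivNNReal])
  filter_upwards [(memLp_of_measurable_bounded (μ := μ) hf hM y).coeFn_toLp] with z hz
  rw [hz]
  exact hM _

theorem abs_gaussianFDeriv_le (hμ : IsCenteredGaussian μ K) (hK : K.IsPositive)
    (hinj : ∀ x, K x = 0 → x = 0) {f : H → ℝ} {M : ℝ} (hf : Measurable f) (hM : ∀ x, |f x| ≤ M)
    (L : H →L[ℝ] H) (y h : H) :
    |gaussianFDeriv μ K L (memLp_of_measurable_bounded (μ := μ) hf hM y).toLp h| ≤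
      M * ‖L h‖ := by
  rw [gaussianFDeriv_apply]
  have hM0 : 0 ≤ M := (abs_nonneg _).trans (hM 0)
  refine (abs_real_inner_le_norm _ _).trans ?_
  gcongr
  · exact norm_toLp_le_of_bounded hf hM y
  · exact (whiteNoise_spec hμ hK hinj).2 _

/-- The increment `T h = K^{1/2} (L h)` is absorbed into the density `r` of a shift. The Taylor
remainder is then the `L²` inner product of a function bounded by `M` with `r - 1 - whiteNoise μ K
(L h)`, whose norm is explicit. No regularity of `f` enters. -/
theorem hasFDerivAt_gaussian_smoothing (hμ : IsCenteredGaussian μ K) (hK : K.IsPositive)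
    (hinj : ∀ x, K x = 0 → x = 0) {f : H → ℝ} {M : ℝ} (hf : Measurable f) (hM : ∀ x, |f x| ≤ M)
    {T L : H →L[ℝ] H} (hTL : (opSqrt K).comp L = T) (x : H) :
    HasFDerivAt (fun x => ∫ z, f (T x + z) ∂μ)
      (gaussianFDeriv μ K L (memLp_of_measurable_bounded (μ := μ) hf hM (T x)).toLp) x := by
  have hM0 : 0 ≤ M := (abs_nonneg _).trans (hM 0)
  have key : ∀ h : H, ‖(∫ z, f (T (x + h) + z) ∂μ) - (∫ z, f (T x + z) ∂μ) -
      gaussianFDeriv μ K L (memLp_of_measurable_bounded (μ := μ) hf hM (T x)).toLp h‖ ≤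
      M * Real.sqrt (Real.exp (‖L h‖ ^ 2) - 1 - ‖L h‖ ^ 2) := by
    intro h
    obtain ⟨r, hr1, hr2⟩ := exists_density_opSqrt hμ hK hinj (L h)
    set F := (memLp_of_measurable_bounded (μ := μ) hf hM (T x)) with hF
    have e1 : ∫ z, f (T (x + h) + z) ∂μ = ⟪F.toLp, r⟫ := by
      have e2 := hr1 (fun z => f (T x + z)) (by fun_prop)
      have e3 : ∀ z, T x + (z + opSqrt K (L h)) = T (x + h) + z := fun z => by
        rw [map_add, ← hTL]; simp only [ContinuousLinearMap.comp_apply]; abel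
      simp only [e3] at e2
      rw [e2, L2.inner_def]
      refine integral_congr_ae ?_
      filter_upwards [F.coeFn_toLp] with z hz
      rw [hz, real_inner_eq_re_inner]
      simp
    have e2 : ∫ z, f (T x + z) ∂μ = ⟪F.toLp, (memLp_const (1 : ℝ)).toLp⟫ := by
      rw [inner_toLp]; simp
    rw [e1, e2, gaussianFDeriv_apply, ← inner_sub_right, ← inner_sub_right, ← hr2,
      Real.sqrt_sq (norm_nonneg _)]
    exact (norm_inner_le_norm _ _).trans (mul_le_mul_of_nonneg_right
      (norm_toLp_le_of_bounded hf hM _) (norm_nonneg _))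
  refine HasFDerivAt.of_isLittleO ?_
  have hO : (fun x' => (∫ z, f (T x' + z) ∂μ) - (∫ z, f (T x + z) ∂μ) -
      gaussianFDeriv μ K L (memLp_of_measurable_bounded (μ := μ) hf hM (T x)).toLp (x' - x))
      =O[𝓝 x] fun x' => ‖x' - x‖ ^ 2 := by
    refine Asymptotics.IsBigO.of_bound (M * ‖L‖ ^ 2) ?_
    have hnear : ∀ᶠ x' in 𝓝 x, ‖L (x' - x)‖ < 1 := by
      have : Continuous fun x' => ‖L (x' - x)‖ := by fun_prop
      have h0 := this.tendsto x
      rw [sub_self, map_zero, norm_zero] at h0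
      exact h0.eventually_lt_const one_pos
    filter_upwards [hnear] with x' hx'
    have h1 := key (x' - x)
    rw [add_sub_cancel] at h1
    refine h1.trans ?_
    set a := ‖L (x' - x)‖ with ha
    have ha0 : 0 ≤ a := norm_nonneg _
    -- From `|exp y - 1 - y| ≤ y²` for `|y| ≤ 1`, with `y = a²`; this is why `x'` was restricted to
    -- `‖L (x' - x)‖ < 1`.
    have h2 : Real.sqrt (Real.exp (a ^ 2) - 1 - a ^ 2) ≤ a ^ 2 := by
      refine Real.sqrt_le_iff.2 ⟨by positivity, ?_⟩
      have := Real.abs_exp_sub_one_sub_id_le (x := a ^ 2) (by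
        rw [abs_of_nonneg (by positivity)]; nlinarith)
      exact (le_abs_self _).trans this
    have h3 : a ≤ ‖L‖ * ‖x' - x‖ := L.le_opNorm _
    rw [norm_pow, norm_norm, mul_assoc, ← mul_pow]
    refine mul_le_mul_of_nonneg_left (h2.trans ?_) hM0
    exact pow_le_pow_left₀ ha0 h3 2
  refine hO.trans_isLittleO ?_
  have h4 : (fun x' : H => ‖x' - x‖ ^ 2) =o[𝓝 x] fun x' => ‖x' - x‖ := by
    have h5 : Tendsto (fun x' : H => ‖x' - x‖) (𝓝 x) (𝓝 0) := by
      have : Continuous fun x' : H => ‖x' - x‖ := by fun_prop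
      simpa using this.tendsto x
    exact (Asymptotics.isLittleO_pow_id (𝕜 := ℝ) (n := 2) (by norm_num)).comp_tendsto h5
  exact h4.of_norm_right

end WhiteNoise

/-! ### The pairing `⟨η, K^{-1/2} Y⟩` with an independent random vector -/

section WhitePairing

variable [CompleteSpace H] [TopologicalSpace.SeparableSpace H] [MeasurableSpace H] [BorelSpace H]
  {μ : Measure H} [IsProbabilityMeasure μ] {K : H →L[ℝ] H}
  {G : Type*} [MeasurableSpace G] {ν : Measure G} [IsProbabilityMeasure ν]

theorem IsCenteredGaussian.eLpNorm_inner (hμ : IsCenteredGaussian μ K) (hK : K.IsPositive)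
    (a : H) : eLpNorm (fun y => ⟪a, y⟫) 2 μ = ‖opSqrt K a‖ₑ := by
  rw [← Lp.enorm_toLp (hf := hμ.memLp_inner hK a), ← ofReal_norm, hμ.norm_toLp_inner hK,
    ofReal_norm]

/-- With the first variable frozen, the pairing has second moment `‖K^{1/2} F(g)‖²`; integrate over
`g`. -/
theorem IsCenteredGaussian.eLpNorm_inner_prod (hμ : IsCenteredGaussian μ K) (hK : K.IsPositive)
    {F : G → H} (hF : Measurable F) :
    eLpNorm (fun q : G × H => ⟪F q.1, q.2⟫) 2 (ν.prod μ) =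
      eLpNorm (fun g => opSqrt K (F g)) 2 ν := by
  rw [eLpNorm_eq_lintegral_rpow_enorm_toReal (by norm_num) (by norm_num),
    eLpNorm_eq_lintegral_rpow_enorm_toReal (by norm_num) (by norm_num)]
  congr 1
  rw [lintegral_prod _ (by fun_prop)]
  refine lintegral_congr fun g => ?_
  have h := hμ.eLpNorm_inner hK (F g)
  rw [eLpNorm_eq_lintegral_rpow_enorm_toReal (by norm_num) (by norm_num)] at h
  rw [← h, ← ENNReal.rpow_mul]
  norm_num

theorem tendsto_eLpNorm_regInvSqrt (hK : K.IsPositive) (hinj : ∀ x, K x = 0 → x = 0)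
    {b : G → H} (hb : Measurable b) {C : ℝ} (hC : ∀ g, ‖b g‖ ≤ C) :
    Tendsto (fun ε => eLpNorm (fun g => opSqrt K (regInvSqrt K ε (b g)) - b g) 2 ν)
      (𝓝[>] 0) (𝓝 0) := by
  have h : Tendsto (fun ε => ∫⁻ g, ‖opSqrt K (regInvSqrt K ε (b g)) - b g‖ₑ ^ (2 : ℝ) ∂ν)
      (𝓝[>] 0) (𝓝 (∫⁻ _, 0 ∂ν)) := by
    refine tendsto_lintegral_filter_of_dominated_convergence
      (fun _ => ENNReal.ofReal (2 * C) ^ (2 : ℝ))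
      (Eventually.of_forall fun ε => by fun_prop) ?_ (by simp [ENNReal.mul_eq_top]) ?_
    · filter_upwards [self_mem_nhdsWithin] with ε hε
      refine Eventually.of_forall fun g => ?_
      gcongr
      rw [← ofReal_norm]
      refine ENNReal.ofReal_le_ofReal ((norm_sub_le _ _).trans ?_)
      linarith [norm_opSqrt_regInvSqrt_le hK hε (b g), hC g]
    · refine Eventually.of_forall fun g => ?_
      have h1 := (tendsto_opSqrt_regInvSqrt hK hinj (b g)).sub_const (b g)
      rw [sub_self] at h1
      have h2 : Continuous fun y : H => ‖y‖ₑ ^ (2 : ℝ) :=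
        ENNReal.continuous_rpow_const.comp continuous_enorm
      have h3 := (h2.tendsto 0).comp h1
      simp only [Function.comp_def, enorm_zero,
        ENNReal.zero_rpow_of_pos (show (0 : ℝ) < 2 by norm_num)] at h3
      exact h3
  simp only [lintegral_zero] at h
  have h3 := ((ENNReal.continuous_rpow_const (y := (1 / 2 : ℝ))).tendsto 0).comp h
  simp only [ENNReal.zero_rpow_of_pos (show (0 : ℝ) < 1 / 2 by norm_num)] at h3
  refine h3.congr fun ε => ?_
  rw [eLpNorm_eq_lintegral_rpow_enorm_toReal (by norm_num) (by norm_num)]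
  simp

/-- The white noise pairing with a random vector, on the product space. -/
theorem exists_whitePairing_prod (hμ : IsCenteredGaussian μ K) (hK : K.IsPositive)
    (hinj : ∀ x, K x = 0 → x = 0) {b : G → H} (hb : Measurable b) {C : ℝ}
    (hC : ∀ g, ‖b g‖ ≤ C) :
    ∃ ρ : G × H → ℝ, Measurable ρ ∧ MemLp ρ 2 (ν.prod μ) ∧
      Tendsto (fun ε => eLpNorm (fun q : G × H => ⟪regInvSqrt K ε (b q.1), q.2⟫ - ρ q) 2
        (ν.prod μ)) (𝓝[>] 0) (𝓝 0) ∧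
      ∀ᵐ g ∂ν, (fun y => ρ (g, y)) =ᵐ[μ] whiteNoise μ K (b g) := by
  have hbd : ∀ (L : H →L[ℝ] H), MemLp (fun g => L (b g)) 2 ν := fun L =>
    MemLp.of_bound (by fun_prop) (‖L‖ * C) (Eventually.of_forall fun g =>
      (L.le_opNorm _).trans (mul_le_mul_of_nonneg_left (hC g) (norm_nonneg _)))
  have hΦ : ∀ ε, MemLp (fun q : G × H => ⟪regInvSqrt K ε (b q.1), q.2⟫) 2 (ν.prod μ) := by
    intro ε
    refine ⟨by fun_prop, ?_⟩
    rw [hμ.eLpNorm_inner_prod hK (F := fun g => regInvSqrt K ε (b g)) (by fun_prop)]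
    exact (hbd ((opSqrt K).comp (regInvSqrt K ε))).2
  set U : ℝ → Lp ℝ 2 (ν.prod μ) := fun ε => (hΦ ε).toLp with hU
  set V : ℝ → Lp H 2 ν := fun ε => (hbd ((opSqrt K).comp (regInvSqrt K ε))).toLp with hV
  have hVlim : Tendsto V (𝓝[>] 0) (𝓝 (hbd (ContinuousLinearMap.id ℝ H)).toLp) := by
    rw [hV, Lp.tendsto_Lp_iff_tendsto_eLpNorm'']
    exact tendsto_eLpNorm_regInvSqrt hK hinj hb hC
  -- The regularized pairings are at the same distances as the vectors `K^{1/2} (K + ε)⁻¹ K^{1/2}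
  -- b`, which converge in `L²(ν; H)`; hence the pairings are Cauchy.
  have hdist : ∀ ε ε', dist (U ε) (U ε') = dist (V ε) (V ε') := by
    intro ε ε'
    rw [dist_eq_norm, dist_eq_norm, ← toReal_enorm, ← toReal_enorm, hU, hV]
    simp only
    rw [← MemLp.toLp_sub, ← MemLp.toLp_sub, Lp.enorm_toLp, Lp.enorm_toLp]
    congr 1
    have h1 := hμ.eLpNorm_inner_prod hK (ν := ν)
      (F := fun g => regInvSqrt K ε (b g) - regInvSqrt K ε' (b g)) (by fun_prop)
    simp only [inner_sub_left, map_sub] at h1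
    exact h1
  have hc : Cauchy (map U (𝓝[>] 0)) := by
    have h1 := cauchy_map_iff.1 (hVlim.cauchy_map)
    refine cauchy_map_iff.2 ⟨h1.1, ?_⟩
    rw [Metric.uniformity_eq_comap_nhds_zero, tendsto_comap_iff] at h1 ⊢
    exact h1.2.congr fun q => (hdist _ _).symm
  obtain ⟨ρ, hρ⟩ := CompleteSpace.complete hc
  have hρ : Tendsto U (𝓝[>] 0) (𝓝 ρ) := hρ
  refine ⟨ρ, (Lp.stronglyMeasurable ρ).measurable, Lp.memLp ρ, ?_, ?_⟩
  · have h1 := (Lp.tendsto_Lp_iff_tendsto_eLpNorm' _ _).1 hρ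
    refine h1.congr fun ε => eLpNorm_congr_ae ?_
    filter_upwards [(hΦ ε).coeFn_toLp] with q hq
    rw [Pi.sub_apply, hU]
    simp only
    rw [hq]
  · obtain ⟨ns, hns, hae⟩ := (tendstoInMeasure_of_tendsto_Lp hρ).exists_seq_tendsto_ae'
    have h1 : ∀ᵐ q ∂(ν.prod μ), ∀ n, U (ns n) q = ⟪regInvSqrt K (ns n) (b q.1), q.2⟫ :=
      ae_all_iff.2 fun n => (hΦ (ns n)).coeFn_toLp
    have h2 : ∀ᵐ q ∂(ν.prod μ), Tendsto (fun n => ⟪regInvSqrt K (ns n) (b q.1), q.2⟫) atTop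
        (𝓝 (ρ q)) := by
      filter_upwards [hae, h1] with q h3 h4
      simpa only [h4] using h3
    filter_upwards [Measure.ae_ae_of_ae_prod h2] with g hg
    obtain ⟨hI, -⟩ := whiteNoise_spec hμ hK hinj
    -- For a frozen `g` the same regularized pairings converge to the white noise of `b g`, so along
    -- a further subsequence the two almost everywhere limits coincide.
    have h3 : Tendsto (fun n => whiteNoise μ K (opSqrt K (regInvSqrt K (ns n) (b g)))) atTop
        (𝓝 (whiteNoise μ K (b g))) :=
      ((whiteNoise μ K).continuous.tendsto _).comp
        ((tendsto_opSqrt_regInvSqrt hK hinj (b g)).comp hns)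
    obtain ⟨ms, hms, hae'⟩ := (tendstoInMeasure_of_tendsto_Lp h3).exists_seq_tendsto_ae'
    have h4 : ∀ᵐ y ∂μ, ∀ n, whiteNoise μ K (opSqrt K (regInvSqrt K (ns n) (b g))) y =
        ⟪regInvSqrt K (ns n) (b g), y⟫ := ae_all_iff.2 fun n => by
      rw [hI]; exact (hμ.memLp_inner hK _).coeFn_toLp
    filter_upwards [hg, hae', h4] with y h5 h6 h7
    simp only [h7] at h6
    exact tendsto_nhds_unique (h5.comp hms) h6

/-- Independence makes the law of `(Z, Y)` a product, so the limit built on the product space pulls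
back to `Ω`. It agrees almost surely with the variable chosen by `whitePairing`, because `L²` limits
are unique. -/
theorem whitePairing_eq {Ω : Type*} [MeasurableSpace Ω] {P : Measure Ω} [IsProbabilityMeasure P]
    {Z : Ω → G} {Y : Ω → H} (hZ : AEMeasurable Z P) (hY : AEMeasurable Y P)
    (hind : IndepFun Z Y P) (hμ : IsCenteredGaussian (P.map Y) K) (hK : K.IsPositive)
    (hinj : ∀ x, K x = 0 → x = 0) {b : G → H} (hb : Measurable b) {C : ℝ}
    (hC : ∀ g, ‖b g‖ ≤ C) [IsProbabilityMeasure (P.map Y)] :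
    ∃ ρ : G × H → ℝ, Measurable ρ ∧
      whitePairing P K (fun ω => b (Z ω)) Y =ᵐ[P] (fun ω => ρ (Z ω, Y ω)) ∧
      ∀ᵐ g ∂(P.map Z), (fun y => ρ (g, y)) =ᵐ[P.map Y] whiteNoise (P.map Y) K (b g) := by
  have : IsProbabilityMeasure (P.map Z) := Measure.isProbabilityMeasure_map hZ
  obtain ⟨ρ, hρm, hρL, hρlim, hρI⟩ :=
    exists_whitePairing_prod (ν := P.map Z) hμ hK hinj hb hC
  refine ⟨ρ, hρm, ?_, hρI⟩
  have hlaw : P.map (fun ω => (Z ω, Y ω)) = (P.map Z).prod (P.map Y) :=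
    (indepFun_iff_map_prod_eq_prod_map_map hZ hY).1 hind
  have hZY : AEMeasurable (fun ω => (Z ω, Y ω)) P := hZ.prodMk hY
  rw [← hlaw] at hρL hρlim
  have h1 : MemLp (fun ω => ρ (Z ω, Y ω)) 2 P :=
    (memLp_map_measure_iff (f := fun ω => (Z ω, Y ω)) hρm.aestronglyMeasurable hZY).1 hρL
  have h2 : Tendsto (fun ε : ℝ => eLpNorm (fun ω =>
      ⟪Ring.inverse (K + ε • ContinuousLinearMap.id ℝ H) (opSqrt K (b (Z ω))), Y ω⟫ -
        ρ (Z ω, Y ω)) 2 P) (𝓝[>] 0) (𝓝 0) := by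
    refine hρlim.congr fun ε => ?_
    rw [eLpNorm_map_measure (by fun_prop) hZY]
    rfl
  have hex : ∃ X : Ω → ℝ, MemLp X 2 P ∧ Tendsto (fun ε : ℝ => eLpNorm (fun ω =>
      ⟪Ring.inverse (K + ε • ContinuousLinearMap.id ℝ H) (opSqrt K (b (Z ω))), Y ω⟫ - X ω) 2 P)
      (𝓝[>] 0) (𝓝 0) := ⟨_, h1, h2⟩
  rw [whitePairing, dif_pos hex]
  obtain ⟨h3, h4⟩ := hex.choose_spec
  set X := hex.choose with hX
  have h5 : eLpNorm (fun ω => X ω - ρ (Z ω, Y ω)) 2 P = 0 := by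
    have h6 := h4.add h2
    rw [add_zero] at h6
    refine le_antisymm (ge_of_tendsto' h6 fun ε => ?_) zero_le
    have hm : AEStronglyMeasurable (fun ω =>
        ⟪Ring.inverse (K + ε • ContinuousLinearMap.id ℝ H) (opSqrt K (b (Z ω))), Y ω⟫) P := by
      refine AEStronglyMeasurable.inner (AEMeasurable.aestronglyMeasurable ?_)
        hY.aestronglyMeasurable
      exact (ContinuousLinearMap.measurable _).comp_aemeasurable
        ((ContinuousLinearMap.measurable _).comp_aemeasurable (hb.comp_aemeasurable hZ))
    have h7 := eLpNorm_sub_le (p := 2) (hm.sub h1.1) (hm.sub h3.1) (by norm_num)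
    rw [add_comm]
    refine le_trans (le_of_eq ?_) h7
    congr 1
    funext ω
    simp only [Pi.sub_apply]
    ring
  replace h5 := (eLpNorm_eq_zero_iff (h3.1.sub h1.1) (by norm_num)).1 h5
  filter_upwards [h5] with ω h8
  exact sub_eq_zero.1 h8

end WhitePairing

/-! ### Measurable dependence of the laws on time -/

section MeasurableFamilies

theorem continuous_integral_of_continuous_charFun {E : Type*} [NormedAddCommGroup E]
    [InnerProductSpace ℝ E] [FiniteDimensional ℝ E] [MeasurableSpace E] [BorelSpace E]
    {N : ℝ → Measure E} [∀ t, IsProbabilityMeasure (N t)]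
    (hN : ∀ v, Continuous fun t => charFun (N t) v) (g : BoundedContinuousFunction E ℝ) :
    Continuous fun t => ∫ x, g x ∂(N t) := by
  refine continuous_iff_continuousAt.2 fun t => tendsto_of_seq_tendsto fun u hu => ?_
  have h := ProbabilityMeasure.tendsto_of_tendsto_charFun
    (μ := fun n => ⟨N (u n), inferInstance⟩) (μ₀ := ⟨N t, inferInstance⟩)
    (fun v => ((hN v).tendsto t).comp hu)
  exact (ProbabilityMeasure.tendsto_iff_forall_integral_tendsto.1 h) g

variable [CompleteSpace H] [TopologicalSpace.SeparableSpace H] [MeasurableSpace H] [BorelSpace H]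

/-- In infinite dimension, convergence of characteristic functions does not by itself give weak
convergence. Lévy's theorem does apply to finite-dimensional projections; the integrals of `g`
composed with these are continuous in `t` and converge to the integral of `g`, which leaves
measurability. -/
theorem measurable_integral_of_continuous_charFun {N : ℝ → Measure H}
    [∀ t, IsProbabilityMeasure (N t)]
    (hN : ∀ h : H, Continuous fun t => ∫ z, Complex.exp (⟪h, z⟫ * Complex.I) ∂(N t))
    {g : H → ℝ} (hg : Continuous g) {C : ℝ} (hC : ∀ x, |g x| ≤ C) :
    Measurable fun t => ∫ x, g x ∂(N t) := by
  obtain ⟨w, b, -⟩ := exists_hilbertBasis ℝ H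
  have hw : Countable w := countable_of_orthonormal b.orthonormal
  let π : ∀ F : Finset w, H →L[ℝ] EuclideanSpace ℝ F := fun F =>
    (EuclideanSpace.equiv F ℝ).symm.toContinuousLinearMap.comp
      (ContinuousLinearMap.pi fun k : F => innerSL ℝ (b k))
  let j : ∀ F : Finset w, EuclideanSpace ℝ F → H := fun F v => ∑ k : F, v k • b k
  have hj : ∀ F, Continuous (j F) := fun F => by
    refine continuous_finsetSum _ fun k _ => Continuous.smul ?_ continuous_const
    exact (EuclideanSpace.proj k : EuclideanSpace ℝ F →L[ℝ] ℝ).continuous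
  have hinner : ∀ F x v, ⟪π F x, v⟫ = ⟪j F v, x⟫ := fun F x v => by
    simp only [j, sum_inner, real_inner_smul_left, PiLp.inner_apply]
    refine Finset.sum_congr rfl fun k _ => ?_
    rw [real_inner_eq_re_inner]
    simp [π]
  have hcont : ∀ F : Finset w, Continuous fun t => ∫ x, g (j F (π F x)) ∂(N t) := by
    intro F
    have hp : ∀ t, IsProbabilityMeasure ((N t).map (π F)) := fun t =>
      Measure.isProbabilityMeasure_map (by fun_prop)
    have hcf : ∀ v, Continuous fun t => charFun ((N t).map (π F)) v := fun v => by
      refine (hN (j F v)).congr fun t => ?_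
      rw [charFun_apply, integral_map (by fun_prop)
        (by apply Continuous.aestronglyMeasurable; fun_prop)]
      simp only [hinner]
    have h := continuous_integral_of_continuous_charFun hcf
      (BoundedContinuousFunction.ofNormedAddCommGroup (fun v => g (j F v)) (hg.comp (hj F)) C
        (fun v => hC _))
    refine h.congr fun t => ?_
    rw [integral_map (by fun_prop) (BoundedContinuousFunction.continuous _).aestronglyMeasurable]
    rfl
  refine measurable_of_tendsto_metrizable' (atTop : Filter (Finset w))
    (fun F => (hcont F).measurable) ?_
  refine tendsto_pi_nhds.2 fun t => ?_
  refine tendsto_integral_filter_of_dominated_convergence (fun _ => C)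
    (Eventually.of_forall fun F => (hg.comp ((hj F).comp (π F).continuous)).aestronglyMeasurable)
    (Eventually.of_forall fun F => Eventually.of_forall fun x => hC _) (integrable_const _)
    (Eventually.of_forall fun x => (hg.tendsto x).comp ?_)
  have h1 := b.hasSum_repr x
  simp only [b.repr_apply_apply] at h1
  refine Tendsto.congr (fun F => ?_) h1
  rw [← Finset.sum_coe_sort]
  rfl

/-- Closed sets form a generating π-system, and their indicators are limits of bounded continuous
functions. -/
theorem measurable_of_continuous_charFun {N : ℝ → Measure H} [∀ t, IsProbabilityMeasure (N t)]
    (hN : ∀ h : H, Continuous fun t => ∫ z, Complex.exp (⟪h, z⟫ * Complex.I) ∂(N t)) :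
    Measurable N := by
  refine Measurable.measure_of_isPiSystem_of_isProbabilityMeasure
    (S := {s | IsClosed s}) ?_ isPiSystem_isClosed fun s hs => ?_
  · rw [BorelSpace.measurable_eq (α := H), borel_eq_generateFrom_isClosed]
  · have hs : IsClosed s := hs
    have h1 : ∀ n, Measurable fun t => ∫⁻ x, hs.apprSeq n x ∂(N t) := by
      intro n
      have h2 : ∀ t, ∫⁻ x, hs.apprSeq n x ∂(N t) =
          ENNReal.ofReal (∫ x, (hs.apprSeq n x : ℝ) ∂(N t)) := fun t =>
        lintegral_coe_eq_integral _ ((hs.apprSeq n).integrable_of_nnreal _)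
      simp only [h2]
      refine (measurable_integral_of_continuous_charFun hN (C := 1) (by fun_prop)
        (fun x => ?_)).ennreal_ofReal
      rw [abs_of_nonneg (by positivity)]
      exact_mod_cast HasOuterApproxClosed.apprSeq_apply_le_one hs n x
    exact measurable_of_tendsto_metrizable h1 (tendsto_pi_nhds.2 fun t =>
      HasOuterApproxClosed.tendsto_lintegral_apprSeq hs (N t))

end MeasurableFamilies

/-! ### Measurability of `t ↦ ‖Λ(t)‖` -/

section MeasurableNorm

variable [CompleteSpace H] [TopologicalSpace.SeparableSpace H]

/-- `‖L x‖²` is the supremum over `g` of `2 ⟨L x, K^{1/2} g⟩ - ‖K^{1/2} g‖² = 2 ⟨T x, g⟩ - ⟨K g,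
g⟩`, an expression free of `L`. The strict inequalities are open conditions, so `x` and `g` may be
taken from a dense sequence. -/
theorem lt_norm_iff_of_sqrt_comp {K L T : H →L[ℝ] H} (hK : K.IsPositive)
    (hinj : ∀ x, K x = 0 → x = 0) (hL : (opSqrt K).comp L = T) {c : ℝ} (hc : 0 ≤ c) :
    c < ‖L‖ ↔ ∃ n m : ℕ, (c * ‖TopologicalSpace.denseSeq H n‖) ^ 2 <
      2 * ⟪T (TopologicalSpace.denseSeq H n), TopologicalSpace.denseSeq H m⟫ -
        ⟪K (TopologicalSpace.denseSeq H m), TopologicalSpace.denseSeq H m⟫ := by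
  have hTS : ∀ x g, ⟪T x, g⟫ = ⟪L x, opSqrt K g⟫ := fun x g => by
    rw [← hL, ContinuousLinearMap.comp_apply, inner_opSqrt hK]
  have hd := TopologicalSpace.denseRange_denseSeq H
  constructor
  · intro h
    obtain ⟨x, hx⟩ : ∃ x, c * ‖x‖ < ‖L x‖ := by
      by_contra! hcon
      exact absurd (L.opNorm_le_bound hc hcon) (not_le.2 h)
    have ho : IsOpen {x : H | c * ‖x‖ < ‖L x‖} := isOpen_lt (by fun_prop) (by fun_prop)
    obtain ⟨n, hy⟩ := hd.exists_mem_open ho ⟨x, hx⟩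
    clear hx
    generalize hxn : TopologicalSpace.denseSeq H n = y at hy
    clear x
    obtain ⟨x, rfl⟩ : ∃ x, x = y := ⟨y, rfl⟩
    have hy : c * ‖x‖ < ‖L x‖ := hy
    have hy2 : (c * ‖x‖) ^ 2 < ‖L x‖ ^ 2 := pow_lt_pow_left₀ hy (by positivity) (by norm_num)
    have ho2 : IsOpen {v : H | (c * ‖x‖) ^ 2 < 2 * ⟪L x, v⟫ - ‖v‖ ^ 2} :=
      isOpen_lt (by fun_prop) (by fun_prop)
    obtain ⟨g, hg⟩ := (denseRange_opSqrt hK hinj).exists_mem_open ho2 ⟨L x, by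
      simp only [Set.mem_ofPred_eq, real_inner_self_eq_norm_sq]; linarith⟩
    have ho3 : IsOpen {g : H | (c * ‖x‖) ^ 2 < 2 * ⟪T x, g⟫ - ⟪K g, g⟫} :=
      isOpen_lt (by fun_prop) (by fun_prop)
    obtain ⟨m, hm⟩ := hd.exists_mem_open ho3 ⟨g, by
      simp only [Set.mem_ofPred_eq] at hg ⊢
      rwa [hTS, ← norm_opSqrt_sq hK]⟩
    exact ⟨n, m, by rw [hxn]; exact hm⟩
  · rintro ⟨n, m, h⟩
    set x := TopologicalSpace.denseSeq H n
    set g := TopologicalSpace.denseSeq H m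
    rw [hTS, ← norm_opSqrt_sq hK] at h
    have h1 := norm_sub_sq_real (L x) (opSqrt K g)
    have h2 : (c * ‖x‖) ^ 2 < ‖L x‖ ^ 2 := by nlinarith [sq_nonneg ‖L x - opSqrt K g‖]
    have h3 : c * ‖x‖ < ‖L x‖ := lt_of_pow_lt_pow_left₀ 2 (norm_nonneg _) h2
    exact lt_of_mul_lt_mul_right (h3.trans_le (L.le_opNorm x)) (norm_nonneg _)

theorem C0Semigroup.continuous_max (T : C0Semigroup H) (x : H) :
    Continuous fun t => T (max t 0) x :=
  (T.strong_cont x).comp_continuous (by fun_prop) (fun t => Set.mem_Ici.2 (le_max_right _ _))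

theorem measurable_norm_lam (T : C0Semigroup H) {Q : H →L[ℝ] H} (hQ : Q.IsPositive)
    (hQker : ∀ x, Q x = 0 → x = 0)
    (hlam : ∀ t, 0 < t → (opSqrt (covOp T Q t)).comp (lam T Q t) = T t) :
    Measurable ((Set.Ioi 0).indicator fun t => ‖lam T Q t‖) := by
  refine measurable_of_Ioi fun c => ?_
  by_cases hc : 0 ≤ c
  · have h1 : ((Set.Ioi 0).indicator fun t => ‖lam T Q t‖) ⁻¹' Set.Ioi c = Set.Ioi (0 : ℝ) ∩
        ⋃ (n : ℕ) (m : ℕ), {t : ℝ | (c * ‖TopologicalSpace.denseSeq H n‖) ^ 2 <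
          2 * ⟪T (max t 0) (TopologicalSpace.denseSeq H n), TopologicalSpace.denseSeq H m⟫ -
          ⟪covOp T Q (max t 0) (TopologicalSpace.denseSeq H m),
            TopologicalSpace.denseSeq H m⟫} := by
      ext t
      by_cases ht : 0 < t
      · rw [Set.mem_preimage, Set.indicator_of_mem (Set.mem_Ioi.2 ht), Set.mem_Ioi,
          lt_norm_iff_of_sqrt_comp (covOp_isPositive T hQ t) (covOp_injective T hQ hQker ht)
            (hlam t ht) hc]
        simp [ht, max_eq_left ht.le]
      · rw [Set.mem_preimage, Set.indicator_of_notMem (by simpa using ht)]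
        simp [ht, hc]
    rw [h1]
    refine measurableSet_Ioi.inter (MeasurableSet.iUnion fun n => MeasurableSet.iUnion fun m => ?_)
    refine measurableSet_lt measurable_const (Measurable.sub ?_ ?_)
    · exact (((T.continuous_max _).inner continuous_const).const_mul 2).measurable
    · exact ((continuousOn_inner_covOp T hQ _).comp_continuous (by fun_prop)
        (fun t => Set.mem_Ici.2 (le_max_right t 0))).measurable
  · have h1 : ((Set.Ioi 0).indicator fun t => ‖lam T Q t‖) ⁻¹' Set.Ioi c = Set.univ := by
      refine Set.eq_univ_of_forall fun t => lt_of_lt_of_le (not_le.1 hc) ?_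
      exact Set.indicator_nonneg (fun t _ => norm_nonneg _) t
    rw [h1]
    exact MeasurableSet.univ

end MeasurableNorm

/-! ### Transition operators, their derivatives and joint measurability -/

section TransitionOperators

variable [MeasurableSpace H]

/-- The transition operators `f ↦ E f(T_τ · + Y_τ)`, `Y_τ ∼ N_τ` (with `T_τ = T_0` for `τ < 0`). -/
def transOp (T : C0Semigroup H) (N : ℝ → Measure H) (τ : ℝ) (f : H → ℝ) (x : H) : ℝ :=
  ∫ z, f (T (max τ 0) x + z) ∂(N τ)

open scoped Classical in
/-- The directional derivative `⟨B, D(S_τ f)⟩` of the transition operators for `τ > 0`. -/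
def derivOp (T : C0Semigroup H) (N : ℝ → Measure H) (B : H → H) (τ : ℝ) (f : H → ℝ) (y : H) : ℝ :=
  if 0 < τ then fderiv ℝ (transOp T N τ f) y (B y) else 0

variable [CompleteSpace H] [TopologicalSpace.SeparableSpace H]

/-- `N_τ` is a measurable family of probability measures, `N_τ` being centered Gaussian with
covariance `Q_τ` for `τ > 0`, and the operators `Λ_τ` exist and satisfy `‖Λ_τ‖ ≤ C / τ^δ`. -/
structure IsOUFamily (T : C0Semigroup H) (Q : H →L[ℝ] H) (N : ℝ → Measure H) (δ C : ℝ) :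
    Prop where
  prob : ∀ t, IsProbabilityMeasure (N t)
  measurable : Measurable N
  gaussian : ∀ t, 0 < t → IsCenteredGaussian (N t) (covOp T Q t)
  pos : ∀ t, 0 < t → (covOp T Q t).IsPositive
  inj : ∀ t, 0 < t → ∀ x, covOp T Q t x = 0 → x = 0
  lam_spec : ∀ t, 0 < t → (opSqrt (covOp T Q t)).comp (lam T Q t) = T t
  lam_le : ∀ t, 0 < t → ‖lam T Q t‖ ≤ C / t ^ δ
  lam_meas : Measurable ((Set.Ioi 0).indicator fun t => ‖lam T Q t‖)
  delta : 0 < δ ∧ δ < 1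
  const_pos : 0 < C

variable [BorelSpace H] {T : C0Semigroup H} {Q : H →L[ℝ] H} {N : ℝ → Measure H} {δ C : ℝ}

theorem C0Semigroup.measurable_uncurry (T : C0Semigroup H) :
    Measurable fun p : ℝ × H => T (max p.1 0) p.2 := by
  have h := measurable_uncurry_of_continuous_of_measurable (u := fun (x : H) (t : ℝ) => T (max t 0) x)
    (fun t => (T (max t 0)).continuous) (fun x => (T.continuous_max x).measurable)
  exact h.comp measurable_swap

theorem IsOUFamily.measurable_transOp (hN : IsOUFamily T Q N δ C) {A : Type*} [MeasurableSpace A]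
    {F : A → H → ℝ} (hF : Measurable (Function.uncurry F)) :
    Measurable fun p : ℝ × A × H => transOp T N p.1 (F p.2.1) p.2.2 := by
  have := hN.prob
  let κ : Kernel ℝ H := ⟨N, hN.measurable⟩
  have hκ : IsMarkovKernel κ := ⟨hN.prob⟩
  let κ' : Kernel (ℝ × A × H) H := κ.comap Prod.fst measurable_fst
  have h := StronglyMeasurable.integral_kernel_prod_right (κ := κ')
    (f := fun (p : ℝ × A × H) (z : H) => F p.2.1 (T (max p.1 0) p.2.2 + z)) (by
      refine Measurable.stronglyMeasurable ?_
      have hm : Measurable fun p : (ℝ × A × H) × H => (p.1.1, p.1.2.2) := by fun_prop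
      have hm2 : Measurable fun p : (ℝ × A × H) × H => p.1.2.1 := by fun_prop
      exact hF.comp (hm2.prodMk ((T.measurable_uncurry.comp hm).add measurable_snd)))
  exact h.measurable

theorem IsOUFamily.abs_transOp_le (hN : IsOUFamily T Q N δ C) {f : H → ℝ} {M : ℝ}
    (hM : ∀ x, |f x| ≤ M) (τ : ℝ) (x : H) : |transOp T N τ f x| ≤ M := by
  have := hN.prob τ
  rw [transOp, ← Real.norm_eq_abs]
  refine (norm_integral_le_of_norm_le_const (C := M) (Eventually.of_forall fun z => ?_)).trans ?_
  · exact hM _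
  · simp

theorem IsOUFamily.hasFDerivAt_transOp (hN : IsOUFamily T Q N δ C) {f : H → ℝ} {M : ℝ}
    (hf : Measurable f) (hM : ∀ x, |f x| ≤ M) {τ : ℝ} (hτ : 0 < τ) (x : H) :
    ∃ D : H →L[ℝ] ℝ, HasFDerivAt (transOp T N τ f) D x ∧
      (∀ h, |D h| ≤ M * ‖lam T Q τ h‖) ∧
      ∃ I : H → Lp ℝ 2 (N τ), (∀ h, ‖I h‖ ≤ ‖lam T Q τ h‖) ∧
        (∀ h, have := hN.prob τ; I h = whiteNoise (N τ) (covOp T Q τ) (lam T Q τ h)) ∧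
        ∀ h, D h = ∫ z, f (T τ x + z) * I h z ∂(N τ) := by
  have := hN.prob τ
  have hG := hN.gaussian τ hτ
  refine ⟨_, ?_, abs_gaussianFDeriv_le hG (hN.pos τ hτ) (hN.inj τ hτ) hf hM (lam T Q τ) (T τ x),
    fun h => whiteNoise (N τ) (covOp T Q τ) (lam T Q τ h),
    fun h => (whiteNoise_spec hG (hN.pos τ hτ) (hN.inj τ hτ)).2 _, fun h => rfl, fun h => ?_⟩
  · have h := hasFDerivAt_gaussian_smoothing hG (hN.pos τ hτ) (hN.inj τ hτ) hf hM
      (hN.lam_spec τ hτ) x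
    refine h.congr_of_eventuallyEq (Eventually.of_forall fun y => ?_)
    rw [transOp, max_eq_left hτ.le]
  · rw [gaussianFDeriv_apply, L2.inner_def]
    refine integral_congr_ae ?_
    filter_upwards [(memLp_of_measurable_bounded (μ := N τ) hf hM (T τ x)).coeFn_toLp] with z hz
    rw [hz, real_inner_eq_re_inner]
    simp [mul_comm]

theorem IsOUFamily.norm_fderiv_transOp_le (hN : IsOUFamily T Q N δ C) {f : H → ℝ} {M : ℝ}
    (hf : Measurable f) (hM : ∀ x, |f x| ≤ M) {τ : ℝ} (hτ : 0 < τ) (x : H) :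
    ‖fderiv ℝ (transOp T N τ f) x‖ ≤ M * ‖lam T Q τ‖ := by
  obtain ⟨D, hD, hb, -⟩ := hN.hasFDerivAt_transOp hf hM hτ x
  have hM0 : 0 ≤ M := (abs_nonneg _).trans (hM 0)
  rw [hD.fderiv]
  refine ContinuousLinearMap.opNorm_le_bound _ (by positivity) fun h => (hb h).trans ?_
  rw [mul_assoc]
  exact mul_le_mul_of_nonneg_left ((lam T Q τ).le_opNorm h) hM0

variable {B : H → H} {b : ℝ}

theorem IsOUFamily.abs_derivOp_le (hN : IsOUFamily T Q N δ C) (hb : ∀ y, ‖B y‖ ≤ b) {f : H → ℝ}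
    {M : ℝ} (hf : Measurable f) (hM : ∀ x, |f x| ≤ M) {τ : ℝ} (hτ : 0 < τ) (x : H) :
    |derivOp T N B τ f x| ≤ M * ‖lam T Q τ‖ * b := by
  have hM0 : 0 ≤ M := (abs_nonneg _).trans (hM 0)
  rw [derivOp, if_pos hτ]
  refine ((fderiv ℝ (transOp T N τ f) x).le_opNorm (B x)).trans ?_
  have := hN.norm_fderiv_transOp_le hf hM hτ x
  have := hb x
  gcongr

/-- For `τ > 0` the directional derivative is the limit of difference quotients with step `1 / (m +
1)`, and each quotient is jointly measurable. -/
theorem IsOUFamily.measurable_derivOp (hN : IsOUFamily T Q N δ C) (hB : Measurable B)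
    {A : Type*} [MeasurableSpace A] {F : A → H → ℝ} (hF : Measurable (Function.uncurry F))
    (hFb : ∀ a, ∃ M, ∀ x, |F a x| ≤ M) :
    Measurable fun p : ℝ × A × H => derivOp T N B p.1 (F p.2.1) p.2.2 := by
  have hS := hN.measurable_transOp hF
  refine measurable_of_tendsto_metrizable (f := fun (m : ℕ) (p : ℝ × A × H) =>
    {p : ℝ × A × H | 0 < p.1}.indicator (fun p => ((m : ℝ) + 1) *
      (transOp T N p.1 (F p.2.1) (p.2.2 + ((m : ℝ) + 1)⁻¹ • B p.2.2) -
        transOp T N p.1 (F p.2.1) p.2.2)) p) (fun m => ?_) (tendsto_pi_nhds.2 fun p => ?_)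
  · refine Measurable.indicator ?_ (measurableSet_lt measurable_const measurable_fst)
    refine Measurable.const_mul (Measurable.sub ?_ hS) _
    have hm : Measurable fun p : ℝ × A × H =>
        (p.1, p.2.1, p.2.2 + ((m : ℝ) + 1)⁻¹ • B p.2.2) := by fun_prop
    exact hS.comp hm
  · by_cases hp : 0 < p.1
    · simp only [derivOp, if_pos hp]
      obtain ⟨M, hM⟩ := hFb p.2.1
      obtain ⟨D, hD, -⟩ := hN.hasFDerivAt_transOp (hF.comp measurable_prodMk_left) hM hp p.2.2
      have hD : HasFDerivAt (transOp T N p.1 (F p.2.1)) D p.2.2 := hD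
      rw [hD.fderiv]
      have hc : Tendsto (fun m : ℕ => ‖(m : ℝ) + 1‖) atTop atTop := by
        refine tendsto_norm_atTop_atTop.comp ?_
        exact tendsto_atTop_add_const_right _ _ tendsto_natCast_atTop_atTop
      have h1 := hD.lim (B p.2.2) hc
      refine h1.congr fun m => ?_
      rw [Set.indicator_of_mem (show p ∈ {p : ℝ × A × H | 0 < p.1} from hp)]
      rfl
    · simp only [derivOp, if_neg hp]
      refine tendsto_const_nhds.congr fun m => ?_
      rw [Set.indicator_of_notMem (show p ∉ {p : ℝ × A × H | 0 < p.1} from hp)]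

theorem IsOUFamily.derivOp_eq_integral (hN : IsOUFamily T Q N δ C) {τ : ℝ} (hτ : 0 < τ)
    [IsProbabilityMeasure (N τ)] {f : H → ℝ} {M : ℝ} (hf : Measurable f) (hM : ∀ y, |f y| ≤ M)
    (x : H) : derivOp T N B τ f x =
      ∫ z, f (T τ x + z) * whiteNoise (N τ) (covOp T Q τ) (lam T Q τ (B x)) z ∂(N τ) := by
  obtain ⟨D, hD, -, I, -, hI, hDI⟩ := hN.hasFDerivAt_transOp hf hM hτ x
  rw [derivOp, if_pos hτ, hD.fderiv, hDI, hI]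

section Exchange

variable {A : Type*} [MeasurableSpace A] {lm : Measure A} [SFinite lm] {F : A → H → ℝ} {β : A → ℝ}

theorem measurable_integral_param (hF : Measurable (Function.uncurry F)) :
    Measurable fun y => ∫ a, F a y ∂lm := by
  have h : StronglyMeasurable (Function.uncurry fun (y : H) (a : A) => F a y) :=
    (hF.comp measurable_swap).stronglyMeasurable
  exact h.integral_prod_right.measurable

/-- Fubini on the product, with dominating function `w(z) β(a)`. -/
theorem integral_weight_exchange {μ : Measure H} [IsProbabilityMeasure μ]
    (hF : Measurable (Function.uncurry F)) (hβ : Integrable β lm)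
    (hFβ : ∀ᵐ a ∂lm, ∀ y, |F a y| ≤ β a) {w : H → ℝ} (hw : Integrable w μ) (x : H) :
    ∫ z, (∫ a, F a (x + z) ∂lm) * w z ∂μ = ∫ a, ∫ z, F a (x + z) * w z ∂μ ∂lm := by
  simp only [← integral_mul_const]
  rw [integral_integral_swap]
  have h1 : Integrable (fun p : H × A => w p.1 * β p.2) (μ.prod lm) := hw.mul_prod hβ
  refine h1.mono ?_ ?_
  · refine AEStronglyMeasurable.mul ?_ hw.1.comp_fst
    exact (hF.comp (by fun_prop : Measurable fun p : H × A => (p.2, x + p.1))).aestronglyMeasurable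
  · have h2 : ∀ᵐ p ∂(μ.prod lm), ∀ y, |F p.2 y| ≤ β p.2 :=
      (Measure.quasiMeasurePreserving_snd (μ := μ) (ν := lm)).ae hFβ
    filter_upwards [h2] with p hp
    simp only [Function.uncurry, norm_mul]
    rw [mul_comm]
    refine mul_le_mul_of_nonneg_left ?_ (norm_nonneg _)
    exact (hp _).trans (le_abs_self _)

theorem IsOUFamily.transOp_integral (hN : IsOUFamily T Q N δ C)
    (hF : Measurable (Function.uncurry F)) (hβ : Integrable β lm)
    (hFβ : ∀ᵐ a ∂lm, ∀ y, |F a y| ≤ β a) (τ : ℝ) (x : H) :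
    transOp T N τ (fun y => ∫ a, F a y ∂lm) x = ∫ a, transOp T N τ (F a) x ∂lm := by
  have := hN.prob τ
  have h := integral_weight_exchange (μ := N τ) hF hβ hFβ (integrable_const (1 : ℝ))
    (T (max τ 0) x)
  simp only [mul_one] at h
  exact h

end Exchange

end TransitionOperators

/-! ### Ordered times, their gaps, and Fubini on the simplex -/

section Gaps

/-- The increments `sᵢ - sᵢ₋₁`, with `s₀ = 0`. -/
def gaps {n : ℕ} (s : Fin n → ℝ) (i : Fin n) : ℝ := s i - prevTime s i

/-- The last of the times `s₀ = 0, s₁, …, sₙ`. -/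
def lastTime {n : ℕ} (s : Fin n → ℝ) : ℝ := Fin.cons (α := fun _ => ℝ) 0 s (Fin.last n)

/-- Appending a final time leaves the earlier gaps unchanged. All inductions on the simplex
therefore remove the largest time, in step with the recursions for `orderedIntegral` and
`derivChain`. -/
theorem gaps_snoc {n : ℕ} (s : Fin n → ℝ) (r : ℝ) :
    gaps (Fin.snoc (α := fun _ => ℝ) s r) =
      Fin.snoc (α := fun _ => ℝ) (gaps s) (r - lastTime s) := by
  funext i
  refine Fin.lastCases ?_ (fun j => ?_) i
  · simp only [gaps, prevTime, lastTime, Fin.snoc_last, Fin.cons_snoc_eq_snoc_cons,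
      Fin.snoc_castSucc]
  · simp only [gaps, prevTime, Fin.cons_snoc_eq_snoc_cons, Fin.snoc_castSucc]

@[simp]
theorem lastTime_snoc {n : ℕ} (s : Fin n → ℝ) (r : ℝ) :
    lastTime (Fin.snoc (α := fun _ => ℝ) s r) = r := by
  simp only [lastTime, Fin.cons_snoc_eq_snoc_cons, Fin.snoc_last]

theorem measurable_lastTime {n : ℕ} : Measurable (lastTime (n := n)) := by
  cases n with
  | zero => exact measurable_const
  | succ n =>
    have h : (lastTime (n := n + 1)) = fun s => s (Fin.last n) := by
      funext s
      rw [lastTime, ← Fin.succ_last, Fin.cons_succ]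
    rw [h]
    fun_prop

theorem measurable_gaps {n : ℕ} : Measurable (gaps (n := n)) := by
  refine measurable_pi_lambda _ fun i => ?_
  refine (measurable_pi_apply i).sub ?_
  unfold prevTime
  rcases Fin.eq_zero_or_eq_succ i.castSucc with h | ⟨j, h⟩
  · rw [h]
    exact measurable_const
  · rw [h]
    exact measurable_pi_apply j

theorem measurable_snoc {n : ℕ} :
    Measurable fun p : ℝ × (Fin n → ℝ) => Fin.snoc (α := fun _ => ℝ) p.2 p.1 := by
  refine measurable_pi_lambda _ fun i => ?_
  refine Fin.lastCases ?_ (fun j => ?_) i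
  · simp only [Fin.snoc_last]
    fun_prop
  · simp only [Fin.snoc_castSucc]
    fun_prop

theorem lastTime_mem {n : ℕ} {s : Fin n → ℝ} {t : ℝ} (ht : 0 < t) (hs : s ∈ timeSimplex n t) :
    0 ≤ lastTime s ∧ lastTime s < t := by
  cases n with
  | zero => exact ⟨le_rfl, ht⟩
  | succ n =>
    rw [lastTime, ← Fin.succ_last, Fin.cons_succ]
    exact ⟨(hs.2 _).1.le, (hs.2 _).2⟩

theorem snoc_mem_timeSimplex {n : ℕ} {s : Fin n → ℝ} {r t : ℝ} :
    Fin.snoc (α := fun _ => ℝ) s r ∈ timeSimplex (n + 1) t ↔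
      r ∈ Set.Ioo 0 t ∧ s ∈ timeSimplex n r := by
  constructor
  · rintro ⟨hm, h⟩
    have hl := h (Fin.last n)
    simp only [Fin.snoc_last] at hl
    refine ⟨hl, fun i j hij => ?_, fun i => ⟨?_, ?_⟩⟩
    · have := hm (Fin.castSucc_lt_castSucc_iff.2 hij)
      simpa only [Fin.snoc_castSucc] using this
    · have := (h i.castSucc).1
      simpa only [Fin.snoc_castSucc] using this
    · have := hm (Fin.castSucc_lt_last i)
      simpa only [Fin.snoc_castSucc, Fin.snoc_last] using this
  · rintro ⟨hr, hm, h⟩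
    refine ⟨fun i j => ?_, fun i => ?_⟩
    · refine Fin.lastCases (fun hij => ?_) (fun i => ?_) i
      · exact absurd (Fin.le_last j) (not_le.2 hij)
      · refine Fin.lastCases (fun _ => ?_) (fun j hij => ?_) j
        · simpa only [Fin.snoc_castSucc, Fin.snoc_last] using (h i).2
        · simpa only [Fin.snoc_castSucc] using hm (Fin.castSucc_lt_castSucc_iff.1 hij)
    · refine Fin.lastCases ?_ (fun i => ?_) i
      · simpa only [Fin.snoc_last] using Set.mem_Ioo.1 hr
      · simpa only [Fin.snoc_castSucc] using ⟨(h i).1, (h i).2.trans hr.2⟩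

theorem gaps_pos {n : ℕ} {s : Fin n → ℝ} {t : ℝ} (hs : s ∈ timeSimplex n t) (i : Fin n) :
    0 < gaps s i := by
  induction n generalizing t with
  | zero => exact i.elim0
  | succ n ih =>
    obtain ⟨s, r, rfl⟩ : ∃ s' r, s = Fin.snoc (α := fun _ => ℝ) s' r :=
      ⟨fun i => s i.castSucc, s (Fin.last n), (Fin.snoc_init_self s).symm⟩
    obtain ⟨hr, hs⟩ := snoc_mem_timeSimplex.1 hs
    rw [gaps_snoc]
    refine Fin.lastCases ?_ (fun i => ?_) i
    · simpa only [Fin.snoc_last, sub_pos] using (lastTime_mem hr.1 hs).2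
    · simpa only [Fin.snoc_castSucc] using ih hs i

theorem measurableSet_timeSimplex (n : ℕ) (t : ℝ) : MeasurableSet (timeSimplex n t) := by
  have h : timeSimplex n t = (⋂ (i : Fin n) (j : Fin n) (_ : i < j), {s | s i < s j}) ∩
      ⋂ i : Fin n, {s : Fin n → ℝ | 0 < s i ∧ s i < t} := by
    ext s
    simp [timeSimplex, StrictMono]
  rw [h]
  refine MeasurableSet.inter ?_ ?_
  · exact MeasurableSet.iInter fun i => MeasurableSet.iInter fun j => MeasurableSet.iInter fun _ =>
      measurableSet_lt (measurable_pi_apply i) (measurable_pi_apply j)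
  · exact MeasurableSet.iInter fun i => (measurableSet_lt measurable_const (measurable_pi_apply i)).inter
      (measurableSet_lt (measurable_pi_apply i) measurable_const)

/-- The simplex `{0 < s₁ < ⋯ < sₙ₊₁ < t}` as a set of pairs `(sₙ₊₁, (s₁, …, sₙ))`. -/
def prodSimplex (n : ℕ) (t : ℝ) : Set (ℝ × (Fin n → ℝ)) :=
  {p | p.1 ∈ Set.Ioo 0 t ∧ p.2 ∈ timeSimplex n p.1}

theorem measurePreserving_snoc (n : ℕ) :
    MeasurePreserving ((MeasurableEquiv.piFinSuccAbove (fun _ : Fin (n + 1) => ℝ)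
      (Fin.last n)).symm) (volume.prod volume) volume :=
  (volume_preserving_piFinSuccAbove (fun _ : Fin (n + 1) => ℝ) (Fin.last n)).symm

theorem piFinSuccAbove_symm_eq_snoc {n : ℕ} (p : ℝ × (Fin n → ℝ)) :
    (MeasurableEquiv.piFinSuccAbove (fun _ : Fin (n + 1) => ℝ) (Fin.last n)).symm p =
      Fin.snoc (α := fun _ => ℝ) p.2 p.1 :=
  Fin.insertNth_last (α := fun _ => ℝ) p.1 p.2

theorem preimage_timeSimplex (n : ℕ) (t : ℝ) :
    (MeasurableEquiv.piFinSuccAbove (fun _ : Fin (n + 1) => ℝ) (Fin.last n)).symm ⁻¹'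
      timeSimplex (n + 1) t = prodSimplex n t := by
  ext p
  rw [Set.mem_preimage, piFinSuccAbove_symm_eq_snoc, snoc_mem_timeSimplex]
  rfl

theorem measurableSet_prodSimplex (n : ℕ) (t : ℝ) : MeasurableSet (prodSimplex n t) := by
  rw [← preimage_timeSimplex]
  exact (MeasurableEquiv.measurable _) (measurableSet_timeSimplex _ _)

theorem indicator_prodSimplex {n : ℕ} {t : ℝ} {E : Type*} [Zero E] (F : (Fin (n + 1) → ℝ) → E)
    (r : ℝ) (s : Fin n → ℝ) :
    (prodSimplex n t).indicator (fun p => F (Fin.snoc (α := fun _ => ℝ) p.2 p.1)) (r, s) =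
      (Set.Ioo 0 t).indicator (fun r => (timeSimplex n r).indicator
        (fun s => F (Fin.snoc (α := fun _ => ℝ) s r)) s) r := by
  by_cases hr : r ∈ Set.Ioo 0 t
  · rw [Set.indicator_of_mem hr]
    by_cases hs : s ∈ timeSimplex n r
    · rw [Set.indicator_of_mem hs, Set.indicator_of_mem (show (r, s) ∈ prodSimplex n t from ⟨hr, hs⟩)]
    · rw [Set.indicator_of_notMem hs,
        Set.indicator_of_notMem (show (r, s) ∉ prodSimplex n t from fun h => hs h.2)]
  · rw [Set.indicator_of_notMem hr,
      Set.indicator_of_notMem (show (r, s) ∉ prodSimplex n t from fun h => hr h.1)]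

theorem lintegral_timeSimplex_succ {n : ℕ} {t : ℝ} {F : (Fin (n + 1) → ℝ) → ℝ≥0∞}
    (hF : Measurable F) :
    ∫⁻ s in timeSimplex (n + 1) t, F s =
      ∫⁻ r in Set.Ioo 0 t, ∫⁻ s in timeSimplex n r, F (Fin.snoc (α := fun _ => ℝ) s r) := by
  rw [← (measurePreserving_snoc n).setLIntegral_comp_preimage (measurableSet_timeSimplex _ _) hF,
    preimage_timeSimplex]
  simp only [piFinSuccAbove_symm_eq_snoc]
  rw [← lintegral_indicator (measurableSet_prodSimplex n t), lintegral_prod,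
    ← lintegral_indicator measurableSet_Ioo]
  · refine lintegral_congr fun r => ?_
    simp only [indicator_prodSimplex]
    by_cases hr : r ∈ Set.Ioo 0 t
    · simp only [Set.indicator_of_mem hr]
      rw [lintegral_indicator (measurableSet_timeSimplex _ _)]
    · simp [Set.indicator_of_notMem hr]
  · exact ((hF.comp measurable_snoc).indicator (measurableSet_prodSimplex n t)).aemeasurable

/-- Fubini for the measure-preserving splitting of the last coordinate, which maps the simplex to
`prodSimplex`. -/
theorem integrableOn_timeSimplex_succ {n : ℕ} {t : ℝ} {F : (Fin (n + 1) → ℝ) → ℝ}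
    (hF : IntegrableOn F (timeSimplex (n + 1) t)) :
    (∀ᵐ r ∂(volume.restrict (Set.Ioo 0 t)),
        IntegrableOn (fun s => F (Fin.snoc (α := fun _ => ℝ) s r)) (timeSimplex n r)) ∧
      IntegrableOn (fun r => ∫ s in timeSimplex n r, F (Fin.snoc (α := fun _ => ℝ) s r))
        (Set.Ioo 0 t) ∧
      ∫ s in timeSimplex (n + 1) t, F s =
        ∫ r in Set.Ioo 0 t, ∫ s in timeSimplex n r, F (Fin.snoc (α := fun _ => ℝ) s r) := by
  have h1 := ((measurePreserving_snoc n).integrableOn_comp_preimage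
    (MeasurableEquiv.measurableEmbedding _)).2 hF
  rw [preimage_timeSimplex] at h1
  have h2 : Integrable ((prodSimplex n t).indicator
      (fun p => F (Fin.snoc (α := fun _ => ℝ) p.2 p.1))) (volume.prod volume) := by
    rw [integrable_indicator_iff (measurableSet_prodSimplex n t)]
    refine h1.congr_fun (fun p _ => ?_) (measurableSet_prodSimplex n t)
    simp only [Function.comp, piFinSuccAbove_symm_eq_snoc]
  have h3 : ∀ r, ∫ s, (prodSimplex n t).indicator
      (fun p => F (Fin.snoc (α := fun _ => ℝ) p.2 p.1)) (r, s) = (Set.Ioo 0 t).indicator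
        (fun r => ∫ s in timeSimplex n r, F (Fin.snoc (α := fun _ => ℝ) s r)) r := fun r => by
    simp only [indicator_prodSimplex]
    by_cases hr : r ∈ Set.Ioo 0 t
    · simp only [Set.indicator_of_mem hr]
      rw [integral_indicator (measurableSet_timeSimplex _ _)]
    · simp [Set.indicator_of_notMem hr]
  refine ⟨?_, ?_, ?_⟩
  · rw [ae_restrict_iff' measurableSet_Ioo]
    filter_upwards [h2.prod_right_ae] with r hr hr0
    simp only [indicator_prodSimplex, Set.indicator_of_mem hr0] at hr
    rwa [integrable_indicator_iff (measurableSet_timeSimplex _ _)] at hr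
  · have h4 := h2.integral_prod_left
    simp only [h3] at h4
    rwa [integrable_indicator_iff measurableSet_Ioo] at h4
  · rw [← (measurePreserving_snoc n).setIntegral_preimage_emb
      (MeasurableEquiv.measurableEmbedding _), preimage_timeSimplex]
    simp only [piFinSuccAbove_symm_eq_snoc]
    rw [← integral_indicator (measurableSet_prodSimplex n t), integral_prod _ h2]
    simp only [h3]
    rw [integral_indicator measurableSet_Ioo]

theorem setIntegral_timeSimplex_zero (t : ℝ) (F : (Fin 0 → ℝ) → ℝ) :
    ∫ s in timeSimplex 0 t, F s = F Fin.elim0 := by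
  have h : timeSimplex 0 t = Set.univ :=
    Set.eq_univ_of_forall fun s => ⟨fun i => i.elim0, fun i => i.elim0⟩
  rw [h, Measure.restrict_univ, volume_pi, Measure.pi_of_empty _ Fin.elim0, integral_dirac]

/-- Integrability is essential: it makes almost every inner slice integrable, so the iterated
integral can be evaluated from the inside. -/
theorem orderedIntegral_eq_setIntegral {n : ℕ} {t : ℝ} (ht : 0 ≤ t) {F : (Fin n → ℝ) → ℝ}
    (hF : IntegrableOn F (timeSimplex n t)) :
    orderedIntegral n t F = ∫ s in timeSimplex n t, F s := by
  induction n generalizing t with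
  | zero => rw [setIntegral_timeSimplex_zero, orderedIntegral]
  | succ n ih =>
    obtain ⟨h1, -, h3⟩ := integrableOn_timeSimplex_succ hF
    rw [h3, orderedIntegral, intervalIntegral.integral_of_le ht, integral_Ioc_eq_integral_Ioo]
    refine integral_congr_ae ?_
    filter_upwards [h1, ae_restrict_mem measurableSet_Ioo] with r hr hr0
    exact ih hr0.1.le hr

end Gaps

/-! ### Chains of derivatives `⟨B, D S_τ ·⟩` -/

section DerivChain

/-- The iterated derivatives `⟨B, D S_{τₙ} ⟨B, D S_{τₙ₋₁} ⋯ ⟨B, D S_{τ₁} f⟩⟩⟩`. -/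
def derivChain [MeasurableSpace H] (T : C0Semigroup H) (N : ℝ → Measure H) (B : H → H)
    (f : H → ℝ) : {n : ℕ} → (Fin n → ℝ) → H → ℝ
  | 0, _ => f
  | n + 1, τ => derivOp T N B (τ (Fin.last n)) (derivChain T N B f fun i : Fin n => τ i.castSucc)

/-- The definition peels off the outermost operator; this form peels off the innermost one. The
recursion for `vⁿ` uses the former, and conditioning on the earlier values of the process uses the
latter. -/
theorem derivChain_succ [MeasurableSpace H] (T : C0Semigroup H) (N : ℝ → Measure H) (B : H → H)
    (f : H → ℝ) {n : ℕ} (τ : Fin (n + 1) → ℝ) : derivChain T N B f τ =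
      derivChain T N B (derivOp T N B (τ 0) f) fun i : Fin n => τ i.succ := by
  induction n with
  | zero => rfl
  | succ n ih =>
    conv_lhs => rw [derivChain, ih]
    conv_rhs => rw [derivChain]
    rfl

theorem derivChain_snoc [MeasurableSpace H] (T : C0Semigroup H) (N : ℝ → Measure H) (B : H → H)
    (f : H → ℝ) {n : ℕ} (τ : Fin n → ℝ) (r : ℝ) :
    derivChain T N B f (Fin.snoc (α := fun _ => ℝ) τ r) =
      derivOp T N B r (derivChain T N B f τ) := by
  rw [derivChain]
  simp only [Fin.snoc_last, Fin.snoc_castSucc]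

variable [CompleteSpace H] [TopologicalSpace.SeparableSpace H]

/-- `‖Λ(τ)‖` for `τ > 0`, extended by zero. -/
def lamNorm (T : C0Semigroup H) (Q : H →L[ℝ] H) : ℝ → ℝ :=
  (Set.Ioi 0).indicator fun t => ‖lam T Q t‖

theorem lamNorm_of_pos (T : C0Semigroup H) (Q : H →L[ℝ] H) {τ : ℝ} (hτ : 0 < τ) :
    lamNorm T Q τ = ‖lam T Q τ‖ := Set.indicator_of_mem (Set.mem_Ioi.2 hτ) _

theorem lamNorm_nonneg (T : C0Semigroup H) (Q : H →L[ℝ] H) (τ : ℝ) : 0 ≤ lamNorm T Q τ :=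
  Set.indicator_nonneg (fun _ _ => norm_nonneg _) _

variable [MeasurableSpace H] [BorelSpace H] {T : C0Semigroup H} {Q : H →L[ℝ] H}
  {N : ℝ → Measure H} {δ C : ℝ} {B : H → H} {b : ℝ} {f : H → ℝ} {M : ℝ}

theorem IsOUFamily.abs_derivOp_le' (hN : IsOUFamily T Q N δ C) (hb : ∀ y, ‖B y‖ ≤ b)
    (hf : Measurable f) (hM : ∀ x, |f x| ≤ M) (τ : ℝ) (x : H) :
    |derivOp T N B τ f x| ≤ M * (lamNorm T Q τ * b) := by
  have hM0 : 0 ≤ M := (abs_nonneg _).trans (hM 0)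
  have hb0 : 0 ≤ b := (norm_nonneg _).trans (hb 0)
  by_cases hτ : 0 < τ
  · rw [lamNorm_of_pos T Q hτ, ← mul_assoc]
    exact hN.abs_derivOp_le hb hf hM hτ x
  · rw [derivOp, if_neg hτ, abs_zero]
    have := lamNorm_nonneg T Q τ
    positivity

/-- One induction proves both claims, since adding a derivative requires the previous function to be
measurable and bounded. -/
theorem IsOUFamily.measurable_derivChain_and_abs_le (hN : IsOUFamily T Q N δ C) (hB : Measurable B)
    (hb : ∀ y, ‖B y‖ ≤ b) (hf : Measurable f) (hM : ∀ x, |f x| ≤ M) (n : ℕ) :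
    (Measurable fun p : (Fin n → ℝ) × H => derivChain T N B f p.1 p.2) ∧
      ∀ (τ : Fin n → ℝ) y, |derivChain T N B f τ y| ≤ M * ∏ i, (lamNorm T Q (τ i) * b) := by
  induction n with
  | zero => exact ⟨hf.comp measurable_snd, fun τ y => by simpa [derivChain] using hM y⟩
  | succ n ih =>
    obtain ⟨ih1, ih2⟩ := ih
    refine ⟨?_, fun τ y => ?_⟩
    · have h := hN.measurable_derivOp hB (F := fun τ : Fin n → ℝ => derivChain T N B f τ) ih1
        (fun τ => ⟨_, ih2 τ⟩)
      have hm : Measurable fun p : (Fin (n + 1) → ℝ) × H =>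
        (p.1 (Fin.last n), (fun i : Fin n => p.1 i.castSucc), p.2) := by fun_prop
      exact h.comp hm
    · rw [derivChain, Fin.prod_univ_castSucc, ← mul_assoc]
      refine hN.abs_derivOp_le' hb ?_ (ih2 _) _ _
      exact ih1.comp measurable_prodMk_left

end DerivChain

/-! ### Integrability of products of `‖Λ‖` over the simplex -/

section SingularIntegrals

theorem lintegral_Ioo_rpow {δ : ℝ} (hδ : δ < 1) {t : ℝ} (ht : 0 < t) :
    ∫⁻ r in Set.Ioo 0 t, ENNReal.ofReal (r ^ (-δ)) =
      ENNReal.ofReal (t ^ (1 - δ) / (1 - δ)) := by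
  have hi : IntervalIntegrable (fun r : ℝ => r ^ (-δ)) volume 0 t :=
    intervalIntegral.intervalIntegrable_rpow' (by linarith)
  rw [intervalIntegrable_iff_integrableOn_Ioo_of_le ht.le] at hi
  rw [← ofReal_integral_eq_lintegral_ofReal hi]
  · rw [← integral_Ioc_eq_integral_Ioo, ← intervalIntegral.integral_of_le ht.le,
      integral_rpow (Or.inl (by linarith)), Real.zero_rpow (by linarith), sub_zero]
    rw [show -δ + 1 = 1 - δ by ring]
  · filter_upwards [ae_restrict_mem measurableSet_Ioo] with r hr
    exact Real.rpow_nonneg hr.1.le _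

theorem lintegral_Ioo_sub_rpow {δ : ℝ} (hδ : δ < 1) {t : ℝ} (ht : 0 < t) :
    ∫⁻ r in Set.Ioo 0 t, ENNReal.ofReal ((t - r) ^ (-δ)) =
      ENNReal.ofReal (t ^ (1 - δ) / (1 - δ)) := by
  rw [← lintegral_Ioo_rpow hδ ht]
  have h := (Measure.measurePreserving_sub_left volume t).setLIntegral_comp_preimage
    (s := Set.Ioo 0 t) measurableSet_Ioo
    (f := fun r => ENNReal.ofReal (r ^ (-δ))) (by fun_prop)
  rw [← h]
  simp

/-- One of `r` and `t - r` is at least `t / 2`, which bounds its factor by `(t / 2)^{-δ}`. -/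
theorem rpow_sub_mul_rpow_le {δ : ℝ} (hδ : 0 < δ) {r t : ℝ} (hr : 0 < r) (hrt : r < t) :
    (t - r) ^ (-δ) * r ^ (-δ) ≤ (t / 2) ^ (-δ) * ((t - r) ^ (-δ) + r ^ (-δ)) := by
  have h1 : 0 ≤ (t - r) ^ (-δ) := Real.rpow_nonneg (by linarith) _
  have h2 : 0 ≤ r ^ (-δ) := Real.rpow_nonneg hr.le _
  have h3 : 0 ≤ (t / 2) ^ (-δ) := Real.rpow_nonneg (by linarith) _
  rcases le_total (t / 2) r with h | h
  · have := Real.rpow_le_rpow_of_nonpos (by linarith) h (by linarith : -δ ≤ 0)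
    nlinarith
  · have := Real.rpow_le_rpow_of_nonpos (by linarith) (by linarith : t / 2 ≤ t - r)
      (by linarith : -δ ≤ 0)
    nlinarith

theorem lintegral_convolution_rpow_le {δ : ℝ} (hδ : 0 < δ) (hδ1 : δ < 1) {t t₁ : ℝ} (ht : 0 < t)
    (ht1 : t ≤ t₁) : ∫⁻ r in Set.Ioo 0 t, ENNReal.ofReal ((t - r) ^ (-δ) * r ^ (-δ)) ≤
      ENNReal.ofReal (2 * 2 ^ δ * (t₁ ^ (1 - δ) / (1 - δ)) * t ^ (-δ)) := by
  calc ∫⁻ r in Set.Ioo 0 t, ENNReal.ofReal ((t - r) ^ (-δ) * r ^ (-δ))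
      ≤ ∫⁻ r in Set.Ioo 0 t, ENNReal.ofReal ((t / 2) ^ (-δ)) *
          (ENNReal.ofReal ((t - r) ^ (-δ)) + ENNReal.ofReal (r ^ (-δ))) := by
        refine setLIntegral_mono' measurableSet_Ioo fun r hr => ?_
        rw [← ENNReal.ofReal_add (Real.rpow_nonneg (by linarith [hr.2]) _)
          (Real.rpow_nonneg hr.1.le _), ← ENNReal.ofReal_mul (Real.rpow_nonneg (by linarith) _)]
        exact ENNReal.ofReal_le_ofReal (rpow_sub_mul_rpow_le hδ hr.1 hr.2)
    _ = ENNReal.ofReal ((t / 2) ^ (-δ) * (t ^ (1 - δ) / (1 - δ) + t ^ (1 - δ) / (1 - δ))) := by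
        have h0 : 0 ≤ t ^ (1 - δ) / (1 - δ) :=
          div_nonneg (Real.rpow_nonneg ht.le _) (by linarith)
        rw [lintegral_const_mul _ (by fun_prop), lintegral_add_left (by fun_prop),
          lintegral_Ioo_rpow hδ1 ht, lintegral_Ioo_sub_rpow hδ1 ht, ← ENNReal.ofReal_add h0 h0,
          ← ENNReal.ofReal_mul (Real.rpow_nonneg (by linarith) _)]
    _ ≤ _ := by
        refine ENNReal.ofReal_le_ofReal ?_
        rw [Real.div_rpow ht.le (by norm_num), Real.rpow_neg (by norm_num : (0 : ℝ) ≤ 2), div_inv_eq_mul]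
        have h1 : t ^ (1 - δ) / (1 - δ) ≤ t₁ ^ (1 - δ) / (1 - δ) := by
          have : 0 < 1 - δ := by linarith
          gcongr
        have h2 : 0 ≤ t ^ (-δ) * 2 ^ δ := by positivity
        nlinarith

variable [CompleteSpace H] [TopologicalSpace.SeparableSpace H] [MeasurableSpace H] [BorelSpace H]
  {T : C0Semigroup H} {Q : H →L[ℝ] H} {N : ℝ → Measure H} {δ C : ℝ}

theorem IsOUFamily.measurable_prod_lamNorm (hN : IsOUFamily T Q N δ C) (n : ℕ) :
    Measurable fun τ : Fin n → ℝ => ∏ i, lamNorm T Q (τ i) :=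
  Finset.measurable_fun_prod _ fun i _ => hN.lam_meas.comp (measurable_pi_apply i)

/-- Convolution with `τ^{-δ}` maps a bound `c r^{-δ}` to a bound of the same form: the gained factor
`t^{1-δ}` is absorbed in the constant through `t ≤ t₁`. The shape is thus stable under induction. -/
theorem IsOUFamily.lintegral_prod_lamNorm_snoc_le (hN : IsOUFamily T Q N δ C) (n : ℕ) (t₁ : ℝ) :
    ∃ c : ℝ, 0 ≤ c ∧ ∀ t, 0 < t → t ≤ t₁ →
      ∫⁻ s in timeSimplex n t, ENNReal.ofReal
        (∏ i, lamNorm T Q (gaps (Fin.snoc (α := fun _ => ℝ) s t) i)) ≤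
        ENNReal.ofReal (c * t ^ (-δ)) := by
  have hL : ∀ t, 0 < t → lamNorm T Q t ≤ C * t ^ (-δ) := fun t ht => by
    rw [lamNorm_of_pos T Q ht, Real.rpow_neg ht.le, ← div_eq_mul_inv]
    exact hN.lam_le t ht
  have hC := hN.const_pos
  have hδ := hN.delta
  induction n with
  | zero =>
    refine ⟨C, hC.le, fun t ht _ => ?_⟩
    have h : timeSimplex 0 t = Set.univ :=
      Set.eq_univ_of_forall fun s => ⟨fun i => i.elim0, fun i => i.elim0⟩
    rw [h, Measure.restrict_univ, volume_pi, Measure.pi_of_empty _ Fin.elim0, lintegral_dirac]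
    refine ENNReal.ofReal_le_ofReal ?_
    rw [gaps_snoc, Fin.prod_univ_castSucc]
    simp only [Fin.snoc_last, lastTime, Finset.univ_eq_empty, Finset.prod_empty, one_mul]
    simpa using hL t ht
  | succ n ih =>
    obtain ⟨c, hc, ih⟩ := ih
    by_cases ht1 : 0 ≤ t₁
    swap
    · exact ⟨0, le_rfl, fun t ht h => absurd (ht.le.trans h) ht1⟩
    have h1δ : 0 < 1 - δ := by linarith [hδ.2]
    refine ⟨C * c * (2 * 2 ^ δ * (t₁ ^ (1 - δ) / (1 - δ))), by positivity, fun t ht htt => ?_⟩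
    have hm : Measurable fun s : Fin (n + 1) → ℝ => ENNReal.ofReal
        (∏ i, lamNorm T Q (gaps (Fin.snoc (α := fun _ => ℝ) s t) i)) := by
      refine ENNReal.measurable_ofReal.comp ((hN.measurable_prod_lamNorm _).comp
        (measurable_gaps.comp (measurable_snoc.comp measurable_prodMk_left)))
    rw [lintegral_timeSimplex_succ hm]
    calc _ ≤ ∫⁻ r in Set.Ioo 0 t, ENNReal.ofReal (C * c) *
          ENNReal.ofReal ((t - r) ^ (-δ) * r ^ (-δ)) := by
          refine setLIntegral_mono' measurableSet_Ioo fun r hr => ?_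
          -- The last gap `t - r` splits off; what remains is the product for a chain ending at `r`,
          -- to which the induction hypothesis applies.
          simp only [gaps_snoc (Fin.snoc (α := fun _ => ℝ) _ r) t, lastTime_snoc]
          simp only [Fin.prod_univ_castSucc (n := n + 1), Fin.snoc_last, Fin.snoc_castSucc]
          have h0 : 0 < t - r := by linarith [hr.2]
          have hnn : ∀ s : Fin n → ℝ,
              0 ≤ ∏ i, lamNorm T Q (gaps (Fin.snoc (α := fun _ => ℝ) s r) i) :=
            fun s => Finset.prod_nonneg fun i _ => lamNorm_nonneg _ _ _
          simp only [ENNReal.ofReal_mul (hnn _)]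
          rw [lintegral_mul_const' _ _ ENNReal.ofReal_ne_top]
          calc _ ≤ ENNReal.ofReal (c * r ^ (-δ)) * ENNReal.ofReal (C * (t - r) ^ (-δ)) :=
                mul_le_mul' (ih r hr.1 (hr.2.le.trans htt)) (ENNReal.ofReal_le_ofReal (hL _ h0))
            _ = _ := by
                have h2 := Real.rpow_nonneg hr.1.le (-δ)
                rw [← ENNReal.ofReal_mul (by positivity), ← ENNReal.ofReal_mul (by positivity)]
                congr 1
                ring
      _ ≤ _ := by
          rw [lintegral_const_mul' _ _ ENNReal.ofReal_ne_top]
          refine (mul_le_mul_right (lintegral_convolution_rpow_le hδ.1 hδ.2 ht htt) _).trans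
            (le_of_eq ?_)
          rw [← ENNReal.ofReal_mul (by positivity)]
          congr 1
          ring

theorem IsOUFamily.integrableOn_prod_lamNorm_snoc (hN : IsOUFamily T Q N δ C) (n : ℕ) {t : ℝ}
    (ht : 0 < t) : IntegrableOn (fun s : Fin n → ℝ =>
      ∏ i, lamNorm T Q (gaps (Fin.snoc (α := fun _ => ℝ) s t) i)) (timeSimplex n t) := by
  obtain ⟨c, -, h⟩ := hN.lintegral_prod_lamNorm_snoc_le n t
  have hm : Measurable fun s : Fin n → ℝ =>
      ∏ i, lamNorm T Q (gaps (Fin.snoc (α := fun _ => ℝ) s t) i) :=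
    (hN.measurable_prod_lamNorm _).comp
        (measurable_gaps.comp (measurable_snoc.comp measurable_prodMk_left))
  refine ⟨hm.aestronglyMeasurable, ?_⟩
  rw [hasFiniteIntegral_iff_ofReal (Eventually.of_forall fun s =>
    Finset.prod_nonneg fun i _ => lamNorm_nonneg _ _ _)]
  exact (h t ht le_rfl).trans_lt ENNReal.ofReal_lt_top

/-- Without a final gap up to `t`, the inner integral at largest time `r` is at most `c r^{-δ}`,
integrable near `0`. -/
theorem IsOUFamily.integrableOn_prod_lamNorm (hN : IsOUFamily T Q N δ C) (n : ℕ) {t : ℝ}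
    (ht : 0 < t) : IntegrableOn (fun s : Fin n → ℝ => ∏ i, lamNorm T Q (gaps s i))
      (timeSimplex n t) := by
  have hm : Measurable fun s : Fin n → ℝ => ∏ i, lamNorm T Q (gaps s i) :=
    (hN.measurable_prod_lamNorm _).comp measurable_gaps
  refine ⟨hm.aestronglyMeasurable, ?_⟩
  rw [hasFiniteIntegral_iff_ofReal (Eventually.of_forall fun s =>
    Finset.prod_nonneg fun i _ => lamNorm_nonneg _ _ _)]
  cases n with
  | zero =>
    have h : timeSimplex 0 t = Set.univ :=
      Set.eq_univ_of_forall fun s => ⟨fun i => i.elim0, fun i => i.elim0⟩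
    rw [h, Measure.restrict_univ, volume_pi, Measure.pi_of_empty _ Fin.elim0, lintegral_dirac]
    exact ENNReal.ofReal_lt_top
  | succ n =>
    obtain ⟨c, hc, h⟩ := hN.lintegral_prod_lamNorm_snoc_le n t
    rw [lintegral_timeSimplex_succ hm.ennreal_ofReal]
    calc _ ≤ ∫⁻ r in Set.Ioo 0 t, ENNReal.ofReal c * ENNReal.ofReal (r ^ (-δ)) := by
          refine setLIntegral_mono' measurableSet_Ioo fun r hr => ?_
          rw [← ENNReal.ofReal_mul hc]
          exact h r hr.1 hr.2.le
      _ < ⊤ := by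
          rw [lintegral_const_mul' _ _ ENNReal.ofReal_ne_top, lintegral_Ioo_rpow hN.delta.2 ht]
          exact ENNReal.mul_lt_top ENNReal.ofReal_lt_top ENNReal.ofReal_lt_top

end SingularIntegrals

/-! ### Simplex representation and differentiability of the iterates -/

section Iterates

theorem timeSimplex_mono (n : ℕ) {t t' : ℝ} (h : t ≤ t') : timeSimplex n t ⊆ timeSimplex n t' :=
  fun _ hs => ⟨hs.1, fun i => ⟨(hs.2 i).1, (hs.2 i).2.trans_le h⟩⟩

variable [CompleteSpace H] [TopologicalSpace.SeparableSpace H]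

/-- By Riesz, `D a` is the limit of its partial sums in an orthonormal basis, whose coefficients are
the numbers `D a (e i)`. -/
theorem aestronglyMeasurable_dual_of_apply {A : Type*} [MeasurableSpace A] {lm : Measure A}
    {D : A → H →L[ℝ] ℝ} (hD : ∀ h, AEStronglyMeasurable (fun a => D a h) lm) :
    AEStronglyMeasurable D lm := by
  obtain ⟨w, e, -⟩ := exists_hilbertBasis ℝ H
  have hw : Countable w := countable_of_orthonormal e.orthonormal
  refine aestronglyMeasurable_of_tendsto_ae (u := (atTop : Filter (Finset w)))
    (f := fun J a => ∑ i ∈ J, D a (e i) • (InnerProductSpace.toDual ℝ H (e i))) (fun J => ?_)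
    (Eventually.of_forall fun a => ?_)
  · exact Finset.aestronglyMeasurable_fun_sum _ fun i _ => (hD (e i)).smul
      aestronglyMeasurable_const
  · have h1 := e.hasSum_repr ((InnerProductSpace.toDual ℝ H).symm (D a))
    have h2 := h1.mapL (InnerProductSpace.toDual ℝ H).toContinuousLinearEquiv.toContinuousLinearMap
    have h3 : ∀ i, ⟪e i, (InnerProductSpace.toDual ℝ H).symm (D a)⟫ = D a (e i) := fun i => by
      rw [real_inner_comm, InnerProductSpace.toDual_symm_apply]
    simp only [e.repr_apply_apply, h3] at h2
    simpa [HasSum] using h2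

variable [MeasurableSpace H] [BorelSpace H] {T : C0Semigroup H} {Q : H →L[ℝ] H}
  {N : ℝ → Measure H} {δ C : ℝ} {B : H → H} {b : ℝ} {f : H → ℝ} {M : ℝ}

theorem IsOUFamily.integrableOn_prod_lamNorm' (hN : IsOUFamily T Q N δ C) (n : ℕ) (t : ℝ) :
    IntegrableOn (fun s : Fin n → ℝ => ∏ i, lamNorm T Q (gaps s i)) (timeSimplex n t) :=
  (hN.integrableOn_prod_lamNorm n (lt_max_of_lt_right one_pos)).mono_set
    (timeSimplex_mono n (le_max_left t 1))

/-- The integrand `S_{t - sₙ} ⟨B, D S_{sₙ - sₙ₋₁} ⋯ ⟨B, D S_{s₁} f⟩⟩ (x)`. -/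
def chainIntegrand (T : C0Semigroup H) (N : ℝ → Measure H) (B : H → H) (f : H → ℝ) (t : ℝ)
    {n : ℕ} (s : Fin n → ℝ) (x : H) : ℝ :=
  transOp T N (t - lastTime s) (derivChain T N B f (gaps s)) x

theorem IsOUFamily.measurable_chainIntegrand (hN : IsOUFamily T Q N δ C) (hB : Measurable B)
    (hb : ∀ y, ‖B y‖ ≤ b) (hf : Measurable f) (hM : ∀ x, |f x| ≤ M) (t : ℝ) (n : ℕ) :
    Measurable fun p : (Fin n → ℝ) × H => chainIntegrand T N B f t p.1 p.2 := by
  have h := hN.measurable_transOp (F := fun τ : Fin n → ℝ => derivChain T N B f τ)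
    (hN.measurable_derivChain_and_abs_le hB hb hf hM n).1
  have hm : Measurable fun p : (Fin n → ℝ) × H => (t - lastTime p.1, gaps p.1, p.2) :=
    (measurable_const.sub (measurable_lastTime.comp measurable_fst)).prodMk
      ((measurable_gaps.comp measurable_fst).prodMk measurable_snd)
  exact h.comp hm

theorem IsOUFamily.abs_chainIntegrand_le (hN : IsOUFamily T Q N δ C) (hB : Measurable B)
    (hb : ∀ y, ‖B y‖ ≤ b) (hf : Measurable f) (hM : ∀ x, |f x| ≤ M) (t : ℝ) {n : ℕ}
    (s : Fin n → ℝ) (x : H) :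
    |chainIntegrand T N B f t s x| ≤ M * b ^ n * ∏ i, lamNorm T Q (gaps s i) := by
  refine (hN.abs_transOp_le ((hN.measurable_derivChain_and_abs_le hB hb hf hM n).2 (gaps s))
    _ _).trans (le_of_eq ?_)
  rw [Finset.prod_mul_distrib, Finset.prod_const, Finset.card_univ, Fintype.card_fin]
  ring

theorem IsOUFamily.integrableOn_chainIntegrand (hN : IsOUFamily T Q N δ C) (hB : Measurable B)
    (hb : ∀ y, ‖B y‖ ≤ b) (hf : Measurable f) (hM : ∀ x, |f x| ≤ M) (t : ℝ) (n : ℕ) (x : H) :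
    IntegrableOn (fun s : Fin n → ℝ => chainIntegrand T N B f t s x) (timeSimplex n t) := by
  refine ((hN.integrableOn_prod_lamNorm' n t).const_mul (M * b ^ n)).mono' ?_
    (Eventually.of_forall fun s => hN.abs_chainIntegrand_le hB hb hf hM t s x)
  exact ((hN.measurable_chainIntegrand hB hb hf hM t n).comp
    measurable_prodMk_right).aestronglyMeasurable

theorem derivChain_gaps_snoc_apply {n : ℕ} (s : Fin n → ℝ) (t : ℝ) (ht : 0 < t)
    (hs : s ∈ timeSimplex n t) (y : H) :
    derivChain T N B f (gaps (Fin.snoc (α := fun _ => ℝ) s t)) y =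
      fderiv ℝ (chainIntegrand T N B f t s) y (B y) := by
  rw [gaps_snoc, derivChain_snoc, derivOp, if_pos (sub_pos.2 (lastTime_mem ht hs).2)]
  rfl

/-- Differentiation under the integral. The outer operator `S_{t-sₙ}` contributes the extra factor
`‖Λ(t - sₙ)‖`, and the resulting majorant is uniform in `x` and integrable on the simplex. -/
theorem IsOUFamily.hasFDerivAt_integral_chainIntegrand (hN : IsOUFamily T Q N δ C)
    (hB : Measurable B) (hb : ∀ y, ‖B y‖ ≤ b) (hf : Measurable f) (hM : ∀ x, |f x| ≤ M) {t : ℝ}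
    (ht : 0 < t) (n : ℕ) (x : H) :
    ∃ D : H →L[ℝ] ℝ,
      HasFDerivAt (fun x => ∫ s in timeSimplex n t, chainIntegrand T N B f t s x) D x ∧
      D (B x) = ∫ s in timeSimplex n t,
        derivChain T N B f (gaps (Fin.snoc (α := fun _ => ℝ) s t)) x ∧
      ‖D‖ ≤ M * b ^ n * ∫ s in timeSimplex n t,
        ∏ i, lamNorm T Q (gaps (Fin.snoc (α := fun _ => ℝ) s t) i) := by
  obtain ⟨hcm, hcb⟩ := hN.measurable_derivChain_and_abs_le hB hb hf hM n
  have hcm' : ∀ τ : Fin n → ℝ, Measurable (derivChain T N B f τ) := fun τ =>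
    hcm.comp measurable_prodMk_left
  have hτ : ∀ s ∈ timeSimplex n t, 0 < t - lastTime s := fun s hs =>
    sub_pos.2 (lastTime_mem ht hs).2
  have hd : ∀ s ∈ timeSimplex n t, ∀ x,
      HasFDerivAt (chainIntegrand T N B f t s) (fderiv ℝ (chainIntegrand T N B f t s) x) x := by
    intro s hs x
    obtain ⟨D, hD, -⟩ := hN.hasFDerivAt_transOp (hcm' (gaps s)) (hcb _) (hτ s hs) x
    exact hD.differentiableAt.hasFDerivAt
  have hbd : ∀ s ∈ timeSimplex n t, ∀ x, ‖fderiv ℝ (chainIntegrand T N B f t s) x‖ ≤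
      M * b ^ n * ∏ i, lamNorm T Q (gaps (Fin.snoc (α := fun _ => ℝ) s t) i) := by
    intro s hs x
    refine (hN.norm_fderiv_transOp_le (hcm' (gaps s)) (hcb _) (hτ s hs) x).trans (le_of_eq ?_)
    rw [gaps_snoc, Fin.prod_univ_castSucc, Finset.prod_mul_distrib, Finset.prod_const,
      Finset.card_univ, Fintype.card_fin, ← lamNorm_of_pos T Q (hτ s hs)]
    simp only [Fin.snoc_castSucc, Fin.snoc_last]
    ring
  have hmeas : ∀ h, AEStronglyMeasurable (fun s => fderiv ℝ (chainIntegrand T N B f t s) x h)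
      (volume.restrict (timeSimplex n t)) := by
    intro h
    -- The derivative in a fixed direction `h` is `derivOp` with the constant field `h` in place of
    -- `B`.
    have h1 := hN.measurable_derivOp (B := fun _ => h) measurable_const
      (F := fun τ : Fin n → ℝ => derivChain T N B f τ) hcm (fun τ => ⟨_, hcb τ⟩)
    have h2 : Measurable fun s : Fin n → ℝ => (t - lastTime s, gaps s, x) :=
      (measurable_const.sub measurable_lastTime).prodMk (measurable_gaps.prodMk measurable_const)
    refine (h1.comp h2).aestronglyMeasurable.congr ?_
    filter_upwards [ae_restrict_mem (measurableSet_timeSimplex n t)] with s hs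
    simp only [Function.comp, derivOp, if_pos (hτ s hs)]
    rfl
  have hDm := aestronglyMeasurable_dual_of_apply hmeas
  have hbi := (hN.integrableOn_prod_lamNorm_snoc n ht).const_mul (M * b ^ n)
  have hae : ∀ᵐ s ∂(volume.restrict (timeSimplex n t)), s ∈ timeSimplex n t :=
    ae_restrict_mem (measurableSet_timeSimplex n t)
  refine ⟨∫ s in timeSimplex n t, fderiv ℝ (chainIntegrand T N B f t s) x, ?_, ?_, ?_⟩
  · refine hasFDerivAt_integral_of_dominated_of_fderiv_le (s := Set.univ)
      (F := fun x s => chainIntegrand T N B f t s x)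
      (F' := fun x s => fderiv ℝ (chainIntegrand T N B f t s) x) univ_mem
      (Eventually.of_forall fun x => ?_)
      (hN.integrableOn_chainIntegrand hB hb hf hM t n x) hDm
      (hae.mono fun s hs x _ => hbd s hs x) hbi (hae.mono fun s hs x _ => hd s hs x)
    exact (hN.integrableOn_chainIntegrand hB hb hf hM t n x).1
  · rw [ContinuousLinearMap.integral_apply (hbi.mono' hDm (hae.mono fun s hs => hbd s hs x))]
    refine integral_congr_ae (hae.mono fun s hs => ?_)
    exact (derivChain_gaps_snoc_apply s t ht hs x).symm
  · rw [← integral_const_mul]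
    exact norm_integral_le_of_norm_le hbi (hae.mono fun s hs => hbd s hs x)

theorem IsOUFamily.transOp_integral_derivChain (hN : IsOUFamily T Q N δ C) (hB : Measurable B)
    (hb : ∀ y, ‖B y‖ ≤ b) (hf : Measurable f) (hM : ∀ x, |f x| ≤ M) {r : ℝ} (hr : 0 < r) (t : ℝ)
    (n : ℕ) (x : H) :
    (Measurable fun y => ∫ s in timeSimplex n r,
        derivChain T N B f (gaps (Fin.snoc (α := fun _ => ℝ) s r)) y) ∧
    transOp T N (t - r) (fun y => ∫ s in timeSimplex n r,
        derivChain T N B f (gaps (Fin.snoc (α := fun _ => ℝ) s r)) y) x =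
      ∫ s in timeSimplex n r,
        chainIntegrand T N B f t (Fin.snoc (α := fun _ => ℝ) s r) x := by
  obtain ⟨hcm, hcb⟩ := hN.measurable_derivChain_and_abs_le hB hb hf hM (n + 1)
  have hm : Measurable fun p : (Fin n → ℝ) × H =>
      derivChain T N B f (gaps (Fin.snoc (α := fun _ => ℝ) p.1 r)) p.2 := by
    have h2 : Measurable fun p : (Fin n → ℝ) × H =>
        (gaps (Fin.snoc (α := fun _ => ℝ) p.1 r), p.2) :=
      (measurable_gaps.comp (measurable_snoc.comp
        (measurable_const.prodMk measurable_fst))).prodMk measurable_snd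
    exact hcm.comp h2
  refine ⟨measurable_integral_param hm, ?_⟩
  rw [hN.transOp_integral (F := fun (s : Fin n → ℝ) y =>
    derivChain T N B f (gaps (Fin.snoc (α := fun _ => ℝ) s r)) y) hm
    ((hN.integrableOn_prod_lamNorm_snoc n hr).const_mul (M * b ^ (n + 1)))
    (Eventually.of_forall fun s y => (hcb _ y).trans (le_of_eq ?_))]
  · simp only [chainIntegrand, lastTime_snoc]
  · rw [Finset.prod_mul_distrib, Finset.prod_const, Finset.card_univ, Fintype.card_fin]
    ring

variable {Ω : Type*} [MeasurableSpace Ω] {P : Measure Ω} {WA : ℝ → Ω → H}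

/-- For `0 < r < t`, the derivative of the simplex integral along `B` is a simplex integral of
longer chains, and `S_{t-r}` passes inside by Fubini; integrating over `r` assembles the simplex of
one dimension more. The endpoint `r = 0`, where smoothness may fail, is a null set. -/
theorem IsOUFamily.integral_iterate_step (hN : IsOUFamily T Q N δ C)
    (hS : ∀ τ, 0 ≤ τ → ∀ (g : H → ℝ), Measurable g → ∀ x,
      ouSemigroup P T WA τ g x = transOp T N τ g x)
    (hB : Measurable B) (hb : ∀ y, ‖B y‖ ≤ b) (hf : Measurable f) (hM : ∀ x, |f x| ≤ M) (n : ℕ)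
    (hit : ∀ t, 0 ≤ t → ∀ x, iterate P T WA f B n t x =
      ∫ s in timeSimplex n t, chainIntegrand T N B f t s x) {t : ℝ} (ht : 0 ≤ t) (x : H) :
    IntervalIntegrable (fun s => ouSemigroup P T WA (t - s)
        (fun y => fderiv ℝ (iterate P T WA f B n s) y (B y)) x) volume 0 t ∧
      ∫ s in (0 : ℝ)..t, ouSemigroup P T WA (t - s)
        (fun y => fderiv ℝ (iterate P T WA f B n s) y (B y)) x =
        ∫ s in timeSimplex (n + 1) t, chainIntegrand T N B f t s x := by
  have h1 : ∀ r ∈ Set.Ioo 0 t, ouSemigroup P T WA (t - r)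
      (fun y => fderiv ℝ (iterate P T WA f B n r) y (B y)) x = ∫ s in timeSimplex n r,
        chainIntegrand T N B f t (Fin.snoc (α := fun _ => ℝ) s r) x := by
    intro r hr
    have h2 : (fun y => fderiv ℝ (iterate P T WA f B n r) y (B y)) = fun y =>
        ∫ s in timeSimplex n r,
          derivChain T N B f (gaps (Fin.snoc (α := fun _ => ℝ) s r)) y := by
      funext y
      obtain ⟨D, hD, hDB, -⟩ := hN.hasFDerivAt_integral_chainIntegrand hB hb hf hM hr.1 n y
      rw [show iterate P T WA f B n r = _ from funext (hit r hr.1.le), hD.fderiv, hDB]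
    obtain ⟨h3, h4⟩ := hN.transOp_integral_derivChain hB hb hf hM hr.1 t n x
    rw [h2, hS _ (by linarith [hr.2]) _ h3, h4]
  obtain ⟨-, h5, h6⟩ :=
    integrableOn_timeSimplex_succ (hN.integrableOn_chainIntegrand hB hb hf hM t (n + 1) x)
  constructor
  · rw [intervalIntegrable_iff_integrableOn_Ioo_of_le ht]
    exact h5.congr_fun (fun r hr => (h1 r hr).symm) measurableSet_Ioo
  · rw [h6, intervalIntegral.integral_of_le ht, integral_Ioc_eq_integral_Ioo]
    exact setIntegral_congr_fun measurableSet_Ioo h1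

theorem IsOUFamily.iterate_eq (hN : IsOUFamily T Q N δ C)
    (hS : ∀ τ, 0 ≤ τ → ∀ (g : H → ℝ), Measurable g → ∀ x,
      ouSemigroup P T WA τ g x = transOp T N τ g x)
    (hB : Measurable B) (hb : ∀ y, ‖B y‖ ≤ b) (hf : Measurable f) (hM : ∀ x, |f x| ≤ M) (n : ℕ) :
    ∀ t, 0 ≤ t → ∀ x, iterate P T WA f B n t x =
      ∫ s in timeSimplex n t, chainIntegrand T N B f t s x := by
  induction n with
  | zero =>
    intro t ht x
    rw [setIntegral_timeSimplex_zero, iterate, hS t ht f hf x, chainIntegrand]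
    simp [lastTime, derivChain]
  | succ n ih => exact fun t ht x => (hN.integral_iterate_step hS hB hb hf hM n ih ht x).2

end Iterates

/-! ### The expectation of the product of white noise factors -/

section Chaos

theorem integral_abs_le_norm_Lp {E : Type*} [MeasurableSpace E] {μ : Measure E}
    [IsProbabilityMeasure μ] (I : Lp ℝ 2 μ) : ∫ x, |I x| ∂μ ≤ ‖I‖ := by
  have h1 : ∫ x, |I x| ∂μ = (eLpNorm I 1 μ).toReal := by
    rw [eLpNorm_one_eq_lintegral_enorm, ← integral_norm_eq_lintegral_enorm (Lp.aestronglyMeasurable I)]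
    rfl
  rw [h1, Lp.norm_def]
  exact ENNReal.toReal_mono (Lp.eLpNorm_ne_top I)
    (eLpNorm_le_eLpNorm_of_exponent_le (by norm_num) (Lp.aestronglyMeasurable I))

variable [CompleteSpace H] [TopologicalSpace.SeparableSpace H] [MeasurableSpace H] [BorelSpace H]

theorem IsCenteredGaussian.eq {μ ν : Measure H} [IsFiniteMeasure μ] [IsFiniteMeasure ν]
    {K : H →L[ℝ] H} (hμ : IsCenteredGaussian μ K) (hν : IsCenteredGaussian ν K) : μ = ν := by
  refine Measure.ext_of_charFun (funext fun h => ?_)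
  simp only [charFun_apply, real_inner_comm h]
  exact (hμ h).trans (hν h).symm

variable {G : Type*} [MeasurableSpace G] {K : H →L[ℝ] H}

/-- Integrating out `Y` with `Z` frozen, where the pairing becomes white noise. Its conditional
first moment is at most `C`, so multiplying by the pairing preserves integrability of `ξ (Z ω)`; no
square integrability of `ξ` is required. -/
theorem whitePairing_mul_integral {Ω : Type*} [MeasurableSpace Ω] {P : Measure Ω}
    [IsProbabilityMeasure P] {Z : Ω → G} {Y : Ω → H} (hZ : AEMeasurable Z P)
    (hY : AEMeasurable Y P) (hind : IndepFun Z Y P) {μ : Measure H} [IsProbabilityMeasure μ]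
    (hYμ : P.map Y = μ) (hμ : IsCenteredGaussian μ K)
    (hK : K.IsPositive) (hinj : ∀ x, K x = 0 → x = 0) {b : G → H} (hb : Measurable b) {C : ℝ}
    (hC : ∀ g, ‖b g‖ ≤ C) {ξ : G → ℝ} (hξ : Measurable ξ)
    (hξi : Integrable (fun ω => ξ (Z ω)) P) :
    ∃ ρ : G × H → ℝ, Measurable ρ ∧
      whitePairing P K (fun ω => b (Z ω)) Y =ᵐ[P] (fun ω => ρ (Z ω, Y ω)) ∧
      Integrable (fun ω => ρ (Z ω, Y ω) * ξ (Z ω)) P ∧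
      ∀ (φ : G × H → ℝ) (M : ℝ), Measurable φ → (∀ p, |φ p| ≤ M) →
        ∫ ω, φ (Z ω, Y ω) * (ρ (Z ω, Y ω) * ξ (Z ω)) ∂P =
          ∫ ω, (∫ y, φ (Z ω, y) * whiteNoise μ K (b (Z ω)) y ∂μ) * ξ (Z ω) ∂P := by
  subst hYμ
  have : IsProbabilityMeasure (P.map Z) := Measure.isProbabilityMeasure_map hZ
  obtain ⟨ρ, hρm, hρ, hρI⟩ := whitePairing_eq hZ hY hind hμ hK hinj hb hC
  have hlaw : P.map (fun ω => (Z ω, Y ω)) = (P.map Z).prod (P.map Y) :=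
    (indepFun_iff_map_prod_eq_prod_map_map hZ hY).1 hind
  have hZY : AEMeasurable (fun ω => (Z ω, Y ω)) P := hZ.prodMk hY
  have hm : Measurable fun p : G × H => ρ p * ξ p.1 := hρm.mul (hξ.comp measurable_fst)
  have hξi' : Integrable ξ (P.map Z) :=
    (integrable_map_measure hξ.aestronglyMeasurable hZ).2 hξi
  have hint : Integrable (fun p : G × H => ρ p * ξ p.1) ((P.map Z).prod (P.map Y)) := by
    rw [integrable_prod_iff hm.aestronglyMeasurable]
    constructor
    · filter_upwards [hρI] with g hg
      refine Integrable.mul_const ?_ _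
      exact ((Lp.memLp (whiteNoise (P.map Y) K (b g))).integrable (by norm_num)).congr hg.symm
    · refine (hξi'.norm.const_mul C).mono' hm.norm.aestronglyMeasurable.integral_prod_right' ?_
      filter_upwards [hρI] with g hg
      rw [Real.norm_of_nonneg (by positivity)]
      simp only [norm_mul]
      rw [integral_mul_const]
      refine mul_le_mul_of_nonneg_right ?_ (norm_nonneg _)
      calc ∫ y, ‖ρ (g, y)‖ ∂(P.map Y) = ∫ y, |whiteNoise (P.map Y) K (b g) y| ∂(P.map Y) :=
            integral_congr_ae (hg.mono fun y hy => by
              simp only at hy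
              simp only [hy, Real.norm_eq_abs])
        _ ≤ ‖whiteNoise (P.map Y) K (b g)‖ := integral_abs_le_norm_Lp _
        _ ≤ ‖b g‖ := (whiteNoise_spec hμ hK hinj).2 _
        _ ≤ C := hC g
  refine ⟨ρ, hρm, hρ, ?_, fun φ M hφ hM => ?_⟩
  · rw [← hlaw] at hint
    exact (integrable_map_measure hm.aestronglyMeasurable hZY).1 hint
  · have hm2 : Measurable fun p : G × H => φ p * (ρ p * ξ p.1) := hφ.mul hm
    have hint2 : Integrable (fun p : G × H => φ p * (ρ p * ξ p.1)) ((P.map Z).prod (P.map Y)) :=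
      hint.bdd_mul hφ.aestronglyMeasurable (Eventually.of_forall hM)
    have h1 : ∫ ω, φ (Z ω, Y ω) * (ρ (Z ω, Y ω) * ξ (Z ω)) ∂P =
        ∫ p, φ p * (ρ p * ξ p.1) ∂(P.map fun ω => (Z ω, Y ω)) :=
      (integral_map hZY hm2.aestronglyMeasurable).symm
    rw [h1, hlaw, integral_prod _ hint2,
      integral_map hZ hm2.aestronglyMeasurable.integral_prod_right']
    refine integral_congr_ae ?_
    filter_upwards [ae_of_ae_map hZ hρI] with ω hω
    simp only [← mul_assoc]
    rw [integral_mul_const]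
    congr 1
    refine integral_congr_ae (hω.mono fun y hy => ?_)
    simp only at hy
    simp only [hy]

variable {T : C0Semigroup H} {Q : H →L[ℝ] H} {Ω : Type*} [MeasurableSpace Ω] {P : Measure Ω}
  [IsProbabilityMeasure P] {ι : Type*} {e : HilbertBasis ι ℝ H} {W : ι → ℝ≥0 → Ω → ℝ}
  {WA : ℝ → Ω → H} {δ C : ℝ}

theorem IsStochasticConvolution.aemeasurable (hWA : IsStochasticConvolution P T Q e W WA) {t : ℝ}
    (ht : 0 ≤ t) : AEMeasurable (WA t) P :=
  (hWA t ht).1.aestronglyMeasurable.aemeasurable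

/-- The laws of the stochastic convolution. -/
def convolutionLaw (P : Measure Ω) (WA : ℝ → Ω → H) (t : ℝ) : Measure H := P.map (WA (max t 0))

theorem isOUFamily_convolutionLaw (hQ : Q.IsPositive) (hQker : ∀ x, Q x = 0 → x = 0)
    (hrange : ∀ t, 0 < t → Set.range (T t) ⊆ Set.range (opSqrt (covOp T Q t)))
    (hδ : 0 < δ ∧ δ < 1) (hC : 0 < C) (hΛ : ∀ t, 0 < t → ‖lam T Q t‖ ≤ C / t ^ δ)
    (hW : IsCylindricalBM P W) (hWA : IsStochasticConvolution P T Q e W WA) :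
    IsOUFamily T Q (convolutionLaw P WA) δ C := by
  have hp : ∀ t, IsProbabilityMeasure (convolutionLaw P WA t) := fun t =>
    Measure.isProbabilityMeasure_map (hWA.aemeasurable (le_max_right t 0))
  have hl : ∀ t, 0 < t → (opSqrt (covOp T Q t)).comp (lam T Q t) = T t := fun t ht =>
    covSqrt_comp_lam T Q t (opSqrt_injective (covOp_isPositive T hQ t)
      (covOp_injective T hQ hQker ht)) fun x => hrange t ht ⟨x, rfl⟩
  have hg : ∀ t, IsCenteredGaussian (convolutionLaw P WA t) (covOp T Q (max t 0)) := fun t =>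
    stochasticConvolution_law hQ hW hWA (le_max_right t 0)
  refine ⟨hp, measurable_of_continuous_charFun fun h => ?_, fun t ht => ?_,
    fun t _ => covOp_isPositive T hQ t, fun t ht => covOp_injective T hQ hQker ht, hl, hΛ,
    measurable_norm_lam T hQ hQker hl, hδ, hC⟩
  · simp only [hg _ h]
    have h1 : Continuous fun t : ℝ => ⟪covOp T Q (max t 0) h, h⟫ :=
      (continuousOn_inner_covOp T hQ h).comp_continuous (by fun_prop)
        (fun t => Set.mem_Ici.2 (le_max_right t 0))
    fun_prop
  · have := hg t
    rwa [max_eq_left ht.le] at this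

theorem ouSemigroup_eq_transOp (hWA : IsStochasticConvolution P T Q e W WA) {τ : ℝ} (hτ : 0 ≤ τ)
    {g : H → ℝ} (hg : Measurable g) (x : H) :
    ouSemigroup P T WA τ g x = transOp T (convolutionLaw P WA) τ g x := by
  rw [transOp, convolutionLaw, max_eq_left hτ, integral_map (hWA.aemeasurable hτ)]
  · rfl
  · exact (hg.comp (measurable_const_add _)).aestronglyMeasurable

theorem ou_sub_apply_ou (T : C0Semigroup H) (WA : ℝ → Ω → H) {r t : ℝ} (hr : 0 ≤ r) (hrt : r ≤ t)
    (x : H) (ω : Ω) : ou T WA t x ω - T (t - r) (ou T WA r x ω) =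
      WA t ω - T (t - r) (WA r ω) := by
  have h := T.map_add (t - r) r (by linarith) hr
  rw [sub_add_cancel] at h
  simp only [ou, map_add, h, ContinuousLinearMap.comp_apply]
  abel

/-- The factors `⟨Λ(rᵢ - rᵢ₊₁) B(Z_{rᵢ₊₁}), Q_{rᵢ - rᵢ₊₁}^{-1/2} (Z_{rᵢ} - e^{(rᵢ - rᵢ₊₁)A} Z_{rᵢ₊₁})⟩`. -/
def chaosFactor (P : Measure Ω) (T : C0Semigroup H) (Q : H →L[ℝ] H) (WA : ℝ → Ω → H) (B : H → H)
    (x : H) (t r : ℝ) (ω : Ω) : ℝ :=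
  whitePairing P (covOp T Q (t - r)) (fun ω' => lam T Q (t - r) (B (ou T WA r x ω')))
    (fun ω' => ou T WA t x ω' - T (t - r) (ou T WA r x ω')) ω

/-- Induction on the number of factors, removing the one at the latest time `r 0`. The remaining
product must be a measurable function of the earlier values of `W_A`, so that the new increment is
independent of it, and integrable; hence the three claims are proved together. The identity is
quantified over `f` because the step replaces `f` by `⟨B, D S_τ f⟩`. -/
theorem prod_chaosFactor (hN : IsOUFamily T Q (convolutionLaw P WA) δ C) (hQ : Q.IsPositive)
    (hW : IsCylindricalBM P W) (hWA : IsStochasticConvolution P T Q e W WA)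
    {B : H → H} (hB : Measurable B) {b : ℝ} (hb : ∀ y, ‖B y‖ ≤ b) (x : H) (n : ℕ)
    (r : Fin (n + 1) → ℝ) (hr : ∀ i : Fin n, r i.succ < r i.castSucc) (h0 : ∀ i, 0 ≤ r i) :
    (∃ ξ : (Fin (n + 1) → H) → ℝ, Measurable ξ ∧
      (fun ω => ∏ i : Fin n, chaosFactor P T Q WA B x (r i.castSucc) (r i.succ) ω) =ᵐ[P]
        fun ω => ξ fun i => WA (r i) ω) ∧
    Integrable (fun ω => ∏ i : Fin n, chaosFactor P T Q WA B x (r i.castSucc) (r i.succ) ω) P ∧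
    ∀ (f : H → ℝ) (M : ℝ), Measurable f → (∀ y, |f y| ≤ M) →
      ∫ ω, f (ou T WA (r 0) x ω) *
        ∏ i : Fin n, chaosFactor P T Q WA B x (r i.castSucc) (r i.succ) ω ∂P =
        transOp T (convolutionLaw P WA) (r (Fin.last n))
          (derivChain T (convolutionLaw P WA) B f fun i : Fin n => r i.castSucc - r i.succ) x := by
  induction n with
  | zero =>
    refine ⟨⟨fun _ => 1, measurable_const, by simp⟩, by simp, fun f M hf hM => ?_⟩
    simp only [Finset.univ_eq_empty, Finset.prod_empty, mul_one]
    exact ouSemigroup_eq_transOp hWA (h0 0) hf x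
  | succ n ih =>
    obtain ⟨⟨ξ, hξm, hξ⟩, hint, hE⟩ := ih (fun i => r i.succ) (fun i => hr i.succ) fun i => h0 _
    set X : Ω → ℝ := fun ω =>
      ∏ i : Fin n, chaosFactor P T Q WA B x (r i.castSucc.succ) (r i.succ.succ) ω with hX
    have h10 : r 1 < r 0 := hr 0
    set τ := r 0 - r 1 with hτ
    have hτ0 : 0 < τ := sub_pos.2 h10
    have := hN.prob τ
    have hanti : ∀ i : Fin (n + 1), r i.succ ≤ r 1 := fun i => by
      have : StrictAnti r := Fin.strictAnti_iff_succ_lt.2 hr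
      refine this.antitone ?_
      rw [← Fin.succ_zero_eq_one]
      exact Fin.succ_le_succ_iff.2 (Fin.zero_le i)
    obtain ⟨hYg, hind⟩ := stochasticConvolution_increment hQ hW hWA (h0 1) h10.le
      (fun i : Fin (n + 1) => r i.succ) fun i => ⟨h0 _, hanti i⟩
    set Y : Ω → H := fun ω => WA (r 0) ω - T τ (WA (r 1) ω) with hY
    set Z : Ω → Fin (n + 1) → H := fun ω i => WA (r i.succ) ω with hZ
    have hZm : AEMeasurable Z P := aemeasurable_pi_lambda _ fun i => hWA.aemeasurable (h0 _)
    have hYm : AEMeasurable Y P := (hWA.aemeasurable (h0 0)).sub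
      ((T τ).continuous.measurable.comp_aemeasurable (hWA.aemeasurable (h0 1)))
    have : IsProbabilityMeasure (P.map Y) := Measure.isProbabilityMeasure_map hYm
    have hYμ : P.map Y = convolutionLaw P WA τ := hYg.eq (hN.gaussian τ hτ0)
    set β : (Fin (n + 1) → H) → H := fun z => lam T Q τ (B (T (r 1) x + z 0)) with hβ
    have hβm : Measurable β := by
      refine (lam T Q τ).continuous.measurable.comp (hB.comp ?_)
      exact measurable_const.add (measurable_pi_apply 0)
    have hβb : ∀ z, ‖β z‖ ≤ ‖lam T Q τ‖ * b := fun z =>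
      ((lam T Q τ).le_opNorm _).trans (mul_le_mul_of_nonneg_left (hb _) (norm_nonneg _))
    obtain ⟨ρ, hρm, hρ, hρi, hρE⟩ := whitePairing_mul_integral hZm hYm hind hYμ
      (hN.gaussian τ hτ0) (hN.pos τ hτ0) (hN.inj τ hτ0) hβm hβb hξm (hint.congr hξ)
    have hfac : chaosFactor P T Q WA B x (r 0) (r 1) =
        whitePairing P (covOp T Q τ) (fun ω => β (Z ω)) Y := by
      have h1 : (fun ω' => ou T WA (r 0) x ω' - T (r 0 - r 1) (ou T WA (r 1) x ω')) = Y :=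
        funext fun ω => ou_sub_apply_ou T WA (h0 1) h10.le x ω
      unfold chaosFactor
      rw [h1]
      rfl
    have hprod : (fun ω => ∏ i : Fin (n + 1),
        chaosFactor P T Q WA B x (r i.castSucc) (r i.succ) ω) =ᵐ[P]
          fun ω => ρ (Z ω, Y ω) * ξ (Z ω) := by
      filter_upwards [hρ, hξ] with ω h1 h2
      rw [Fin.prod_univ_succ]
      refine congrArg₂ _ ?_ h2
      rw [← h1, ← hfac]
      rfl
    -- The increment is recovered from the first two values of `W_A` as `z 0 - e^{τA} z 1`.
    refine ⟨⟨fun z => ρ (fun i => z i.succ, z 0 - T τ (z 1)) * ξ fun i => z i.succ, ?_, hprod⟩,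
      hρi.congr hprod.symm, fun f M hf hM => ?_⟩
    · have hm1 : Measurable fun z : Fin (n + 2) → H => fun i : Fin (n + 1) => z i.succ := by
        fun_prop
      have hm2 : Measurable fun z : Fin (n + 2) → H => z 0 - T τ (z 1) :=
        (measurable_pi_apply 0).sub ((T τ).continuous.measurable.comp (measurable_pi_apply 1))
      exact (hρm.comp (hm1.prodMk hm2)).mul (hξm.comp hm1)
    · have hφm : Measurable fun p : (Fin (n + 1) → H) × H =>
          f (T τ (T (r 1) x + p.1 0) + p.2) := by
        refine hf.comp (Measurable.add ?_ measurable_snd)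
        refine (T τ).continuous.measurable.comp (measurable_const.add ?_)
        exact (measurable_pi_apply 0).comp measurable_fst
      -- Here `f (Z_{r 0})` is written as a function of the past and the increment, through `Z_{r 0}
      -- = e^{τA} Z_{r 1} + Y`.
      have h3 := hρE (fun p => f (T τ (T (r 1) x + p.1 0) + p.2)) M hφm fun p => hM _
      have h4 : ∫ ω, f (ou T WA (r 0) x ω) * ∏ i : Fin (n + 1),
          chaosFactor P T Q WA B x (r i.castSucc) (r i.succ) ω ∂P =
          ∫ ω, f (T τ (T (r 1) x + Z ω 0) + Y ω) * (ρ (Z ω, Y ω) * ξ (Z ω)) ∂P := by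
        refine integral_congr_ae (hprod.mono fun ω hω => ?_)
        simp only at hω
        simp only [hω]
        congr 2
        have h5 := ou_sub_apply_ou T WA (h0 1) h10.le x ω
        rw [sub_eq_iff_eq_add] at h5
        rw [h5, add_comm]
        rfl
      rw [h4, h3, derivChain_succ]
      have hm3 : Measurable fun y : H => (τ, (), y) := by fun_prop
      have h6 := hE (derivOp T (convolutionLaw P WA) B τ f) (M * ‖lam T Q τ‖ * b)
        ((hN.measurable_derivOp hB (A := Unit) (F := fun _ => f) (hf.comp measurable_snd)
          fun _ => ⟨M, hM⟩).comp hm3)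
        (hN.abs_derivOp_le hb hf hM hτ0)
      refine Eq.trans ?_ h6
      refine integral_congr_ae (hξ.mono fun ω hω => ?_)
      refine congrArg₂ _ ?_ hω.symm
      exact (hN.derivOp_eq_integral (B := B) hτ0 hf hM (T (r 1) x + WA (r 1) ω)).symm

end Chaos

/-! ### From simplex integrals to the stated ordered integrals -/

section Representation

theorem norm_le_supNorm {F : Type*} [NormedAddCommGroup F] {f : H → F} (hf : IsBdd f) (x : H) :
    ‖f x‖ ≤ supNorm f := le_ciSup hf x

theorem isBdd_of_le {F : Type*} [NormedAddCommGroup F] {f : H → F} {c : ℝ}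
    (h : ∀ x, ‖f x‖ ≤ c) : IsBdd f := ⟨c, by rintro _ ⟨x, rfl⟩; exact h x⟩

variable [CompleteSpace H] [TopologicalSpace.SeparableSpace H] [MeasurableSpace H] [BorelSpace H]
  {T : C0Semigroup H} {Q : H →L[ℝ] H} {Ω : Type*} [MeasurableSpace Ω] {P : Measure Ω}
  [IsProbabilityMeasure P] {ι : Type*} {e : HilbertBasis ι ℝ H} {W : ι → ℝ≥0 → Ω → ℝ}
  {WA : ℝ → Ω → H} {δ C : ℝ} {u₀ : H → ℝ} {B : H → H}

theorem chaosIntegrand_eq (x : H) (t : ℝ) {n : ℕ} (s : Fin n → ℝ) (ω : Ω) :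
    chaosIntegrand P T Q WA u₀ B t x s ω = u₀ (ou T WA t x ω) *
      ∏ i : Fin n, chaosFactor P T Q WA B x (t - prevTime s i) (t - s i) ω := by
  simp only [chaosIntegrand, chaosFactor, sub_sub_sub_cancel_left]

/-- The reversed times `rᵢ = t - sᵢ`, with `s₀ = 0`, decrease from `t` and their gaps are `sᵢ -
sᵢ₋₁`, so `prod_chaosFactor` applies. Boundedness of `u₀` preserves integrability. -/
theorem integral_chaosIntegrand (hN : IsOUFamily T Q (convolutionLaw P WA) δ C) (hQ : Q.IsPositive)
    (hW : IsCylindricalBM P W) (hWA : IsStochasticConvolution P T Q e W WA)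
    (hB : Measurable B) {b : ℝ} (hb : ∀ y, ‖B y‖ ≤ b) (hu : Measurable u₀) {M : ℝ}
    (hM : ∀ y, |u₀ y| ≤ M) {t : ℝ} (ht : 0 ≤ t) (x : H) {n : ℕ} {s : Fin n → ℝ}
    (hs : s ∈ timeSimplex n t) :
    Integrable (chaosIntegrand P T Q WA u₀ B t x s) P ∧
      ∫ ω, chaosIntegrand P T Q WA u₀ B t x s ω ∂P =
        chainIntegrand T (convolutionLaw P WA) B u₀ t s x := by
  have hr : ∀ i : Fin n, t - Fin.cons (α := fun _ => ℝ) 0 s i.succ <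
      t - Fin.cons (α := fun _ => ℝ) 0 s i.castSucc := fun i => by
    have := gaps_pos hs i
    simp only [gaps, prevTime] at this
    simp only [Fin.cons_succ]
    linarith
  have h0 : ∀ i : Fin (n + 1), 0 ≤ t - Fin.cons (α := fun _ => ℝ) 0 s i := fun i => by
    refine Fin.cases ?_ (fun i => ?_) i
    · simpa using ht
    · simpa using (hs.2 i).2.le
  obtain ⟨-, h1, h2⟩ := prod_chaosFactor hN hQ hW hWA hB hb x n
    (fun i => t - Fin.cons (α := fun _ => ℝ) 0 s i) hr h0
  have h3 := h2 u₀ M hu hM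
  have hfun : chaosIntegrand P T Q WA u₀ B t x s = fun ω => u₀ (ou T WA t x ω) *
      ∏ i : Fin n, chaosFactor P T Q WA B x (t - prevTime s i) (t - s i) ω :=
    funext fun ω => chaosIntegrand_eq x t s ω
  rw [hfun]
  constructor
  · refine h1.bdd_mul (c := M) ?_ (Eventually.of_forall fun ω => hM _)
    exact (hu.comp_aemeasurable ((hWA.aemeasurable ht).const_add _)).aestronglyMeasurable
  · simp only [Fin.cons_zero, sub_zero, Fin.cons_succ, sub_sub_sub_cancel_left] at h3
    exact h3

theorem orderedIntegral_prod_lam {n : ℕ} (hN : IsOUFamily T Q (convolutionLaw P WA) δ C) {t : ℝ}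
    (ht : 0 ≤ t) : orderedIntegral n t (fun s => ∏ i : Fin n, ‖lam T Q (s i - prevTime s i)‖) =
      ∫ s in timeSimplex n t, ∏ i, lamNorm T Q (gaps s i) := by
  have h : Set.EqOn (fun s : Fin n → ℝ => ∏ i, lamNorm T Q (gaps s i))
      (fun s => ∏ i : Fin n, ‖lam T Q (s i - prevTime s i)‖) (timeSimplex n t) := fun s hs =>
    Finset.prod_congr rfl fun i _ => lamNorm_of_pos T Q (gaps_pos hs i)
  rw [orderedIntegral_eq_setIntegral ht
    ((hN.integrableOn_prod_lamNorm' n t).congr_fun h (measurableSet_timeSimplex n t))]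
  exact (setIntegral_congr_fun (measurableSet_timeSimplex n t) h).symm

theorem orderedIntegral_prod_lam_snoc {n : ℕ} (hN : IsOUFamily T Q (convolutionLaw P WA) δ C)
    {t : ℝ} (ht : 0 < t) : orderedIntegral n t (fun s => ∏ i : Fin (n + 1),
      ‖lam T Q (Fin.snoc (α := fun _ => ℝ) s t i -
        prevTime (Fin.snoc (α := fun _ => ℝ) s t) i)‖) =
      ∫ s in timeSimplex n t, ∏ i, lamNorm T Q (gaps (Fin.snoc (α := fun _ => ℝ) s t) i) := by
  have h : Set.EqOn
      (fun s : Fin n → ℝ => ∏ i, lamNorm T Q (gaps (Fin.snoc (α := fun _ => ℝ) s t) i))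
      (fun s => ∏ i : Fin (n + 1), ‖lam T Q (Fin.snoc (α := fun _ => ℝ) s t i -
        prevTime (Fin.snoc (α := fun _ => ℝ) s t) i)‖) (timeSimplex n t) := fun s hs =>
    Finset.prod_congr rfl fun i _ => lamNorm_of_pos T Q (gaps_pos
      -- Membership in the simplex with horizon `t + 1` suffices to make all gaps positive,
      -- including the last one `t - sₙ`.
      (snoc_mem_timeSimplex.2 ⟨⟨ht, lt_add_one t⟩, hs⟩) i)
  rw [orderedIntegral_eq_setIntegral ht.le
    ((hN.integrableOn_prod_lamNorm_snoc n ht).congr_fun h (measurableSet_timeSimplex n t))]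
  exact (setIntegral_congr_fun (measurableSet_timeSimplex n t) h).symm

end Representation

end Kolmogorov

end

/-! ### The main theorem -/

open Kolmogorov in
theorem mainTheorem3
    {H : Type*} [NormedAddCommGroup H] [InnerProductSpace ℝ H] [CompleteSpace H]
    [TopologicalSpace.SeparableSpace H] [MeasurableSpace H] [BorelSpace H]
    -- the semigroup `e^{tA}` with generator `A`
    (A : H →ₗ.[ℝ] H) (T : C0Semigroup H) (hA : IsGenerator A T)
    -- the operator `Q`, nonnegative, self-adjoint and injective, with `Q_t` of trace class
    (Q : H →L[ℝ] H) (hQ : Q.IsPositive) (hQker : ∀ x, Q x = 0 → x = 0)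
    (hQt : ∀ t, 0 < t → IsTraceClass (covOp T Q t))
    -- `e^{tA}(H) ⊆ Q_t^{1/2}(H)`
    (hrange : ∀ t, 0 < t → Set.range (T t) ⊆ Set.range (opSqrt (covOp T Q t)))
    -- `‖Λ(t)‖ ≤ C_δ / t^δ`
    (δ C : ℝ) (hδ : 0 < δ ∧ δ < 1) (hC : 0 < C)
    (hΛ : ∀ t, 0 < t → ‖lam T Q t‖ ≤ C / t ^ δ)
    -- the cylindrical Brownian motion and the stochastic convolution
    {Ω : Type*} [MeasurableSpace Ω] (P : MeasureTheory.Measure Ω)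
    [MeasureTheory.IsProbabilityMeasure P]
    {ι : Type*} (e : HilbertBasis ι ℝ H) (W : ι → NNReal → Ω → ℝ) (hW : IsCylindricalBM P W)
    (WA : ℝ → Ω → H) (hWA : IsStochasticConvolution P T Q e W WA)
    -- the data
    (u₀ : H → ℝ) (hu₀ : Measurable u₀) (hu₀b : IsBdd u₀)
    (B : H → H) (hB : Measurable B) (hBb : IsBdd B) :
    -- the integrals defining the iterates exist
    (∀ (m : ℕ) (t : ℝ) (x : H), 0 ≤ t →
      IntervalIntegrable (fun s => ouSemigroup P T WA (t - s)
        (fun y => fderiv ℝ (iterate P T WA u₀ B m s) y (B y)) x) MeasureTheory.volume 0 t) ∧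
    ∀ (n : ℕ), 1 ≤ n → ∀ t : ℝ, 0 ≤ t →
      -- the representation formula, all integrals in it being absolutely convergent
      (∀ x : H,
        (∀ s ∈ timeSimplex n t,
          MeasureTheory.Integrable (chaosIntegrand P T Q WA u₀ B t x s) P) ∧
        MeasureTheory.IntegrableOn
          (fun s : Fin n → ℝ => ∫ ω, chaosIntegrand P T Q WA u₀ B t x s ω ∂P)
          (timeSimplex n t) ∧
        iterate P T WA u₀ B n t x =
          orderedIntegral n t (fun s => ∫ ω, chaosIntegrand P T Q WA u₀ B t x s ω ∂P)) ∧
      -- regularity and the two bounds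
      IsCb1 (iterate P T WA u₀ B n t) ∧
      supNorm (iterate P T WA u₀ B n t) ≤
        supNorm u₀ * supNorm B ^ n *
          orderedIntegral n t (fun s => ∏ i : Fin n, ‖lam T Q (s i - prevTime s i)‖) ∧
      supNorm (fderiv ℝ (iterate P T WA u₀ B n t)) ≤
        supNorm u₀ * supNorm B ^ n *
          orderedIntegral n t (fun s =>
            ∏ i : Fin (n + 1), ‖lam T Q (Fin.snoc (α := fun _ => ℝ) s t i -
              prevTime (Fin.snoc (α := fun _ => ℝ) s t) i)‖) := by
  obtain ⟨b, hb⟩ : ∃ b, b = supNorm B := ⟨_, rfl⟩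
  obtain ⟨M, hM'⟩ : ∃ M, M = supNorm u₀ := ⟨_, rfl⟩
  have hBb' : ∀ y, ‖B y‖ ≤ b := fun y => hb ▸ norm_le_supNorm hBb y
  have hM : ∀ y, |u₀ y| ≤ M := fun y => hM' ▸ norm_le_supNorm hu₀b y
  have hN := isOUFamily_convolutionLaw (P := P) (e := e) hQ hQker hrange hδ hC hΛ hW hWA
  have hS : ∀ τ, 0 ≤ τ → ∀ (g : H → ℝ), Measurable g → ∀ x,
      ouSemigroup P T WA τ g x = transOp T (convolutionLaw P WA) τ g x :=
    fun τ hτ g hg x => ouSemigroup_eq_transOp hWA hτ hg x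
  have hit := fun n => hN.iterate_eq hS hB hBb' hu₀ hM n
  refine ⟨fun m t x ht => (hN.integral_iterate_step hS hB hBb' hu₀ hM m (hit m) ht x).1,
    fun n hn t ht => ⟨fun x => ?_, ?_⟩⟩
  · have hE := fun s hs => integral_chaosIntegrand hN hQ hW hWA hB hBb' hu₀ hM ht x (s := s)
      (n := n) hs
    have hi : MeasureTheory.IntegrableOn
        (fun s : Fin n → ℝ => ∫ ω, chaosIntegrand P T Q WA u₀ B t x s ω ∂P) (timeSimplex n t) :=
      (hN.integrableOn_chainIntegrand hB hBb' hu₀ hM t n x).congr_fun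
        (fun s hs => (hE s hs).2.symm) (measurableSet_timeSimplex n t)
    refine ⟨fun s hs => (hE s hs).1, hi, ?_⟩
    rw [hit n t ht, orderedIntegral_eq_setIntegral ht hi]
    exact MeasureTheory.setIntegral_congr_fun (measurableSet_timeSimplex n t)
      (fun s hs => (hE s hs).2.symm)
  -- At `t = 0` the smoothing argument is unavailable, but `n ≥ 1` makes the iterate an integral
  -- over an empty interval, so every quantity is zero.
  · rcases ht.eq_or_lt with rfl | ht0
    · obtain ⟨m, rfl⟩ : ∃ m, n = m + 1 := ⟨n - 1, by omega⟩
      have h0 : iterate P T WA u₀ B (m + 1) 0 = fun _ => 0 := by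
        funext x
        simp [iterate]
      rw [h0]
      simp [orderedIntegral, IsCb1, IsBdd, supNorm]
    · have hfun : iterate P T WA u₀ B n t = fun x => ∫ s in timeSimplex n t,
          chainIntegrand T (convolutionLaw P WA) B u₀ t s x := funext (hit n t ht)
      have h1 : ∀ x, ‖iterate P T WA u₀ B n t x‖ ≤ supNorm u₀ * supNorm B ^ n *
          orderedIntegral n t (fun s => ∏ i : Fin n, ‖lam T Q (s i - prevTime s i)‖) := fun x => by
        rw [hfun, orderedIntegral_prod_lam hN ht, ← hb, ← hM', ← MeasureTheory.integral_const_mul]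
        exact MeasureTheory.norm_integral_le_of_norm_le
          ((hN.integrableOn_prod_lamNorm' n t).const_mul _)
          (Filter.Eventually.of_forall fun s =>
            hN.abs_chainIntegrand_le hB hBb' hu₀ hM t s x)
      have h2 : ∀ x, DifferentiableAt ℝ (iterate P T WA u₀ B n t) x ∧
          ‖fderiv ℝ (iterate P T WA u₀ B n t) x‖ ≤ supNorm u₀ * supNorm B ^ n *
          orderedIntegral n t (fun s =>
            ∏ i : Fin (n + 1), ‖lam T Q (Fin.snoc (α := fun _ => ℝ) s t i -
              prevTime (Fin.snoc (α := fun _ => ℝ) s t) i)‖) := fun x => by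
        obtain ⟨D, hD, -, hDb⟩ :=
          hN.hasFDerivAt_integral_chainIntegrand hB hBb' hu₀ hM ht0 n x
        rw [hfun, hD.fderiv, orderedIntegral_prod_lam_snoc hN ht0, ← hb, ← hM']
        exact ⟨hD.differentiableAt, hDb⟩
      exact ⟨⟨fun x => (h2 x).1, isBdd_of_le h1, isBdd_of_le fun x => (h2 x).2⟩,
        ciSup_le h1, ciSup_le fun x => (h2 x).2⟩
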